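/- Work in $\mathbb C^3$ with coordinates $(x,y_1,y_2)$, put $\mathbf y=(y_1,y_2)$, $v=y_1y_2$, let $\mathfrak m\subset\mathbb C[[x,\mathbf y]]$ be the maximal ideal, $\omega=\frac{dy_1\wedge dy_2}{x}$, and let $\langle dx\rangle$ be the ideal generated by $dx$ in the algebra of formal differential forms. A formal vector field $Y$ vanishing at $0$ is *transversally Hamiltonian* if $\mathcal L_Y(dx)\in\langle dx\rangle$ and $x\mathcal L_Y(\omega)\in\langle dx\rangle$. A formal diffeomorphism $\Phi$ fixing $0$ is *fibered* if $\Phi^*x=x$, and *transversally symplectic* if moreover $x\Phi^*\omega\in x\omega+\langle dx\rangle$. Write $\Phi_*Y=(D\Phi\cdot Y)\circ\Phi^{-1}$. For $\lambda\in\mathbb C^*$, a *prepared form with eigenvalue $\lambda$* is a formal vector field $$x^2\partial_x+(-\lambda y_1+F_1(x,\mathbf y))\partial_{y_1}+(\lambda y_2+F_2(x,\mathbf y))\partial_{y_2},\qquad F_1,F_2\in\mathfrak m^2,$$ and a *transversally Hamiltonian doubly-resonant saddle-node with eigenvalue $\lambda$* is a transversally Hamiltonian $Y$ such that $\Phi_*Y$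 is a prepared form with eigenvalue $\lambda$ for some transversally symplectic $\Phi$. The residue $\mathrm{res}(Y)$ is the coefficient of $x$ in $\mathrm{Tr}\,A(x)$, where $A(x)=\left(\frac{\partial Z_i}{\partial y_j}(x,0)\right)_{i,j=1,2}$ and $Z=(Z_0,Z_1,Z_2)$ is any prepared form that is conjugate to $Y$ by a fibered formal diffeomorphism. Say that $\Phi$ *normalizes* $Y$ with parameters $(\lambda,a_1,a_2,c)$, where $\lambda\in\mathbb C^*$, $a_1,a_2\in\mathbb C$, $a_1+a_2=1$ and $c\in v\mathbb C[[v]]$, if $\Phi$ is transversally symplectic and $$\Phi_*Y=x^2\partial_x+\big(-\lambda+a_1x-c(v)\big)y_1\partial_{y_1}+\big(\lambda+a_2x+c(v)\big)y_2\partial_{y_2}.$$ **Corollary.** Let $Y$ be a transversally Hamiltonian doubly-resonant saddle-node with eigenvalue $\lambda$. 1. There are $a_1,a_2\in\mathbb C$ with $a_1+a_2=1$, a series $c\in v\mathbb C[[v]]$ and a transversally symplectic formal diffeomorphism $\Phi$ that normalizes $Y$ with parameters $(\lambda,a_1,a_2,c)$, such that $(\Phi_{|\{x=0\}})^*(dy_1\wedge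 dy_2)=dy_1\wedge dy_2$ and: if $Y$ is analytic at the origin (i.e. its components are convergent power series), then $\Phi_{|\{x=0\}}$ is a germ of an analytic diffeomorphism of $(\mathbb C^2,0)$ and $c\in v\mathbb C\{v\}$ is convergent. For the convergence of $c$ it suffices that $Y_{|\{x=0\}}$ is analytic. 2. The residue of $Y$ is well defined, and $\mathrm{res}(Y)=1$. 3. $\Phi$ is unique up to linear symplectic transformations: if $\Phi$ and $\Psi$ normalize $Y$ (with possibly different parameters), then $\Psi=L\circ\Phi$ with $L(x,\mathbf y)=(x,M\mathbf y)$ for some $M\in\mathrm{SL}_2(\mathbb C)$. -/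

import Mathlib

open MvPowerSeries

noncomputable section

namespace SaddleNode

/-- Formal power series in `n` variables over `ℂ`. For `n = 3` the variables `0, 1, 2` are
`x, y₁, y₂`; for `n = 2` the variables `0, 1` are `y₁, y₂`. -/
abbrev Ser (n : ℕ) : Type := MvPowerSeries (Fin n) ℂ

/-- The maximal ideal `𝔪`: series with null constant term. -/
def maxIdeal (n : ℕ) : Ideal (Ser n) := RingHom.ker (constantCoeff (σ := Fin n) (R := ℂ))

/-- The series `f` converges (absolutely) on some polydisc around the origin, i.e. it is the
Taylor series of an analytic germ. -/
def IsConvergent {σ : Type*} (f : MvPowerSeries σ ℂ) : Prop :=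
  ∃ r : ℝ, 0 < r ∧ Summable fun k : σ →₀ ℕ => ‖coeff k f‖ * r ^ k.degree

/-! ### Formal vector fields, differential forms, diffeomorphisms -/

section Calculus

variable {n : ℕ}

/-- `X = ∑ Xᵢ ∂/∂xᵢ` acting on series as a derivation. -/
def lie (X : Fin n → Ser n) (f : Ser n) : Ser n := ∑ i, X i * pderiv ℂ i f

/-- Differential of a function: the `1`-form with components `∂f/∂xᵢ`. -/
def d0 (f : Ser n) : Fin n → Ser n := fun i => pderiv ℂ i f

/-- Exterior product of two `1`-forms. A `2`-form is represented by the antisymmetric matrix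
`θ` of its components, `θ = ∑_{i<j} θᵢⱼ dxᵢ ∧ dxⱼ`. -/
def wedge (α β : Fin n → Ser n) : Matrix (Fin n) (Fin n) (Ser n) :=
  Matrix.of fun i j => α i * β j - α j * β i

/-- Jacobian matrix `∂Φᵢ/∂xⱼ`. -/
def jac (Φ : Fin n → Ser n) : Matrix (Fin n) (Fin n) (Ser n) :=
  Matrix.of fun i j => pderiv ℂ j (Φ i)

/-- Lie derivative of the `1`-form `∑ αᵢ dxᵢ`. -/
def lie1 (X : Fin n → Ser n) (α : Fin n → Ser n) : Fin n → Ser n :=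
  fun i => lie X (α i) + ∑ k, α k * pderiv ℂ i (X k)

/-- Lie derivative of the `2`-form with component matrix `θ`. -/
def lie2 (X : Fin n → Ser n) (θ : Matrix (Fin n) (Fin n) (Ser n)) :
    Matrix (Fin n) (Fin n) (Ser n) :=
  θ.map (lie X) + (jac X).transpose * θ + θ * jac X

/-- `Φ` is a formal diffeomorphism fixing the origin of `ℂⁿ`. -/
def IsFormalDiffeo (Φ : Fin n → Ser n) : Prop :=
  (∀ i, constantCoeff (Φ i) = 0) ∧ IsUnit ((jac Φ).map (constantCoeff (R := ℂ))).det

/-- `Φ` is a germ of analytic diffeomorphism of `(ℂⁿ, 0)`. -/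
def IsAnalyticDiffeo (Φ : Fin n → Ser n) : Prop :=
  IsFormalDiffeo Φ ∧ ∀ i, IsConvergent (Φ i)

/-- Pull-back of the `2`-form with component matrix `θ`. -/
def pullback2 (Φ : Fin n → Ser n) (θ : Matrix (Fin n) (Fin n) (Ser n)) :
    Matrix (Fin n) (Fin n) (Ser n) :=
  (jac Φ).transpose * θ.map (subst Φ) * jac Φ

/-- `Φ_* Y = Z`, i.e. `(DΦ · Y) ∘ Φ⁻¹ = Z`, written as `DΦ · Y = Z ∘ Φ`
(used for formal diffeomorphisms `Φ` only). -/
def PushesTo (Φ Y Z : Fin n → Ser n) : Prop :=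
  ∀ i, lie Y (Φ i) = subst Φ (Z i)

end Calculus

/-! ### Restriction to `{x = 0}` -/

/-- `f(0, y₁, y₂)`. -/
def restr (f : Ser 3) : Ser 2 := subst (![0, X 0, X 1] : Fin 3 → Ser 2) f

/-- The `y`-components of a map or vector field of `(ℂ³, 0)`, restricted to `{x = 0}`. -/
def restrMap (Φ : Fin 3 → Ser 3) : Fin 2 → Ser 2 := ![restr (Φ 1), restr (Φ 2)]

/-- `dy₁ ∧ dy₂` on `ℂ²`. -/
def area2 : Matrix (Fin 2) (Fin 2) (Ser 2) := wedge (d0 (X 0)) (d0 (X 1))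

/-! ### Transversal structures on `ℂ³` -/

/-- `dx`. -/
def dx : Fin 3 → Ser 3 := d0 (X 0)

/-- `dy₁ ∧ dy₂ = x ω` on `ℂ³`. -/
def area3 : Matrix (Fin 3) (Fin 3) (Ser 3) := wedge (d0 (X 1)) (d0 (X 2))

/-- The `1`-form `α` lies in the ideal `⟨dx⟩`. -/
def InDx1 (α : Fin 3 → Ser 3) : Prop := ∃ g : Ser 3, α = fun i => g * dx i

/-- The `2`-form `θ` lies in the ideal `⟨dx⟩`. -/
def InDx2 (θ : Matrix (Fin 3) (Fin 3) (Ser 3)) : Prop := ∃ η : Fin 3 → Ser 3, θ = wedge dx η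

/-- The singular formal vector field `Y` is transversally Hamiltonian with respect to
`ω = (dy₁ ∧ dy₂) / x` and `dx`: `L_Y(dx) ∈ ⟨dx⟩` and `x L_Y(ω) ∈ ⟨dx⟩`.
With `q = L_Y(x) / x`, one has `x L_Y(ω) = L_Y(dy₁ ∧ dy₂) - q dy₁ ∧ dy₂`. -/
def IsTransHam (Y : Fin 3 → Ser 3) : Prop :=
  (∀ i, constantCoeff (Y i) = 0) ∧ InDx1 (lie1 Y dx) ∧
    ∃ q : Ser 3, lie Y (X 0) = X 0 * q ∧ InDx2 (lie2 Y area3 - q • area3)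

/-- `Φ` is a fibered formal diffeomorphism `(x, y) ↦ (x, φ(x, y))`. -/
def IsFibered (Φ : Fin 3 → Ser 3) : Prop := IsFormalDiffeo Φ ∧ Φ 0 = X 0

/-- `Φ` is transversally symplectic: `Φ^* x = x` and `x Φ^* ω ∈ x ω + ⟨dx⟩`
(where `x Φ^* ω = Φ^* (dy₁ ∧ dy₂)` because `Φ^* x = x`). -/
def IsTransSymplectic (Φ : Fin 3 → Ser 3) : Prop :=
  IsFibered Φ ∧ InDx2 (pullback2 Φ area3 - area3)

/-! ### Doubly-resonant saddle-nodes -/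

/-- `Y = x² ∂_x + (-l y₁ + F₁) ∂_{y₁} + (l y₂ + F₂) ∂_{y₂}` with `l ≠ 0` and
`F₁, F₂ ∈ 𝔪²`. -/
def IsPrepared (l : ℂ) (Y : Fin 3 → Ser 3) : Prop :=
  l ≠ 0 ∧ ∃ F₁ ∈ maxIdeal 3 ^ 2, ∃ F₂ ∈ maxIdeal 3 ^ 2,
    Y = ![X 0 ^ 2, -(C l * X 1) + F₁, C l * X 2 + F₂]

/-- `Y` is a transversally Hamiltonian doubly-resonant saddle-node, conjugate by a transversally
symplectic diffeomorphism to a prepared form with eigenvalues `-l, l`. -/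
def IsTransHamSaddleNode (l : ℂ) (Y : Fin 3 → Ser 3) : Prop :=
  IsTransHam Y ∧ ∃ Φ Z, IsTransSymplectic Φ ∧ PushesTo Φ Y Z ∧ IsPrepared l Z

/-- `r` is the residue of the doubly-resonant saddle-node `Y`: for some prepared form `Z` of `Y`
under fibered conjugacy, `r = (Tr A(x) / x)` at `x = 0`, where `A(x) = (∂Zᵢ/∂yⱼ)(x, 0)`. -/
def IsResidue (Y : Fin 3 → Ser 3) (r : ℂ) : Prop :=
  ∃ Φ Z, IsFibered Φ ∧ PushesTo Φ Y Z ∧ (∃ l, IsPrepared l Z) ∧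
    r = coeff (Finsupp.single 0 1) (pderiv ℂ 1 (Z 1) + pderiv ℂ 2 (Z 2))

/-- The vector field
`x² ∂_x + (-l + a₁ x - c(v)) y₁ ∂_{y₁} + (l + a₂ x + c(v)) y₂ ∂_{y₂}`, `v = y₁ y₂`. -/
def normalForm (l a₁ a₂ : ℂ) (c : PowerSeries ℂ) : Fin 3 → Ser 3 :=
  let cv : Ser 3 := PowerSeries.subst (X 1 * X 2 : Ser 3) c
  ![X 0 ^ 2, (-C l + C a₁ * X 0 - cv) * X 1, (C l + C a₂ * X 0 + cv) * X 2]

/-- `Φ` is a transversally symplectic diffeomorphism bringing `Y` to the normal form with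
parameters `l ≠ 0`, `a₁ + a₂ = 1` and `c ∈ v ℂ⟦v⟧`. -/
def Normalizes (Φ Y : Fin 3 → Ser 3) (l a₁ a₂ : ℂ) (c : PowerSeries ℂ) : Prop :=
  IsTransSymplectic Φ ∧ l ≠ 0 ∧ a₁ + a₂ = 1 ∧ PowerSeries.constantCoeff c = 0 ∧
    PushesTo Φ Y (normalForm l a₁ a₂ c)

/-- The linear map `(x, y) ↦ (x, M y)` applied to the map `Φ`. -/
def linComp (M : Matrix (Fin 2) (Fin 2) ℂ) (Φ : Fin 3 → Ser 3) : Fin 3 → Ser 3 :=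
  ![Φ 0, C (M 0 0) * Φ 1 + C (M 0 1) * Φ 2, C (M 1 0) * Φ 1 + C (M 1 1) * Φ 2]

end SaddleNode

end

open SaddleNode

noncomputable section

namespace SaddleNode

/-! ### Coefficientwise multipliers and the filtration by order. -/

section Coefficients

variable {σ τ ι : Type*}

/-- Multiplication of the coefficient of index `k` by `μ k`. -/
def mulCoeff (μ : (σ →₀ ℕ) → ℂ) (f : MvPowerSeries σ ℂ) : MvPowerSeries σ ℂ :=
  fun k => μ k * coeff k f

@[simp] lemma coeff_mulCoeff (μ : (σ →₀ ℕ) → ℂ) (f : MvPowerSeries σ ℂ) (k : σ →₀ ℕ) :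
    coeff k (mulCoeff μ f) = μ k * coeff k f := rfl

/-- The ideal of series all of whose terms have degree at least `d`. -/
def ordIdeal (σ : Type*) (d : ℕ) : Ideal (MvPowerSeries σ ℂ) where
  carrier := {f | ∀ k : σ →₀ ℕ, k.degree < d → coeff k f = 0}
  zero_mem' := fun k _ => by simp
  add_mem' := fun {f g} hf hg k hk => by simp [hf k hk, hg k hk]
  smul_mem' := fun c f hf k hk => by
    classical
    rw [smul_eq_mul, coeff_mul]
    refine Finset.sum_eq_zero fun p hp => ?_
    rw [Finset.HasAntidiagonal.mem_antidiagonal] at hp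
    have : p.2.degree < d := by
      have := congrArg Finsupp.degree hp
      rw [map_add] at this
      omega
    rw [hf _ this, mul_zero]

lemma mem_ordIdeal {d : ℕ} {f : MvPowerSeries σ ℂ} :
    f ∈ ordIdeal σ d ↔ ∀ k : σ →₀ ℕ, k.degree < d → coeff k f = 0 := Iff.rfl

lemma ordIdeal_mono {d e : ℕ} (h : d ≤ e) : ordIdeal σ e ≤ ordIdeal σ d :=
  fun _ hf k hk => hf k (hk.trans_le h)

@[simp] lemma ordIdeal_zero : ordIdeal σ 0 = ⊤ := by
  ext f; simp [mem_ordIdeal]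

lemma mem_ordIdeal_one {f : MvPowerSeries σ ℂ} :
    f ∈ ordIdeal σ 1 ↔ constantCoeff f = 0 := by
  refine ⟨fun h => ?_, fun h k hk => ?_⟩
  · rw [← coeff_zero_eq_constantCoeff_apply]; exact h 0 (by simp)
  · have : k = 0 := by rw [← Finsupp.degree_eq_zero_iff]; omega
    rw [this, coeff_zero_eq_constantCoeff_apply, h]

lemma eq_of_forall_sub_mem_ordIdeal {f g : MvPowerSeries σ ℂ}
    (h : ∀ d, f - g ∈ ordIdeal σ d) : f = g := by
  ext k
  have := h (k.degree + 1) k (Nat.lt_succ_self _)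
  rwa [map_sub, sub_eq_zero] at this

lemma mul_mem_ordIdeal {d e : ℕ} {f g : MvPowerSeries σ ℂ} (hf : f ∈ ordIdeal σ d)
    (hg : g ∈ ordIdeal σ e) : f * g ∈ ordIdeal σ (d + e) := by
  classical
  intro k hk
  rw [coeff_mul]
  refine Finset.sum_eq_zero fun p hp => ?_
  rw [Finset.HasAntidiagonal.mem_antidiagonal] at hp
  have h := congrArg Finsupp.degree hp
  rw [map_add] at h
  by_cases h1 : p.1.degree < d
  · rw [hf _ h1, zero_mul]
  · rw [hg _ (by omega), mul_zero]

lemma mulCoeff_mem_ordIdeal {d : ℕ} {f : MvPowerSeries σ ℂ} (μ : (σ →₀ ℕ) → ℂ)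
    (hf : f ∈ ordIdeal σ d) : mulCoeff μ f ∈ ordIdeal σ d :=
  fun k hk => by rw [coeff_mulCoeff, hf k hk, mul_zero]

lemma pderiv_mem_ordIdeal {d : ℕ} {f : MvPowerSeries σ ℂ} (i : σ)
    (hf : f ∈ ordIdeal σ (d + 1)) : pderiv ℂ i f ∈ ordIdeal σ d := by
  intro k hk
  rw [coeff_pderiv, hf, zero_mul]
  rw [map_add, Finsupp.degree_single]; omega

lemma X_mem_ordIdeal (i : σ) : (X i : MvPowerSeries σ ℂ) ∈ ordIdeal σ 1 :=
  mem_ordIdeal_one.2 (by simp)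

lemma maxIdeal_sq_le {n : ℕ} : maxIdeal n ^ 2 ≤ ordIdeal (Fin n) 2 := by
  rw [pow_two, Ideal.mul_le]
  intro f hf g hg
  exact mul_mem_ordIdeal (d := 1) (e := 1) (mem_ordIdeal_one.2 hf) (mem_ordIdeal_one.2 hg)

/-- `X i * ∂/∂X i`. -/
lemma coeff_X_mul_pderiv (i : σ) (f : MvPowerSeries σ ℂ) (k : σ →₀ ℕ) :
    coeff k (X i * pderiv ℂ i f) = k i * coeff k f := by
  classical
  rw [X, coeff_monomial_mul, one_mul]
  split_ifs with h
  · rw [coeff_pderiv, tsub_add_cancel_of_le h]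
    have hi : 1 ≤ k i := by simpa using h i
    rw [Finsupp.tsub_apply, Finsupp.single_eq_same, Nat.cast_sub hi]
    push_cast; ring
  · have : k i = 0 := by
      by_contra hk
      exact h (Finsupp.single_le_iff.2 (Nat.one_le_iff_ne_zero.2 hk))
    simp [this]

lemma X_mul_pderiv_eq_mulCoeff (i : σ) (f : MvPowerSeries σ ℂ) :
    X i * pderiv ℂ i f = mulCoeff (fun k => (k i : ℂ)) f := by
  ext k; rw [coeff_X_mul_pderiv, coeff_mulCoeff]

lemma X_dvd_mulCoeff {i : σ} {f : MvPowerSeries σ ℂ} (μ : (σ →₀ ℕ) → ℂ)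
    (hf : X i ∣ f) : X i ∣ mulCoeff μ f := by
  rw [X_dvd_iff] at hf ⊢
  intro k hk; rw [coeff_mulCoeff, hf k hk, mul_zero]

lemma X_dvd_pderiv {i j : σ} (hij : j ≠ i) {f : MvPowerSeries σ ℂ}
    (hf : X i ∣ f) : X i ∣ pderiv ℂ j f := by
  obtain ⟨g, rfl⟩ := hf
  rw [Derivation.leibniz, pderiv_X_of_ne hij.symm]
  simp

end Coefficients

/-! ### Substitution of series without constant term. -/

section Substitution

variable {σ τ ρ : Type*} [Finite σ]

/-- A family of series without constant terms. -/
def ZeroConst (a : σ → MvPowerSeries τ ℂ) : Prop := ∀ i, constantCoeff (a i) = 0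

lemma ZeroConst.hasSubst {a : σ → MvPowerSeries τ ℂ} (ha : ZeroConst a) : HasSubst a :=
  hasSubst_of_constantCoeff_zero ha

lemma subst_const_zero {a : σ → MvPowerSeries τ ℂ} (ha : ZeroConst a) :
    subst a (0 : MvPowerSeries σ ℂ) = 0 := by
  rw [← coe_substAlgHom ha.hasSubst, map_zero]

lemma subst_const_one {a : σ → MvPowerSeries τ ℂ} (ha : ZeroConst a) :
    subst a (1 : MvPowerSeries σ ℂ) = 1 := by
  rw [← coe_substAlgHom ha.hasSubst, map_one]

lemma subst_neg {a : σ → MvPowerSeries τ ℂ} (ha : ZeroConst a) (f : MvPowerSeries σ ℂ) :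
    subst a (-f) = -subst a f := by
  rw [← coe_substAlgHom ha.hasSubst, map_neg]

lemma subst_sum {ι : Type*} {a : σ → MvPowerSeries τ ℂ} (ha : ZeroConst a) (s : Finset ι)
    (f : ι → MvPowerSeries σ ℂ) : subst a (∑ i ∈ s, f i) = ∑ i ∈ s, subst a (f i) := by
  rw [← coe_substAlgHom ha.hasSubst, map_sum]

lemma zeroConst_X {σ : Type*} : ZeroConst (X : σ → MvPowerSeries σ ℂ) := fun i => by simp

lemma constantCoeff_subst_of_zeroConst {a : σ → MvPowerSeries τ ℂ} (ha : ZeroConst a)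
    (f : MvPowerSeries σ ℂ) : constantCoeff (subst a f) = constantCoeff f := by
  have h : f = (f - C (constantCoeff f)) + C (constantCoeff f) := by ring
  have h2 : constantCoeff (subst a (f - C (constantCoeff f))) = 0 :=
    constantCoeff_subst_eq_zero ha.hasSubst ha (by simp)
  rw [subst_sub ha.hasSubst, subst_C] at h2
  simpa [sub_eq_zero] using h2


/-- The monomial of exponent `k` evaluated at the family `a`. -/
def monomialAt {σ τ : Type*} (a : σ → MvPowerSeries τ ℂ) (k : σ →₀ ℕ) : MvPowerSeries τ ℂ :=
  k.prod fun s e => a s ^ e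

lemma coeff_subst_eq_finsum {a : σ → MvPowerSeries τ ℂ} (ha : ZeroConst a)
    (f : MvPowerSeries σ ℂ) (e : τ →₀ ℕ) :
    coeff e (subst a f) = ∑ᶠ k, coeff k f * coeff e (monomialAt a k) := by
  rw [coeff_subst ha.hasSubst]; rfl

lemma monomialAt_single_add {σ τ : Type*} (a : σ → MvPowerSeries τ ℂ) (i : σ) (k : σ →₀ ℕ) :
    monomialAt a (Finsupp.single i 1 + k) = a i * monomialAt a k := by
  rw [monomialAt, Finsupp.prod_add_index' (by simp) (by intros; rw [pow_add]),
    Finsupp.prod_single_index (by simp), pow_one, monomialAt]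

lemma exists_eq_single_add {σ : Type*} {k : σ →₀ ℕ} (hk : k ≠ 0) :
    ∃ i k', k = Finsupp.single i 1 + k' := by
  obtain ⟨i, hi⟩ := Finsupp.ne_iff.1 hk
  refine ⟨i, k - Finsupp.single i 1, ?_⟩
  rw [add_tsub_cancel_of_le]
  exact Finsupp.single_le_iff.2 (Nat.one_le_iff_ne_zero.2 hi)

lemma monomialAt_mem_ordIdeal {σ τ : Type*} {a : σ → MvPowerSeries τ ℂ} (ha : ZeroConst a) (n : ℕ) :
    ∀ k : σ →₀ ℕ, k.degree = n → monomialAt a k ∈ ordIdeal τ n := by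
  induction n with
  | zero => simp
  | succ n ih =>
    intro k hk
    obtain ⟨i, k', rfl⟩ := exists_eq_single_add (k := k) (by rintro rfl; simp at hk)
    rw [map_add, Finsupp.degree_single] at hk
    rw [monomialAt_single_add, add_comm n 1]
    exact mul_mem_ordIdeal (mem_ordIdeal_one.2 (ha i)) (ih k' (by omega))

lemma monomialAt_sub_mem_ordIdeal {σ τ : Type*} {a b : σ → MvPowerSeries τ ℂ} (ha : ZeroConst a)
    (hb : ZeroConst b) {d : ℕ} (hab : ∀ i, a i - b i ∈ ordIdeal τ d) (n : ℕ) :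
    ∀ k : σ →₀ ℕ, k.degree = n + 1 → monomialAt a k - monomialAt b k ∈ ordIdeal τ (d + n) := by
  induction n with
  | zero =>
    intro k hk
    obtain ⟨i, k', rfl⟩ := exists_eq_single_add (k := k) (by rintro rfl; simp at hk)
    rw [map_add, Finsupp.degree_single] at hk
    have : k' = 0 := by rw [← Finsupp.degree_eq_zero_iff]; omega
    subst this
    simpa [monomialAt_single_add, monomialAt] using hab i
  | succ n ih =>
    intro k hk
    obtain ⟨i, k', rfl⟩ := exists_eq_single_add (k := k) (by rintro rfl; simp at hk)
    rw [map_add, Finsupp.degree_single] at hk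
    have h : a i * monomialAt a k' - b i * monomialAt b k' =
      (a i - b i) * monomialAt a k' + b i * (monomialAt a k' - monomialAt b k') := by ring
    rw [monomialAt_single_add, monomialAt_single_add, h]
    refine add_mem (mul_mem_ordIdeal (hab i) (monomialAt_mem_ordIdeal ha _ k' (by omega))) ?_
    have := mul_mem_ordIdeal (mem_ordIdeal_one.2 (hb i)) (ih k' (by omega))
    rwa [show 1 + (d + n) = d + (n + 1) by ring] at this

lemma monomialAt_sub_mem {σ τ : Type*} {a b : σ → MvPowerSeries τ ℂ}
    (I : Ideal (MvPowerSeries τ ℂ)) (hab : ∀ i, a i - b i ∈ I) (k : σ →₀ ℕ) :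
    monomialAt a k - monomialAt b k ∈ I := by
  rw [← Ideal.Quotient.eq]
  simp only [monomialAt, Finsupp.prod, map_prod, map_pow]
  exact Finset.prod_congr rfl fun i _ => by rw [Ideal.Quotient.eq.2 (hab i)]

lemma subst_mem_ordIdeal {a : σ → MvPowerSeries τ ℂ} (ha : ZeroConst a) {d : ℕ}
    {f : MvPowerSeries σ ℂ} (hf : f ∈ ordIdeal σ d) : subst a f ∈ ordIdeal τ d := by
  intro e he
  rw [coeff_subst_eq_finsum ha]
  refine finsum_eq_zero_of_forall_eq_zero fun k => ?_
  by_cases hk : k.degree < d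
  · rw [hf k hk, zero_mul]
  · rw [monomialAt_mem_ordIdeal ha _ k rfl e (by omega), mul_zero]

/-- A Lipschitz estimate for substitution into a series of order at least `m + 1`. -/
lemma subst_sub_subst_mem_ordIdeal {a b : σ → MvPowerSeries τ ℂ} (ha : ZeroConst a)
    (hb : ZeroConst b) {d m : ℕ} (hab : ∀ i, a i - b i ∈ ordIdeal τ d)
    {f : MvPowerSeries σ ℂ} (hf : f ∈ ordIdeal σ (m + 1)) :
    subst a f - subst b f ∈ ordIdeal τ (d + m) := by
  intro e he
  rw [map_sub, sub_eq_zero, coeff_subst_eq_finsum ha, coeff_subst_eq_finsum hb]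
  refine finsum_congr fun k => ?_
  by_cases hk : k.degree < m + 1
  · rw [hf k hk, zero_mul, zero_mul]
  · congr 1
    rw [← sub_eq_zero, ← map_sub]
    exact monomialAt_sub_mem_ordIdeal ha hb hab (k.degree - 1) k (by omega) e (by omega)

lemma X_dvd_subst_sub_subst {a b : σ → MvPowerSeries τ ℂ} (ha : ZeroConst a)
    (hb : ZeroConst b) {j : τ} (hab : ∀ i, X j ∣ a i - b i) (f : MvPowerSeries σ ℂ) :
    X j ∣ subst a f - subst b f := by
  rw [X_dvd_iff]
  intro e he
  rw [map_sub, sub_eq_zero, coeff_subst_eq_finsum ha, coeff_subst_eq_finsum hb]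
  refine finsum_congr fun k => ?_
  congr 1
  rw [← sub_eq_zero, ← map_sub]
  have := monomialAt_sub_mem (Ideal.span {(X j : MvPowerSeries τ ℂ)})
    (fun i => Ideal.mem_span_singleton.2 (hab i)) k
  exact X_dvd_iff.1 (Ideal.mem_span_singleton.1 this) e he

end Substitution

/-! ### The chain rule. -/

section ChainRule

variable {σ τ : Type*} [Fintype σ]

lemma sub_truncTotal_mem_ordIdeal {σ : Type*} [Finite σ] (f : MvPowerSeries σ ℂ) (n : ℕ) :
    f - (truncTotal n f : MvPolynomial σ ℂ) ∈ ordIdeal σ n := by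
  intro k hk
  rw [map_sub, MvPolynomial.coeff_coe, coeff_truncTotal _ hk, sub_self]

lemma pderiv_subst_coe {a : σ → MvPowerSeries τ ℂ} (ha : ZeroConst a) (p : MvPolynomial σ ℂ)
    (j : τ) : pderiv ℂ j (subst a (p : MvPowerSeries σ ℂ)) =
      ∑ i, subst a (pderiv ℂ i (p : MvPowerSeries σ ℂ)) * pderiv ℂ j (a i) := by
  classical
  induction p using MvPolynomial.induction_on with
  | C c => simp [subst_C, subst_const_zero ha]
  | add p q hp hq =>
    simp only [MvPolynomial.coe_add, subst_add ha.hasSubst, map_add, hp, hq, add_mul,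
      Finset.sum_add_distrib]
  | mul_X p i hp =>
    simp only [MvPolynomial.coe_mul, MvPolynomial.coe_X, subst_mul ha.hasSubst,
      subst_X ha.hasSubst, Derivation.leibniz, hp, smul_eq_mul, subst_add ha.hasSubst, add_mul,
      Finset.sum_add_distrib, pderiv_X, Pi.single_apply, Finset.mul_sum]
    congr 1
    · rw [Finset.sum_eq_single i]
      · rw [if_pos rfl, subst_const_one ha, mul_one]
      · intro b _ hb; rw [if_neg hb.symm, subst_const_zero ha]; simp
      · simp
    · exact Finset.sum_congr rfl fun b _ => by ring

/-- The chain rule for formal power series. -/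
lemma pderiv_subst {a : σ → MvPowerSeries τ ℂ} (ha : ZeroConst a) (f : MvPowerSeries σ ℂ)
    (j : τ) : pderiv ℂ j (subst a f) = ∑ i, subst a (pderiv ℂ i f) * pderiv ℂ j (a i) := by
  refine eq_of_forall_sub_mem_ordIdeal fun d => ?_
  -- The rule is known for polynomials; the tail `g` has order `d + 1` and one differentiation costs
  -- one order, so the defect has order `d`.
  set g := f - (truncTotal (d + 1) f : MvPolynomial σ ℂ) with hg
  have hgm : g ∈ ordIdeal σ (d + 1) := sub_truncTotal_mem_ordIdeal f (d + 1)
  have hf : f = g + (truncTotal (d + 1) f : MvPolynomial σ ℂ) := by rw [hg]; ring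
  have key : pderiv ℂ j (subst a f) - ∑ i, subst a (pderiv ℂ i f) * pderiv ℂ j (a i) =
      pderiv ℂ j (subst a g) - ∑ i, subst a (pderiv ℂ i g) * pderiv ℂ j (a i) := by
    conv_lhs => rw [hf]
    simp only [subst_add ha.hasSubst, map_add, add_mul, Finset.sum_add_distrib,
      pderiv_subst_coe ha]
    ring
  rw [key]
  refine sub_mem (pderiv_mem_ordIdeal j (subst_mem_ordIdeal ha hgm)) (sum_mem fun i _ => ?_)
  exact Ideal.mul_mem_right _ _ (subst_mem_ordIdeal ha (pderiv_mem_ordIdeal i hgm))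

end ChainRule

/-! ### Formal contraction principle. -/

section FixedPoint

variable {σ ι : Type*}

/-- A self-map of families of series that strictly increases the order of contact has a fixed
point in every set that is stable and closed under formal limits. -/
lemma exists_fixedPoint (T : (ι → MvPowerSeries σ ℂ) → ι → MvPowerSeries σ ℂ)
    (S : Set (ι → MvPowerSeries σ ℂ)) (h0 : 0 ∈ S) (hT : ∀ a ∈ S, T a ∈ S)
    (hlim : ∀ a, (∀ n, ∃ b ∈ S, ∀ i, a i - b i ∈ ordIdeal σ n) → a ∈ S)
    (hc : ∀ a ∈ S, ∀ b ∈ S, ∀ d, (∀ i, a i - b i ∈ ordIdeal σ d) →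
      ∀ i, T a i - T b i ∈ ordIdeal σ (d + 1)) :
    ∃ a ∈ S, T a = a := by
  have hS : ∀ n, T^[n] 0 ∈ S := fun n => by
    induction n with
    | zero => exact h0
    | succ n ih => rw [Function.iterate_succ_apply']; exact hT _ ih
  have step : ∀ n i, T^[n + 1] 0 i - T^[n] 0 i ∈ ordIdeal σ n := fun n => by
    induction n with
    | zero => simp
    | succ n ih =>
      rw [Function.iterate_succ_apply' T (n + 1), Function.iterate_succ_apply' T n]
      rw [Function.iterate_succ_apply' T n] at ih
      exact hc _ (hT _ (hS n)) _ (hS n) _ ih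
  have far : ∀ n m i, T^[n + m] 0 i - T^[n] 0 i ∈ ordIdeal σ n := fun n m i => by
    induction m with
    | zero => simp
    | succ m ih =>
      have := add_mem (ordIdeal_mono (Nat.le_add_right n m) (step (n + m) i)) ih
      rwa [sub_add_sub_cancel] at this
  -- Coefficients of degree `d` are stationary from the iterate `d + 1` on, so the limit is read off
  -- coefficient by coefficient.
  let a : ι → MvPowerSeries σ ℂ := fun i k => coeff k (T^[k.degree + 1] 0 i)
  have ha : ∀ n i, a i - T^[n] 0 i ∈ ordIdeal σ n := fun n i k hk => by
    obtain ⟨m, rfl⟩ := Nat.exists_eq_add_of_lt hk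
    have := far (k.degree + 1) m i k (Nat.lt_succ_self _)
    rw [map_sub, sub_eq_zero] at this ⊢
    rw [show k.degree + m + 1 = k.degree + 1 + m by ring, this]
    rfl
  have haS : a ∈ S := hlim a fun n => ⟨_, hS n, ha n⟩
  refine ⟨a, haS, funext fun i => eq_of_forall_sub_mem_ordIdeal fun d => ?_⟩
  have h1 := hc a haS _ (hS d) d (ha d) i
  have h2 := ha (d + 1) i
  rw [Function.iterate_succ_apply' T d] at h2
  have := sub_mem h1 h2
  rw [show T a i - T (T^[d] 0) i - (a i - T (T^[d] 0) i) = T a i - a i by ring] at this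
  exact ordIdeal_mono (Nat.le_succ d) this

end FixedPoint

/-! ### Composition of formal maps and conjugacy of vector fields. -/

section Conjugacy

variable {n : ℕ}

/-- The composite map `Ψ ∘ Φ`. -/
def compMap (Ψ Φ : Fin n → Ser n) : Fin n → Ser n := fun i => subst Φ (Ψ i)

lemma zeroConst_compMap {Ψ Φ : Fin n → Ser n} (hΨ : ZeroConst Ψ) (hΦ : ZeroConst Φ) :
    ZeroConst (compMap Ψ Φ) := fun i => by
  rw [compMap, constantCoeff_subst_of_zeroConst hΦ, hΨ i]

lemma subst_subst {Ψ Φ : Fin n → Ser n} (hΨ : ZeroConst Ψ) (hΦ : ZeroConst Φ) (f : Ser n) :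
    subst Φ (subst Ψ f) = subst (compMap Ψ Φ) f :=
  subst_comp_subst_apply hΨ.hasSubst hΦ.hasSubst f

lemma subst_X_eq (f : Ser n) : subst (X : Fin n → Ser n) f = f := by
  rw [subst_self]; rfl

lemma lie_subst {Φ Y Z : Fin n → Ser n} (hΦ : ZeroConst Φ) (h : PushesTo Φ Y Z) (f : Ser n) :
    lie Y (subst Φ f) = subst Φ (lie Z f) := by
  simp only [lie, pderiv_subst hΦ, Finset.mul_sum]
  rw [Finset.sum_comm, ← coe_substAlgHom hΦ.hasSubst, map_sum]
  refine Finset.sum_congr rfl fun i _ => ?_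
  rw [map_mul, coe_substAlgHom, ← h i, lie, Finset.sum_mul]
  exact Finset.sum_congr rfl fun j _ => by ring

lemma PushesTo.comp {Φ Ψ Y Z W : Fin n → Ser n} (hΦ : ZeroConst Φ) (hΨ : ZeroConst Ψ)
    (h : PushesTo Φ Y Z) (h' : PushesTo Ψ Z W) : PushesTo (compMap Ψ Φ) Y W := fun i => by
  rw [compMap, lie_subst hΦ h, h' i, subst_subst hΨ hΦ]

lemma PushesTo.symm {Φ Ψ Y Z : Fin n → Ser n} (hΨ : ZeroConst Ψ)
    (hΦ : ZeroConst Φ) (h : PushesTo Φ Y Z)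
    (h1 : compMap Φ Ψ = X) (h2 : compMap Ψ Φ = X) : PushesTo Ψ Z Y := fun i => by
  have e : lie Y (compMap Ψ Φ i) = subst Φ (lie Z (Ψ i)) := lie_subst hΦ h _
  have e2 : lie Y (compMap Ψ Φ i) = Y i := by
    rw [h2, lie, Finset.sum_eq_single i] <;> simp +contextual
    intro b hb; right; exact pderiv_X_of_ne (Ne.symm hb)
  rw [← e2, e, subst_subst hΦ hΨ, h1, subst_X_eq]

lemma exists_pushesTo {Φ Ψ : Fin n → Ser n} (hΨ : ZeroConst Ψ)
    (hΦ : ZeroConst Φ) (h2 : compMap Ψ Φ = X) (Y : Fin n → Ser n) :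
    PushesTo Φ Y fun i => subst Ψ (lie Y (Φ i)) := fun i => by
  rw [subst_subst hΨ hΦ, h2, subst_X_eq]

lemma compMap_assoc {Φ Ψ Ξ : Fin n → Ser n} (hΨ : ZeroConst Ψ) (hΞ : ZeroConst Ξ) :
    compMap (compMap Φ Ψ) Ξ = compMap Φ (compMap Ψ Ξ) :=
  funext fun i => subst_subst hΨ hΞ (Φ i)

lemma compMap_X (Φ : Fin n → Ser n) : compMap Φ X = Φ := funext fun i => subst_X_eq (Φ i)

lemma X_compMap {Φ : Fin n → Ser n} (hΦ : ZeroConst Φ) : compMap X Φ = Φ :=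
  funext fun i => subst_X hΦ.hasSubst i

end Conjugacy

end SaddleNode
end

noncomputable section

namespace SaddleNode

open scoped NNReal ENNReal

/-! ### Convergence through weighted `ℓ¹` norms with values in `[0, ∞]`. -/

section Convergence

variable {σ τ : Type*}

/-- The weighted `ℓ¹` norm of radius `r` of a power series. -/
def wnorm (r : ℝ≥0) (f : MvPowerSeries σ ℂ) : ℝ≥0∞ :=
  ∑' k : σ →₀ ℕ, ‖coeff k f‖ₑ * (r : ℝ≥0∞) ^ k.degree

lemma isConvergent_iff {f : MvPowerSeries σ ℂ} :
    IsConvergent f ↔ ∃ r : ℝ≥0, 0 < r ∧ wnorm r f ≠ ∞ := by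
  have key : ∀ r : ℝ≥0, wnorm r f ≠ ∞ ↔
      Summable fun k : σ →₀ ℕ => ‖coeff k f‖ * (r : ℝ) ^ k.degree := fun r => by
    have h := NNReal.summable_coe (f := fun k : σ →₀ ℕ => ‖coeff k f‖₊ * r ^ k.degree)
      (L := SummationFilter.unconditional _)
    rw [← ENNReal.tsum_coe_ne_top_iff_summable] at h
    simpa [wnorm, enorm_eq_nnnorm] using h.symm
  constructor
  · rintro ⟨r, hr, h⟩
    exact ⟨⟨r, hr.le⟩, hr, (key _).2 h⟩
  · rintro ⟨r, hr, h⟩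
    exact ⟨r, hr, (key _).1 h⟩

lemma wnorm_mono {r s : ℝ≥0} (h : r ≤ s) (f : MvPowerSeries σ ℂ) : wnorm r f ≤ wnorm s f := by
  unfold wnorm; gcongr

lemma wnorm_add_le (r : ℝ≥0) (f g : MvPowerSeries σ ℂ) :
    wnorm r (f + g) ≤ wnorm r f + wnorm r g := by
  unfold wnorm
  rw [← ENNReal.tsum_add]
  gcongr with k
  rw [← add_mul, map_add]
  gcongr
  exact enorm_add_le _ _

lemma wnorm_neg (r : ℝ≥0) (f : MvPowerSeries σ ℂ) : wnorm r (-f) = wnorm r f := by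
  simp [wnorm]

lemma wnorm_mul_le (r : ℝ≥0) (f g : MvPowerSeries σ ℂ) :
    wnorm r (f * g) ≤ wnorm r f * wnorm r g := by
  classical
  calc wnorm r (f * g)
      ≤ ∑' k : σ →₀ ℕ, ∑' p : Finset.HasAntidiagonal.antidiagonal k,
        (‖coeff p.1.1 f‖ₑ * (r : ℝ≥0∞) ^ p.1.1.degree) *
          (‖coeff p.1.2 g‖ₑ * (r : ℝ≥0∞) ^ p.1.2.degree) := by
        unfold wnorm
        gcongr with k
        rw [tsum_fintype, coeff_mul, ← Finset.sum_coe_sort]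
        calc _ ≤ (∑ p : Finset.HasAntidiagonal.antidiagonal k,
                ‖coeff p.1.1 f * coeff p.1.2 g‖ₑ) * (r : ℝ≥0∞) ^ k.degree := by
              gcongr; exact enorm_sum_le _ _
          _ = _ := by
              rw [Finset.sum_mul]
              refine Finset.sum_congr rfl fun p _ => ?_
              have := congrArg Finsupp.degree (Finset.HasAntidiagonal.mem_antidiagonal.1 p.2)
              rw [map_add] at this
              rw [enorm_mul, ← this, pow_add]; ring
    _ = ∑' p : (σ →₀ ℕ) × (σ →₀ ℕ), (‖coeff p.1 f‖ₑ * (r : ℝ≥0∞) ^ p.1.degree) *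
          (‖coeff p.2 g‖ₑ * (r : ℝ≥0∞) ^ p.2.degree) := by
        rw [← ENNReal.tsum_sigma
          (f := fun (k : σ →₀ ℕ) (p : Finset.HasAntidiagonal.antidiagonal k) =>
            (‖coeff p.1.1 f‖ₑ * (r : ℝ≥0∞) ^ p.1.1.degree) *
            (‖coeff p.1.2 g‖ₑ * (r : ℝ≥0∞) ^ p.1.2.degree))]
        exact Finset.HasAntidiagonal.sigmaAntidiagonalEquivProd.tsum_eq
          (fun p : (σ →₀ ℕ) × (σ →₀ ℕ) => (‖coeff p.1 f‖ₑ * (r : ℝ≥0∞) ^ p.1.degree) *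
          (‖coeff p.2 g‖ₑ * (r : ℝ≥0∞) ^ p.2.degree))
    _ = wnorm r f * wnorm r g := by
        rw [ENNReal.tsum_prod (f := fun k l : σ →₀ ℕ => (‖coeff k f‖ₑ * (r : ℝ≥0∞) ^ k.degree) *
          (‖coeff l g‖ₑ * (r : ℝ≥0∞) ^ l.degree))]
        simp_rw [ENNReal.tsum_mul_left, ENNReal.tsum_mul_right]
        rfl

lemma wnorm_C (r : ℝ≥0) (c : ℂ) : wnorm r (C c : MvPowerSeries σ ℂ) = ‖c‖ₑ := by
  classical
  rw [wnorm, tsum_eq_single 0]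
  · simp
  · intro k hk; rw [coeff_C, if_neg hk]; simp

lemma wnorm_X (r : ℝ≥0) (i : σ) : wnorm r (X i : MvPowerSeries σ ℂ) = r := by
  classical
  rw [wnorm, tsum_eq_single (Finsupp.single i 1)]
  · simp
  · intro k hk; rw [coeff_X, if_neg hk]; simp

lemma wnorm_le_of_mem_ordIdeal {d : ℕ} {f : MvPowerSeries σ ℂ} (hf : f ∈ ordIdeal σ d)
    {t : ℝ≥0} (ht : t ≤ 1) (r : ℝ≥0) : wnorm (t * r) f ≤ (t : ℝ≥0∞) ^ d * wnorm r f := by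
  unfold wnorm
  rw [← ENNReal.tsum_mul_left]
  refine ENNReal.tsum_le_tsum fun k => ?_
  by_cases hk : k.degree < d
  · rw [hf k hk]; simp
  · rw [ENNReal.coe_mul, mul_pow]
    have : (t : ℝ≥0∞) ^ k.degree ≤ (t : ℝ≥0∞) ^ d :=
      pow_le_pow_right_of_le_one' (by exact_mod_cast ht) (by omega)
    calc _ = (t : ℝ≥0∞) ^ k.degree * (‖coeff k f‖ₑ * (r : ℝ≥0∞) ^ k.degree) := by ring
      _ ≤ _ := by gcongr

lemma wnorm_monomialAt_le {r : ℝ≥0} {ρ : ℝ≥0∞} {a : σ → MvPowerSeries τ ℂ}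
    (h : ∀ i, wnorm r (a i) ≤ ρ) (n : ℕ) :
    ∀ k : σ →₀ ℕ, k.degree = n → wnorm r (monomialAt a k) ≤ ρ ^ n := by
  induction n with
  | zero =>
    intro k hk
    rw [Finsupp.degree_eq_zero_iff] at hk
    subst hk
    have := wnorm_C (σ := τ) r 1
    rw [map_one] at this
    simp [monomialAt, this]
  | succ n ih =>
    intro k hk
    obtain ⟨i, k', rfl⟩ := exists_eq_single_add (k := k) (by rintro rfl; simp at hk)
    rw [map_add, Finsupp.degree_single] at hk
    rw [monomialAt_single_add, pow_succ']
    exact (wnorm_mul_le _ _ _).trans (mul_le_mul' (h i) (ih k' (by omega)))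

/-- By submultiplicativity a monomial of degree `n` in the `a i` has norm at most `ρ ^ n`, and
exchanging the two sums gives the bound. -/
lemma wnorm_subst_le [Finite σ] {r ρ : ℝ≥0} {a : σ → MvPowerSeries τ ℂ} (ha : ZeroConst a)
    (h : ∀ i, wnorm r (a i) ≤ ρ) (f : MvPowerSeries σ ℂ) :
    wnorm r (subst a f) ≤ wnorm ρ f := by
  have h1 : ∀ e, ‖coeff e (subst a f)‖ₑ ≤ ∑' k, ‖coeff k f‖ₑ * ‖coeff e (monomialAt a k)‖ₑ := by
    intro e
    have hfin := coeff_subst_finite ha.hasSubst f e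
    rw [coeff_subst ha.hasSubst, finsum_eq_sum _ hfin]
    refine (enorm_sum_le _ _).trans ?_
    refine le_trans (le_of_eq ?_) (ENNReal.sum_le_tsum hfin.toFinset)
    exact Finset.sum_congr rfl fun k _ => by rw [smul_eq_mul, enorm_mul]; rfl
  calc wnorm r (subst a f)
      ≤ ∑' e : τ →₀ ℕ, ∑' k : σ →₀ ℕ,
        ‖coeff k f‖ₑ * (‖coeff e (monomialAt a k)‖ₑ * (r : ℝ≥0∞) ^ e.degree) := by
        refine ENNReal.tsum_le_tsum fun e => ?_
        refine (mul_le_mul_left (h1 e) _).trans (le_of_eq ?_)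
        rw [← ENNReal.tsum_mul_right]
        exact tsum_congr fun k => by ring
    _ = ∑' k : σ →₀ ℕ, ‖coeff k f‖ₑ * wnorm r (monomialAt a k) := by
        rw [ENNReal.tsum_comm]
        exact tsum_congr fun k => ENNReal.tsum_mul_left
    _ ≤ wnorm ρ f := by
        unfold wnorm
        gcongr with k
        exact wnorm_monomialAt_le h _ k rfl

/-- The norm is a supremum of finite sums, each seeing finitely many coefficients. Norm bounds
therefore survive formal limits, which turns formal fixed points into convergent ones. -/
lemma wnorm_le_of_approx {r : ℝ≥0} {ρ : ℝ≥0∞} {f : MvPowerSeries σ ℂ}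
    (h : ∀ n, ∃ g, wnorm r g ≤ ρ ∧ f - g ∈ ordIdeal σ n) : wnorm r f ≤ ρ := by
  rw [wnorm, ENNReal.tsum_eq_iSup_sum]
  refine iSup_le fun s => ?_
  obtain ⟨g, hg, hfg⟩ := h (s.sup (fun k => k.degree) + 1)
  refine le_trans (le_of_eq (Finset.sum_congr rfl fun k hk => ?_))
    ((ENNReal.sum_le_tsum s).trans hg)
  have : coeff k (f - g) = 0 := hfg k (Nat.lt_succ_of_le (Finset.le_sup (f := fun k => k.degree) hk))
  rw [map_sub, sub_eq_zero] at this
  rw [this]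

lemma IsConvergent.add {f g : MvPowerSeries σ ℂ} (hf : IsConvergent f) (hg : IsConvergent g) :
    IsConvergent (f + g) := by
  rw [isConvergent_iff] at *
  obtain ⟨r, hr, hf⟩ := hf
  obtain ⟨s, hs, hg⟩ := hg
  refine ⟨min r s, lt_min hr hs, ne_top_of_le_ne_top (ENNReal.add_ne_top.2 ⟨hf, hg⟩)
    ((wnorm_add_le _ _ _).trans (add_le_add (wnorm_mono (min_le_left _ _) _)
      (wnorm_mono (min_le_right _ _) _)))⟩

lemma IsConvergent.mul {f g : MvPowerSeries σ ℂ} (hf : IsConvergent f) (hg : IsConvergent g) :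
    IsConvergent (f * g) := by
  rw [isConvergent_iff] at *
  obtain ⟨r, hr, hf⟩ := hf
  obtain ⟨s, hs, hg⟩ := hg
  refine ⟨min r s, lt_min hr hs, ne_top_of_le_ne_top (ENNReal.mul_ne_top hf hg)
    ((wnorm_mul_le _ _ _).trans (mul_le_mul' (wnorm_mono (min_le_left _ _) _)
      (wnorm_mono (min_le_right _ _) _)))⟩

lemma IsConvergent.neg {f : MvPowerSeries σ ℂ} (hf : IsConvergent f) : IsConvergent (-f) := by
  rw [isConvergent_iff] at *
  simpa only [wnorm_neg] using hf

lemma IsConvergent.sub {f g : MvPowerSeries σ ℂ} (hf : IsConvergent f) (hg : IsConvergent g) :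
    IsConvergent (f - g) := by
  rw [sub_eq_add_neg]; exact hf.add hg.neg

lemma isConvergent_C (c : ℂ) : IsConvergent (C c : MvPowerSeries σ ℂ) :=
  isConvergent_iff.2 ⟨1, one_pos, by rw [wnorm_C]; exact enorm_ne_top⟩

lemma isConvergent_zero : IsConvergent (0 : MvPowerSeries σ ℂ) := by
  simpa using isConvergent_C (σ := σ) 0

lemma isConvergent_one : IsConvergent (1 : MvPowerSeries σ ℂ) := by
  simpa using isConvergent_C (σ := σ) 1

lemma isConvergent_X (i : σ) : IsConvergent (X i : MvPowerSeries σ ℂ) :=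
  isConvergent_iff.2 ⟨1, one_pos, by rw [wnorm_X]; exact ENNReal.coe_ne_top⟩

lemma isConvergent_sum {ι : Type*} (s : Finset ι) {f : ι → MvPowerSeries σ ℂ}
    (hf : ∀ i ∈ s, IsConvergent (f i)) : IsConvergent (∑ i ∈ s, f i) :=
  Finset.sum_induction f IsConvergent (fun _ _ => IsConvergent.add) isConvergent_zero hf

/-- Comparison of coefficients along an injective relabelling of exponents. -/
lemma IsConvergent.of_le {f : MvPowerSeries σ ℂ} {g : MvPowerSeries τ ℂ} (hg : IsConvergent g)
    (ι : (σ →₀ ℕ) → τ →₀ ℕ) (hι : Function.Injective ι) (A D : ℝ≥0) (hD : 1 ≤ D) (a b : ℕ)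
    (hdeg : ∀ k, (ι k).degree ≤ a * k.degree + b)
    (hle : ∀ k, ‖coeff k f‖₊ ≤ A * D ^ k.degree * ‖coeff (ι k) g‖₊) : IsConvergent f := by
  rw [isConvergent_iff] at *
  obtain ⟨r₀, hr₀, hr₀g⟩ := hg
  obtain ⟨r, hr, hr1, hg⟩ : ∃ r : ℝ≥0, 0 < r ∧ r ≤ 1 ∧ wnorm r g ≠ ∞ :=
    ⟨min r₀ 1, lt_min hr₀ one_pos, min_le_right _ _,
      ne_top_of_le_ne_top hr₀g (wnorm_mono (min_le_left _ _) _)⟩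
  have hD0 : D ≠ 0 := (one_pos.trans_le hD).ne'
  refine ⟨r ^ a / D, by positivity, ?_⟩
  have hb : ((A * (r ^ b)⁻¹ : ℝ≥0) : ℝ≥0∞) * wnorm r g ≠ ∞ := ENNReal.mul_ne_top ENNReal.coe_ne_top hg
  refine ne_top_of_le_ne_top hb ?_
  calc wnorm (r ^ a / D) f
      ≤ ∑' k : σ →₀ ℕ, ((A * (r ^ b)⁻¹ : ℝ≥0) : ℝ≥0∞) *
        (‖coeff (ι k) g‖ₑ * (r : ℝ≥0∞) ^ (ι k).degree) := by
        unfold wnorm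
        refine ENNReal.tsum_le_tsum fun k => ?_
        rw [enorm_eq_nnnorm, enorm_eq_nnnorm]
        norm_cast
        have h1 : r ^ (a * k.degree + b) ≤ r ^ (ι k).degree :=
          pow_le_pow_of_le_one (zero_le) hr1 (hdeg k)
        calc _ ≤ (A * D ^ k.degree * ‖coeff (ι k) g‖₊) * (r ^ a / D) ^ k.degree := by
              gcongr; exact hle k
          _ = A * (r ^ b)⁻¹ * (‖coeff (ι k) g‖₊ * r ^ (a * k.degree + b)) := by
              rw [div_pow, pow_add, ← pow_mul]
              have hDk : D ^ k.degree ≠ 0 := pow_ne_zero _ hD0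
              have hrb : r ^ b ≠ 0 := pow_ne_zero _ hr.ne'
              field_simp
          _ ≤ _ := by gcongr
    _ ≤ _ := by
        rw [ENNReal.tsum_mul_left]
        gcongr
        exact ENNReal.tsum_comp_le_tsum_of_injective hι _

lemma IsConvergent.mulCoeff {f : MvPowerSeries σ ℂ} (hf : IsConvergent f)
    {μ : (σ →₀ ℕ) → ℂ} (A : ℝ≥0) (hμ : ∀ k, ‖μ k‖₊ ≤ A) : IsConvergent (mulCoeff μ f) :=
  hf.of_le id Function.injective_id A 1 le_rfl 1 0 (by simp) fun k => by
    rw [coeff_mulCoeff, nnnorm_mul, one_pow, mul_one]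
    exact mul_le_mul_left (hμ k) _

lemma IsConvergent.pderiv {f : MvPowerSeries σ ℂ} (hf : IsConvergent f) (i : σ) :
    IsConvergent (pderiv ℂ i f) :=
  hf.of_le (fun k => k + Finsupp.single i 1) (add_left_injective _) 1 2 one_le_two 1 1
    (by simp) fun k => by
    rw [coeff_pderiv, nnnorm_mul, mul_comm, one_mul]
    gcongr
    have : ((k i : ℂ) + 1) = ((k i + 1 : ℕ) : ℂ) := by push_cast; ring
    rw [this, Complex.nnnorm_natCast]
    -- The factor produced by differentiation is absorbed by halving the radius, whence `D = 2`.
    have h1 : k i + 1 ≤ 2 ^ k.degree := (Nat.lt_two_pow_self).trans_le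
      (Nat.pow_le_pow_right (by norm_num) (Finsupp.le_degree i k))
    exact_mod_cast h1

/-- Without constant term, shrinking the radius by `t ≤ 1` multiplies the norm by at most `t`. -/
lemma exists_wnorm_le {ι : Type*} [Finite ι] {a : ι → MvPowerSeries σ ℂ} (ha : ZeroConst a)
    (hc : ∀ i, IsConvergent (a i)) {ρ : ℝ≥0} (hρ : 0 < ρ) :
    ∃ r : ℝ≥0, 0 < r ∧ ∀ i, wnorm r (a i) ≤ ρ := by
  have h1 : ∀ i, ∃ r : ℝ≥0, 0 < r ∧ wnorm r (a i) ≤ ρ := fun i => by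
    obtain ⟨r, hr, h⟩ := isConvergent_iff.1 (hc i)
    obtain ⟨M, hM⟩ : ∃ M : ℝ≥0, (M : ℝ≥0∞) = wnorm r (a i) := ⟨_, ENNReal.coe_toNNReal h⟩
    refine ⟨min 1 (ρ / (M + 1)) * r, mul_pos (lt_min one_pos (by positivity)) hr, ?_⟩
    refine (wnorm_le_of_mem_ordIdeal (mem_ordIdeal_one.2 (ha i)) (min_le_left _ _) r).trans ?_
    rw [← hM, pow_one]
    rw [← ENNReal.coe_mul, ENNReal.coe_le_coe]
    calc min 1 (ρ / (M + 1)) * M ≤ ρ / (M + 1) * (M + 1) := by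
          gcongr
          · exact min_le_right _ _
          · exact le_self_add
      _ = ρ := by field_simp
  choose r hr h using h1
  have : Fintype ι := Fintype.ofFinite ι
  by_cases hne : Nonempty ι
  · refine ⟨Finset.univ.inf' Finset.univ_nonempty r, ?_, fun i => ?_⟩
    · rw [Finset.lt_inf'_iff]; exact fun i _ => hr i
    · exact (wnorm_mono (Finset.inf'_le _ (Finset.mem_univ i)) _).trans (h i)
  · exact ⟨1, one_pos, fun i => (hne ⟨i⟩).elim⟩

lemma IsConvergent.subst [Finite σ] {f : MvPowerSeries σ ℂ} (hf : IsConvergent f)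
    {a : σ → MvPowerSeries τ ℂ} (ha : ZeroConst a) (hc : ∀ i, IsConvergent (a i)) :
    IsConvergent (subst a f) := by
  obtain ⟨ρ, hρ, h⟩ := isConvergent_iff.1 hf
  obtain ⟨r, hr, hr'⟩ := exists_wnorm_le ha hc hρ
  exact isConvergent_iff.2 ⟨r, hr, ne_top_of_le_ne_top h (wnorm_subst_le ha hr' f)⟩

end Convergence

end SaddleNode
end

noncomputable section

namespace SaddleNode

open scoped NNReal ENNReal

/-! ### Substitution into one-variable series: inverses and exponentials. -/

section OneVariable

variable {σ : Type*}

lemma zeroConst_const {a : MvPowerSeries σ ℂ} (ha : constantCoeff a = 0) :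
    ZeroConst fun _ : Unit => a := fun _ => ha

lemma IsConvergent.powerSeries_subst {f : PowerSeries ℂ} (hf : IsConvergent f)
    {a : MvPowerSeries σ ℂ} (ha : constantCoeff a = 0) (hc : IsConvergent a) :
    IsConvergent (PowerSeries.subst a f) :=
  IsConvergent.subst hf (zeroConst_const ha) fun _ => hc

lemma powerSeries_coeff_eq (f : PowerSeries ℂ) (k : Unit →₀ ℕ) :
    MvPowerSeries.coeff k f = PowerSeries.coeff k.degree f := by
  rw [PowerSeries.coeff]
  congr 2
  ext
  simp [Finsupp.degree_eq_sum]

lemma isConvergent_of_norm_coeff_le {f : PowerSeries ℂ} (A D : ℝ≥0)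
    (h : ∀ n, ‖PowerSeries.coeff n f‖₊ ≤ A * D ^ n) : IsConvergent f := by
  rw [isConvergent_iff]
  refine ⟨(2 * (D + 1))⁻¹, by positivity, ?_⟩
  have key : wnorm (2 * (D + 1))⁻¹ f ≤ ∑' n : ℕ, (A : ℝ≥0∞) * (2⁻¹ : ℝ≥0∞) ^ n := by
    rw [wnorm, ← (Finsupp.uniqueEquiv () : (Unit →₀ ℕ) ≃ ℕ).tsum_eq]
    refine ENNReal.tsum_le_tsum fun k => ?_
    have hk : (Finsupp.uniqueEquiv () : (Unit →₀ ℕ) ≃ ℕ) k = k.degree := by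
      simp [Finsupp.degree_eq_sum]
    rw [powerSeries_coeff_eq, hk, enorm_eq_nnnorm]
    have h2 : (2⁻¹ : ℝ≥0∞) = ((2⁻¹ : ℝ≥0) : ℝ≥0∞) := by simp
    rw [h2]
    norm_cast
    calc _ ≤ (A * (D + 1) ^ k.degree) * ((2 * (D + 1))⁻¹) ^ k.degree := by
          gcongr
          exact (h _).trans (by gcongr; exact le_self_add)
      _ = _ := by
          rw [mul_assoc, ← mul_pow]
          congr 2
          field_simp
  refine ne_top_of_le_ne_top ?_ key
  rw [ENNReal.tsum_mul_left]
  exact ENNReal.mul_ne_top (by simp) (by rw [ENNReal.tsum_geometric]; simp)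

lemma constantCoeff_powerSeries_subst {a : MvPowerSeries σ ℂ} (ha : constantCoeff a = 0)
    (f : PowerSeries ℂ) : constantCoeff (PowerSeries.subst a f) = PowerSeries.constantCoeff f :=
  constantCoeff_subst_of_zeroConst (zeroConst_const ha) f

lemma pderiv_powerSeries_subst {a : MvPowerSeries σ ℂ} (ha : constantCoeff a = 0)
    (f : PowerSeries ℂ) (j : σ) : pderiv ℂ j (PowerSeries.subst a f) =
      PowerSeries.subst a (PowerSeries.derivative ℂ f) * pderiv ℂ j a := by
  have := pderiv_subst (zeroConst_const ha) f j
  rw [Finset.univ_unique, Finset.sum_singleton] at this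
  exact this

/-- With `g = 1 - f / f(0)`, the inverse is `f(0)⁻¹` times the geometric series in `g`. If `f(0) =
0`, the conventional inverse is zero. -/
lemma IsConvergent.inv {f : MvPowerSeries σ ℂ} (hf : IsConvergent f) : IsConvergent f⁻¹ := by
  by_cases h0 : constantCoeff f = 0
  · rw [MvPowerSeries.inv_eq_zero.2 h0]; exact isConvergent_zero
  set g : MvPowerSeries σ ℂ := 1 - C (constantCoeff f)⁻¹ * f with hg
  have hg0 : constantCoeff g = 0 := by simp [hg, h0]
  have hgc : IsConvergent g := isConvergent_one.sub ((isConvergent_C _).mul hf)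
  have hG : PowerSeries.subst g (PowerSeries.mk 1 : PowerSeries ℂ) * (1 - g) = 1 := by
    have := congrArg (PowerSeries.subst g) (PowerSeries.mk_one_mul_one_sub_eq_one ℂ)
    have hs := PowerSeries.HasSubst.of_constantCoeff_zero hg0
    rw [PowerSeries.subst_mul hs, PowerSeries.subst_sub hs, PowerSeries.subst_X hs] at this
    have h1 : PowerSeries.subst g (1 : PowerSeries ℂ) = 1 := subst_const_one (zeroConst_const hg0)
    rwa [h1] at this
  have hinv : f⁻¹ = C (constantCoeff f)⁻¹ * PowerSeries.subst g (PowerSeries.mk 1 : PowerSeries ℂ) := by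
    rw [MvPowerSeries.inv_eq_iff_mul_eq_one h0, mul_right_comm]
    rw [← hG, hg]; ring
  rw [hinv]
  refine (isConvergent_C _).mul (IsConvergent.powerSeries_subst ?_ hg0 hgc)
  exact isConvergent_of_norm_coeff_le 1 1 fun n => by simp

/-- The exponential of a series without constant term. -/
def expS (g : MvPowerSeries σ ℂ) : MvPowerSeries σ ℂ := PowerSeries.subst g (PowerSeries.exp ℂ)

lemma constantCoeff_expS {g : MvPowerSeries σ ℂ} (hg : constantCoeff g = 0) :
    constantCoeff (expS g) = 1 := by
  rw [expS, constantCoeff_powerSeries_subst hg]; simp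

lemma pderiv_expS {g : MvPowerSeries σ ℂ} (hg : constantCoeff g = 0) (j : σ) :
    pderiv ℂ j (expS g) = expS g * pderiv ℂ j g := by
  rw [expS, pderiv_powerSeries_subst hg, PowerSeries.derivative_exp]

/-- All partial derivatives of the product vanish and its value at the origin is 1. -/
lemma expS_mul_expS_neg {g : MvPowerSeries σ ℂ} (hg : constantCoeff g = 0) :
    expS g * expS (-g) = 1 := by
  have hg' : constantCoeff (-g) = 0 := by simp [hg]
  refine pderiv.ext (fun i => ?_) (by simp [constantCoeff_expS hg, constantCoeff_expS hg'])
  rw [Derivation.leibniz, pderiv_expS hg, pderiv_expS hg', pderiv_one, map_neg, smul_eq_mul,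
    smul_eq_mul]
  ring

lemma IsConvergent.expS {g : MvPowerSeries σ ℂ} (hc : IsConvergent g)
    (hg : constantCoeff g = 0) : IsConvergent (expS g) := by
  refine IsConvergent.powerSeries_subst ?_ hg hc
  refine isConvergent_of_norm_coeff_le 1 1 fun n => ?_
  rw [PowerSeries.coeff_exp, one_pow, one_mul]
  simp only [one_div, map_inv₀, map_natCast, nnnorm_inv, Complex.nnnorm_natCast]
  exact inv_le_one_of_one_le₀ (by exact_mod_cast Nat.one_le_iff_ne_zero.2 n.factorial_ne_zero)

end OneVariable

/-! ### Inverse function theorem, formal and analytic. -/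

section Inverse

variable {n : ℕ}

lemma IsFormalDiffeo.zeroConst {Φ : Fin n → Ser n} (h : IsFormalDiffeo Φ) : ZeroConst Φ := h.1

lemma constantCoeff_pderiv {σ : Type*} (f : MvPowerSeries σ ℂ) (i : σ) :
    constantCoeff (pderiv ℂ i f) = coeff (Finsupp.single i 1) f := by
  rw [← coeff_zero_eq_constantCoeff_apply, coeff_pderiv]; simp

lemma mem_ordIdeal_two {σ : Type*} {f : MvPowerSeries σ ℂ} : f ∈ ordIdeal σ 2 ↔
    constantCoeff f = 0 ∧ ∀ i, constantCoeff (pderiv ℂ i f) = 0 := by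
  constructor
  · intro h
    refine ⟨mem_ordIdeal_one.1 (ordIdeal_mono one_le_two h), fun i => ?_⟩
    rw [constantCoeff_pderiv]; exact h _ (by simp)
  · rintro ⟨h0, h1⟩ k hk
    by_cases hk0 : k = 0
    · rw [hk0, coeff_zero_eq_constantCoeff_apply, h0]
    · obtain ⟨i, k', rfl⟩ := exists_eq_single_add hk0
      rw [map_add, Finsupp.degree_single] at hk
      have : k' = 0 := by rw [← Finsupp.degree_eq_zero_iff]; omega
      rw [this, add_zero, ← constantCoeff_pderiv, h1]

/-- The linear part of a map. -/
def linPart (Φ : Fin n → Ser n) : Matrix (Fin n) (Fin n) ℂ := (jac Φ).map constantCoeff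

/-- The linear map of matrix `A`. -/
def linMap (A : Matrix (Fin n) (Fin n) ℂ) : Fin n → Ser n := fun i => ∑ j, C (A i j) * X j

lemma pderiv_linMap (A : Matrix (Fin n) (Fin n) ℂ) (i j : Fin n) :
    pderiv ℂ j (linMap A i) = C (A i j) := by
  rw [linMap, map_sum, Finset.sum_eq_single j]
  · rw [Derivation.leibniz]; simp
  · intro k _ hk; rw [Derivation.leibniz, pderiv_X_of_ne hk]; simp
  · simp

lemma zeroConst_linMap (A : Matrix (Fin n) (Fin n) ℂ) : ZeroConst (linMap A) := fun i => by
  simp [linMap]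

lemma isConvergent_linMap (A : Matrix (Fin n) (Fin n) ℂ) (i : Fin n) :
    IsConvergent (linMap A i) :=
  isConvergent_sum _ fun _ _ => (isConvergent_C _).mul (isConvergent_X _)

lemma sub_linMap_linPart_mem {Φ : Fin n → Ser n} (h : ZeroConst Φ) (i : Fin n) :
    Φ i - linMap (linPart Φ) i ∈ ordIdeal (Fin n) 2 := by
  rw [mem_ordIdeal_two]
  refine ⟨by rw [map_sub, h i, zeroConst_linMap, sub_zero], fun j => ?_⟩
  rw [map_sub, map_sub, pderiv_linMap]; simp [linPart, jac]

/-- The remainder of the inverse function theorem is quadratic: shrinking the radius by `t` scales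
it by `t ^ 2`, while the target ball shrinks only by `t`. A small `t`, then a small `s`, keep the
ball stable. -/
lemma exists_radii {M K : ℝ≥0} {r : ℝ≥0} (hr : 0 < r) : ∃ t s : ℝ≥0, 0 < t ∧ t ≤ 1 ∧ 0 < s ∧
    K * (s + t ^ 2 * M) ≤ t * r := by
  have hK : (K : ℝ) ≥ 0 := K.2
  have hM : (M : ℝ) ≥ 0 := M.2
  have hr' : (0 : ℝ) < r := hr
  set t : ℝ≥0 := min 1 (r / (2 * (K * M + 1))) with ht
  have ht0 : 0 < t := lt_min one_pos (by positivity)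
  have h1 : K * M * t ≤ r / 2 := by
    calc K * M * t ≤ (K * M + 1) * (r / (2 * (K * M + 1))) := by
          gcongr
          · exact le_self_add
          · exact min_le_right _ _
      _ = r / 2 := by field_simp
  refine ⟨t, t * r / (2 * (K + 1)), ht0, min_le_left _ _, by positivity, ?_⟩
  have h2 : K * (t * r / (2 * (K + 1))) ≤ t * r / 2 := by
    calc K * (t * r / (2 * (K + 1))) ≤ (K + 1) * (t * r / (2 * (K + 1))) := by
          gcongr; exact le_self_add
      _ = t * r / 2 := by field_simp
  calc K * (t * r / (2 * (K + 1)) + t ^ 2 * M)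
      = K * (t * r / (2 * (K + 1))) + t * (K * M * t) := by ring
    _ ≤ t * r / 2 + t * (r / 2) := by gcongr
    _ = t * r := by ring

lemma wnorm_sum_le {σ ι : Type*} (r : ℝ≥0) (s : Finset ι) (f : ι → MvPowerSeries σ ℂ) :
    wnorm r (∑ i ∈ s, f i) ≤ ∑ i ∈ s, wnorm r (f i) := by
  classical
  induction s using Finset.induction_on with
  | empty => simp [wnorm]
  | insert a s ha ih =>
    rw [Finset.sum_insert ha, Finset.sum_insert ha]
    exact (wnorm_add_le _ _ _).trans (add_le_add le_rfl ih)

/-- A formal map with invertible linear part has a right inverse, which converges if the map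
does. -/
lemma exists_rightInverse {Φ : Fin n → Ser n} (h : IsFormalDiffeo Φ) :
    ∃ Ψ : Fin n → Ser n, ZeroConst Ψ ∧ compMap Φ Ψ = X ∧
      ((∀ i, IsConvergent (Φ i)) → ∀ i, IsConvergent (Ψ i)) := by
  set A := linPart Φ with hA
  set B := A⁻¹ with hB
  have hAB : A * B = 1 := Matrix.mul_nonsing_inv _ h.2
  set N : Fin n → Ser n := fun i => Φ i - linMap A i with hN
  have hN2 : ∀ i, N i ∈ ordIdeal (Fin n) 2 := sub_linMap_linPart_mem h.zeroConst
  -- With `Φ = A + N` and `B = A⁻¹`, the equation `Φ ∘ ψ = X` reads `ψ = B (X - N ∘ ψ)`. As `N` has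
  -- order 2, the right side gains one order of contact.
  let T : (Fin n → Ser n) → Fin n → Ser n := fun ψ i => ∑ j, C (B i j) * (X j - subst ψ (N j))
  obtain ⟨s, ρ, hs, hρ⟩ : ∃ s ρ : ℝ≥0, 0 < s ∧ ((∀ i, IsConvergent (Φ i)) →
      ∀ i, ∑ j, ‖B i j‖ₑ * (s + wnorm ρ (N j)) ≤ ρ) := by
    by_cases hc : ∀ i, IsConvergent (Φ i)
    · have hNc : ∀ i, IsConvergent (N i) := fun i => (hc i).sub (isConvergent_linMap A i)
      obtain ⟨r, hr, hrN⟩ := exists_wnorm_le (a := N)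
        (fun i => mem_ordIdeal_one.1 (ordIdeal_mono one_le_two (hN2 i))) hNc one_pos
      obtain ⟨t, s, ht, ht1, hs, hts⟩ :=
        exists_radii (M := 1) (K := ∑ i, ∑ j, ‖B i j‖₊) (r := r) hr
      refine ⟨s, t * r, hs, fun _ i => ?_⟩
      calc ∑ j, ‖B i j‖ₑ * (s + wnorm (t * r) (N j))
          ≤ ∑ j, ‖B i j‖ₑ * ((s : ℝ≥0∞) + (t : ℝ≥0∞) ^ 2 * 1) := by
            gcongr with j
            refine (wnorm_le_of_mem_ordIdeal (hN2 j) ht1 r).trans ?_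
            gcongr
            exact hrN j
        _ = ((∑ j, ‖B i j‖₊ * (s + t ^ 2 * 1) : ℝ≥0) : ℝ≥0∞) := by
            push_cast; simp [enorm_eq_nnnorm]
        _ ≤ ((t * r : ℝ≥0) : ℝ≥0∞) := by
            rw [ENNReal.coe_le_coe]
            refine le_trans ?_ hts
            rw [← Finset.sum_mul]
            exact mul_le_mul' (Finset.single_le_sum (f := fun i => ∑ j, ‖B i j‖₊)
              (fun _ _ => zero_le) (Finset.mem_univ i)) le_rfl
    · exact ⟨1, 1, one_pos, fun h => (hc h).elim⟩
  -- The norm bound is imposed only when `Φ` converges, so a single fixed point serves both the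
  -- formal and the analytic statement.
  let S : Set (Fin n → Ser n) :=
    {ψ | ZeroConst ψ ∧ ((∀ i, IsConvergent (Φ i)) → ∀ i, wnorm s (ψ i) ≤ ρ)}
  obtain ⟨Ψ, hΨ, hfix⟩ := exists_fixedPoint T S ⟨fun i => by simp, fun _ i => by simp [wnorm]⟩
    (fun ψ hψ => by
      refine ⟨fun i => ?_, fun hc i => ?_⟩
      · simp only [T, map_sum, map_mul, map_sub, constantCoeff_subst_of_zeroConst hψ.1,
          mem_ordIdeal_one.1 (ordIdeal_mono one_le_two (hN2 _))]
        simp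
      · refine (wnorm_sum_le _ _ _).trans (le_trans ?_ (hρ hc i))
        gcongr with j
        refine (wnorm_mul_le _ _ _).trans ?_
        rw [wnorm_C, sub_eq_add_neg]
        gcongr
        refine (wnorm_add_le _ _ _).trans ?_
        rw [wnorm_X, wnorm_neg]
        gcongr
        exact wnorm_subst_le hψ.1 (hψ.2 hc) _)
    (fun a ha => by
      refine ⟨fun i => ?_, fun hc i => wnorm_le_of_approx fun n => ?_⟩
      · obtain ⟨b, hb, hab⟩ := ha 1
        have := mem_ordIdeal_one.1 (hab i)
        rwa [map_sub, hb.1 i, sub_zero] at this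
      · obtain ⟨b, hb, hab⟩ := ha n
        exact ⟨b i, hb.2 hc i, hab i⟩)
    (fun a ha b hb d hab i => by
      simp only [T, ← Finset.sum_sub_distrib, ← mul_sub]
      refine sum_mem fun j _ => Ideal.mul_mem_left _ _ ?_
      rw [sub_sub_sub_cancel_left, ← neg_sub]
      exact neg_mem (subst_sub_subst_mem_ordIdeal (m := 1) ha.1 hb.1 hab (hN2 j)))
  refine ⟨Ψ, hΨ.1, funext fun l => ?_, fun hc i => isConvergent_iff.2
    ⟨s, hs, ne_top_of_le_ne_top ENNReal.coe_ne_top (hΨ.2 hc i)⟩⟩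
  have h1 : ∑ i, C (A l i) * Ψ i = X l - subst Ψ (N l) := by
    calc ∑ i, C (A l i) * Ψ i = ∑ i, ∑ j, C (A l i * B i j) * (X j - subst Ψ (N j)) := by
          refine Finset.sum_congr rfl fun i _ => ?_
          conv_lhs => rw [← hfix]
          rw [Finset.mul_sum]
          exact Finset.sum_congr rfl fun j _ => by rw [map_mul, mul_assoc]
      _ = ∑ j, C ((A * B) l j) * (X j - subst Ψ (N j)) := by
          rw [Finset.sum_comm]
          refine Finset.sum_congr rfl fun j _ => ?_
          rw [Matrix.mul_apply, map_sum, Finset.sum_mul]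
      _ = X l - subst Ψ (N l) := by
          rw [hAB, Finset.sum_eq_single l]
          · simp
          · intro j _ hj; simp [Matrix.one_apply_ne hj.symm]
          · simp
  have h2 : Φ l = linMap A l + N l := by simp [hN]
  rw [compMap, h2, subst_add hΨ.1.hasSubst, linMap, subst_sum hΨ.1]
  simp only [subst_mul hΨ.1.hasSubst, subst_C, subst_X hΨ.1.hasSubst]
  rw [h1]; ring

lemma linPart_compMap {Ψ Φ : Fin n → Ser n} (hΦ : ZeroConst Φ) :
    linPart (compMap Ψ Φ) = linPart Ψ * linPart Φ := by
  ext i j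
  simp [linPart, jac, compMap, Matrix.mul_apply, pderiv_subst hΦ,
    constantCoeff_subst_of_zeroConst hΦ]

lemma linPart_X : linPart (X : Fin n → Ser n) = 1 := by
  ext i j
  rw [linPart, Matrix.map_apply, jac, Matrix.of_apply, pderiv_X, Matrix.one_apply, Pi.single_apply]
  split_ifs <;> simp

/-- The formal and analytic inverse function theorem. -/
theorem exists_inverse {Φ : Fin n → Ser n} (h : IsFormalDiffeo Φ) :
    ∃ Ψ : Fin n → Ser n, IsFormalDiffeo Ψ ∧ compMap Φ Ψ = X ∧ compMap Ψ Φ = X ∧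
      ((∀ i, IsConvergent (Φ i)) → ∀ i, IsConvergent (Ψ i)) := by
  obtain ⟨Ψ, hΨ, h1, hc⟩ := exists_rightInverse h
  have hd : IsFormalDiffeo Ψ := by
    refine ⟨hΨ, ?_⟩
    have := linPart_compMap (Ψ := Φ) hΨ
    rw [h1, linPart_X] at this
    exact (Matrix.isUnit_iff_isUnit_det _).1 (IsUnit.of_mul_eq_one_right _ this.symm)
  obtain ⟨Ξ, hΞ, h2, -⟩ := exists_rightInverse hd
  have : Φ = Ξ := by
    rw [← compMap_X Φ, ← h2, ← compMap_assoc hΨ hΞ, h1, X_compMap hΞ]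
  exact ⟨Ψ, hd, h1, by rw [this]; exact h2, hc⟩

end Inverse

end SaddleNode
end

noncomputable section

namespace SaddleNode

/-! ### Transverse bracket and divergence. -/

section Brackets

lemma pderiv_comm {σ : Type*} (i j : σ) (f : MvPowerSeries σ ℂ) :
    pderiv ℂ i (pderiv ℂ j f) = pderiv ℂ j (pderiv ℂ i f) := by
  classical
  ext k
  rw [coeff_pderiv, coeff_pderiv, coeff_pderiv, coeff_pderiv, add_right_comm]
  by_cases h : i = j
  · rw [h]
  · rw [Finsupp.add_apply, Finsupp.add_apply, Finsupp.single_eq_of_ne h,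
      Finsupp.single_eq_of_ne (Ne.symm h)]
    push_cast; ring

@[simp] lemma pderiv_X01 : pderiv ℂ (1 : Fin 3) (X 0 : Ser 3) = 0 := pderiv_X_of_ne (by decide)
@[simp] lemma pderiv_X02 : pderiv ℂ (2 : Fin 3) (X 0 : Ser 3) = 0 := pderiv_X_of_ne (by decide)
@[simp] lemma pderiv_X10 : pderiv ℂ (0 : Fin 3) (X 1 : Ser 3) = 0 := pderiv_X_of_ne (by decide)
@[simp] lemma pderiv_X12 : pderiv ℂ (2 : Fin 3) (X 1 : Ser 3) = 0 := pderiv_X_of_ne (by decide)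
@[simp] lemma pderiv_X20 : pderiv ℂ (0 : Fin 3) (X 2 : Ser 3) = 0 := pderiv_X_of_ne (by decide)
@[simp] lemma pderiv_X21 : pderiv ℂ (1 : Fin 3) (X 2 : Ser 3) = 0 := pderiv_X_of_ne (by decide)

lemma pderiv_mul {σ : Type*} (i : σ) (f g : MvPowerSeries σ ℂ) :
    pderiv ℂ i (f * g) = f * pderiv ℂ i g + g * pderiv ℂ i f := Derivation.leibniz _ f g

lemma lie_three (Y : Fin 3 → Ser 3) (f : Ser 3) :
    lie Y f = Y 0 * pderiv ℂ 0 f + Y 1 * pderiv ℂ 1 f + Y 2 * pderiv ℂ 2 f :=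
  Fin.sum_univ_three _

lemma lie_X {n : ℕ} (Y : Fin n → Ser n) (i : Fin n) : lie Y (X i) = Y i := by
  rw [lie, Finset.sum_eq_single i]
  · simp
  · intro j _ hj; rw [pderiv_X_of_ne hj.symm, mul_zero]
  · simp

lemma lie_add {n : ℕ} (Y : Fin n → Ser n) (f g : Ser n) : lie Y (f + g) = lie Y f + lie Y g := by
  simp [lie, mul_add, Finset.sum_add_distrib]

lemma lie_mul {n : ℕ} (Y : Fin n → Ser n) (f g : Ser n) :
    lie Y (f * g) = f * lie Y g + g * lie Y f := by
  simp only [lie, pderiv_mul, Finset.mul_sum, ← Finset.sum_add_distrib]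
  exact Finset.sum_congr rfl fun i _ => by ring

/-- The Poisson bracket in the transverse variables. -/
def brk (f g : Ser 3) : Ser 3 :=
  pderiv ℂ 1 f * pderiv ℂ 2 g - pderiv ℂ 2 f * pderiv ℂ 1 g

/-- The divergence in the transverse variables. -/
def ydiv (Y : Fin 3 → Ser 3) : Ser 3 := pderiv ℂ 1 (Y 1) + pderiv ℂ 2 (Y 2)

lemma brk_subst {Φ : Fin 3 → Ser 3} (hΦ : ZeroConst Φ) (h0 : Φ 0 = X 0) (f g : Ser 3) :
    brk (subst Φ f) (subst Φ g) = subst Φ (brk f g) * brk (Φ 1) (Φ 2) := by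
  simp only [brk, pderiv_subst hΦ, Fin.sum_univ_three, h0, pderiv_X01, pderiv_X02, mul_zero,
    zero_add, subst_sub hΦ.hasSubst, subst_mul hΦ.hasSubst]
  ring

/-- This is the Lie derivative of the transverse area form. Only transverse derivatives of `Y 1` and
`Y 2` survive because `Y 0` does not depend on `y₁, y₂`. -/
lemma brk_lie {Y : Fin 3 → Ser 3} (h1 : pderiv ℂ 1 (Y 0) = 0) (h2 : pderiv ℂ 2 (Y 0) = 0)
    (f g : Ser 3) :
    brk (lie Y f) g + brk f (lie Y g) = lie Y (brk f g) + ydiv Y * brk f g := by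
  simp only [brk, lie_three, ydiv, map_add, map_sub, pderiv_mul, h1, h2,
    pderiv_comm (1 : Fin 3) 0, pderiv_comm (2 : Fin 3) 0, pderiv_comm (2 : Fin 3) 1]
  ring

/-- The identity `brk_lie` applied to the components of the conjugacy: the transformation law of the
divergence. It yields the equation satisfied by the Jacobian of a normalizing map as well as the
invariance of the residue. -/
lemma subst_ydiv_mul {Φ Y Z : Fin 3 → Ser 3} (hΦ : ZeroConst Φ) (h0 : Φ 0 = X 0)
    (h1 : pderiv ℂ 1 (Y 0) = 0) (h2 : pderiv ℂ 2 (Y 0) = 0) (h : PushesTo Φ Y Z) :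
    subst Φ (ydiv Z) * brk (Φ 1) (Φ 2) =
      lie Y (brk (Φ 1) (Φ 2)) + ydiv Y * brk (Φ 1) (Φ 2) := by
  have e := brk_lie h1 h2 (subst Φ (X 1 : Ser 3)) (subst Φ (X 2 : Ser 3))
  rw [lie_subst hΦ h, lie_subst hΦ h, brk_subst hΦ h0, brk_subst hΦ h0, lie_X, lie_X,
    subst_X hΦ.hasSubst, subst_X hΦ.hasSubst] at e
  rw [← e, ← add_mul, ← subst_add hΦ.hasSubst]
  congr 2
  simp [brk, ydiv]

lemma linPart_det {Φ : Fin 3 → Ser 3} (h0 : Φ 0 = X 0) :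
    (linPart Φ).det = constantCoeff (brk (Φ 1) (Φ 2)) := by
  rw [Matrix.det_fin_three]
  simp [linPart, jac, h0, brk]

lemma isFibered_iff {Φ : Fin 3 → Ser 3} : IsFibered Φ ↔
    ZeroConst Φ ∧ Φ 0 = X 0 ∧ constantCoeff (brk (Φ 1) (Φ 2)) ≠ 0 := by
  constructor
  · rintro ⟨⟨h1, h2⟩, h0⟩
    refine ⟨h1, h0, ?_⟩
    rw [← linPart_det h0]; exact h2.ne_zero
  · rintro ⟨h1, h0, h2⟩
    refine ⟨⟨h1, ?_⟩, h0⟩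
    rw [← linPart_det h0] at h2; exact isUnit_iff_ne_zero.2 h2

lemma area3_eq : area3 = !![0, 0, 0; 0, 0, 1; 0, -1, 0] := by
  ext i j : 1
  fin_cases i <;> fin_cases j <;> simp [area3, wedge, d0]

lemma dx_eq : dx = ![1, 0, 0] := by
  ext i : 1
  fin_cases i <;> simp [dx, d0]

/-- Modulo `dx` a 2-form retains only its `dy₁ ∧ dy₂` component; for the pull-back of the area this
component is the bracket, which also supplies invertibility. -/
lemma isTransSymplectic_iff {Φ : Fin 3 → Ser 3} : IsTransSymplectic Φ ↔
    ZeroConst Φ ∧ Φ 0 = X 0 ∧ brk (Φ 1) (Φ 2) = 1 := by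
  have key : ZeroConst Φ → pullback2 Φ area3 =
      Matrix.of fun i j => pderiv ℂ i (Φ 1) * pderiv ℂ j (Φ 2) -
        pderiv ℂ i (Φ 2) * pderiv ℂ j (Φ 1) := by
    intro hΦ
    have hm : area3.map (subst Φ) = !![0, 0, 0; 0, 0, 1; 0, -1, 0] := by
      rw [area3_eq]
      ext i j : 1
      fin_cases i <;> fin_cases j <;>
        simp [subst_const_zero hΦ, subst_const_one hΦ, subst_neg hΦ]
    rw [pullback2, hm]
    ext i j : 1
    simp [Matrix.mul_apply, Fin.sum_univ_three, jac]
    ring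
  constructor
  · rintro ⟨hf, η, hη⟩
    refine ⟨hf.1.1, hf.2, ?_⟩
    have := congrFun (congrFun hη 1) 2
    rw [Matrix.sub_apply, key hf.1.1, area3_eq] at this
    simp [wedge, dx_eq] at this
    rw [sub_eq_zero] at this
    rw [brk, ← this]; ring
  · rintro ⟨hz, h0, hb⟩
    refine ⟨isFibered_iff.2 ⟨hz, h0, by simp [hb]⟩, fun j => pderiv ℂ 0 (Φ 1) * pderiv ℂ j (Φ 2) -
        pderiv ℂ 0 (Φ 2) * pderiv ℂ j (Φ 1), ?_⟩
    rw [key hz, area3_eq]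
    rw [brk] at hb
    ext i j : 1
    fin_cases i <;> fin_cases j <;> simp [wedge, dx_eq]
    all_goals first
      | linear_combination hb
      | linear_combination -hb
      | ring

lemma IsTransSymplectic.diffeo {Φ : Fin 3 → Ser 3} (h : IsTransSymplectic Φ) : IsFormalDiffeo Φ :=
  h.1.1

lemma IsTransSymplectic.comp {Ψ Φ : Fin 3 → Ser 3} (hΨ : IsTransSymplectic Ψ)
    (hΦ : IsTransSymplectic Φ) : IsTransSymplectic (compMap Ψ Φ) := by
  rw [isTransSymplectic_iff] at *
  refine ⟨zeroConst_compMap hΨ.1 hΦ.1, ?_, ?_⟩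
  · rw [compMap, hΨ.2.1, subst_X hΦ.1.hasSubst, hΦ.2.1]
  · rw [compMap, compMap, brk_subst hΦ.1 hΦ.2.1, hΨ.2.2, hΦ.2.2, subst_const_one hΦ.1, one_mul]

lemma inverse_fibered {n : ℕ} {Φ Ψ : Fin (n + 1) → Ser (n + 1)} (hΨ : ZeroConst Ψ)
    (h0 : Φ 0 = X 0) (h : compMap Φ Ψ = X) : Ψ 0 = X 0 := by
  have := congrFun h 0
  rwa [compMap, h0, subst_X hΨ.hasSubst] at this

lemma IsTransSymplectic.symm {Ψ Φ : Fin 3 → Ser 3} (hΦ : IsTransSymplectic Φ)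
    (hΨ : ZeroConst Ψ) (h : compMap Φ Ψ = X) : IsTransSymplectic Ψ := by
  rw [isTransSymplectic_iff] at *
  have h0 : Ψ 0 = X 0 := inverse_fibered hΨ hΦ.2.1 h
  refine ⟨hΨ, h0, ?_⟩
  have := brk_subst hΨ h0 (Φ 1) (Φ 2)
  rw [hΦ.2.2, subst_const_one hΨ, one_mul] at this
  rw [← this]
  have e1 := congrFun h 1
  have e2 := congrFun h 2
  rw [compMap] at e1 e2
  rw [e1, e2]; simp [brk]

/-- The quotient `q` is forced to be `x`, and the `dy₁ ∧ dy₂` component of the Lie derivative of the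
area is the divergence. -/
lemma IsTransHam.ydiv_eq {Y : Fin 3 → Ser 3} (h : IsTransHam Y) (h0 : Y 0 = X 0 ^ 2) :
    ydiv Y = X 0 := by
  obtain ⟨-, -, q, hq, η, hη⟩ := h
  have hq' : q = X 0 := by
    rw [lie_X, h0, pow_two] at hq
    have hX : (X 0 : Ser 3) ≠ 0 := by
      intro h
      have := congrArg (pderiv ℂ 0) h
      simp at this
    exact (mul_left_cancel₀ hX hq).symm
  have := congrFun (congrFun hη 1) 2
  rw [hq', area3_eq] at this
  simp only [lie2, Matrix.sub_apply, Matrix.add_apply, Matrix.mul_apply, Fin.sum_univ_three,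
    Matrix.map_apply, Matrix.transpose_apply, jac, Matrix.of_apply, Matrix.smul_apply, wedge,
    dx_eq, lie_three] at this
  simp at this
  rw [ydiv]
  linear_combination this

end Brackets

/-! ### Resonant series and diagonal fields. -/

section Resonance

/-- The weight operator `y₁ ∂/∂y₁ - y₂ ∂/∂y₂`. -/
def del (f : Ser 3) : Ser 3 := X 1 * pderiv ℂ 1 f - X 2 * pderiv ℂ 2 f

lemma coeff_del (f : Ser 3) (k : Fin 3 →₀ ℕ) :
    coeff k (del f) = ((k 1 : ℂ) - k 2) * coeff k f := by
  rw [del, map_sub, coeff_X_mul_pderiv, coeff_X_mul_pderiv, sub_mul]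

lemma del_mul (f g : Ser 3) : del (f * g) = f * del g + g * del f := by
  simp only [del, pderiv_mul]; ring

lemma del_add (f g : Ser 3) : del (f + g) = del f + del g := by
  simp only [del, map_add]; ring

lemma del_sub (f g : Ser 3) : del (f - g) = del f - del g := by
  simp only [del, map_sub]; ring

@[simp] lemma del_X0 : del (X 0) = 0 := by simp [del]

@[simp] lemma del_C (c : ℂ) : del (C c) = 0 := by simp [del]

lemma del_eq_zero_iff {f : Ser 3} :
    del f = 0 ↔ ∀ k : Fin 3 →₀ ℕ, k 1 ≠ k 2 → coeff k f = 0 := by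
  constructor
  · intro h k hk
    have := congrArg (coeff k) h
    rw [coeff_del, map_zero, mul_eq_zero, sub_eq_zero] at this
    exact this.resolve_left (by exact_mod_cast hk)
  · intro h
    ext k
    rw [coeff_del, map_zero]
    by_cases hk : k 1 = k 2
    · rw [hk]; ring
    · rw [h k hk, mul_zero]

lemma del_eq_zero_of_mul {f g : Ser 3} (hg : del g = 0) (hg0 : g ≠ 0) (h : del (g * f) = 0) :
    del f = 0 := by
  rw [del_mul, hg, mul_zero, add_zero] at h
  exact (mul_eq_zero.1 h).resolve_left hg0

/-- The vector field `x² ∂/∂x + k₁ y₁ ∂/∂y₁ + k₂ y₂ ∂/∂y₂`. -/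
def diagField (k₁ k₂ : Ser 3) : Fin 3 → Ser 3 := ![X 0 ^ 2, k₁ * X 1, k₂ * X 2]

lemma lie_diagField (k₁ k₂ f : Ser 3) : lie (diagField k₁ k₂) f =
    X 0 * (X 0 * pderiv ℂ 0 f) + k₁ * (X 1 * pderiv ℂ 1 f) + k₂ * (X 2 * pderiv ℂ 2 f) := by
  rw [lie_three]; simp [diagField]; ring

/-- Each `Xᵢ∂ᵢ` is diagonal on monomials and so commutes with `del`, while resonant coefficients
behave as constants for `del`. -/
lemma del_lie_diagField {k₁ k₂ : Ser 3} (h1 : del k₁ = 0) (h2 : del k₂ = 0) (f : Ser 3) :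
    del (lie (diagField k₁ k₂) f) = lie (diagField k₁ k₂) (del f) := by
  have c : ∀ i : Fin 3, del (X i * pderiv ℂ i f) = X i * pderiv ℂ i (del f) := fun i => by
    ext k
    rw [coeff_del, coeff_X_mul_pderiv, coeff_X_mul_pderiv, coeff_del]; ring
  simp only [lie_diagField, del_add, del_mul _ (_ * pderiv ℂ _ _), c, del_X0, h1, h2]
  ring

lemma X_mul_pderiv_mem_ordIdeal {σ : Type*} {d : ℕ} {f : MvPowerSeries σ ℂ} (i : σ)
    (hf : f ∈ ordIdeal σ d) : X i * pderiv ℂ i f ∈ ordIdeal σ d := by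
  rw [X_mul_pderiv_eq_mulCoeff]; exact mulCoeff_mem_ordIdeal _ hf

/-- Solutions of `N f = f q` are resonant when the resonant field `N` has non-zero linear part
and the resonant series `q` vanishes at the origin. -/
lemma del_eq_zero_of_lie_eq {l : ℂ} (hl : l ≠ 0) {k₁ k₂ q f : Ser 3} (h1 : del k₁ = 0)
    (h2 : del k₂ = 0) (hk₁ : constantCoeff k₁ = -l) (hk₂ : constantCoeff k₂ = l)
    (hq : del q = 0) (hq0 : constantCoeff q = 0) (h : lie (diagField k₁ k₂) f = f * q) :
    del f = 0 := by
  have hg : lie (diagField k₁ k₂) (del f) = del f * q := by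
    rw [← del_lie_diagField h1 h2, h, del_mul, hq]; ring
  have hnr : ∀ k : Fin 3 →₀ ℕ, k 1 = k 2 → coeff k (del f) = 0 := fun k hk => by
    rw [coeff_del, hk, sub_self, zero_mul]
  set g := del f
  have main : ∀ n, g ∈ ordIdeal (Fin 3) n := by
    intro n
    induction n with
    | zero => simp
    | succ n ih =>
      -- The linear part of the field acts as `-l del`; every remaining term raises the order. Since
      -- `g = del f` has no resonant monomial, `del` can be divided out and the order of `g` grows
      -- indefinitely.
      have e : C l * del g = X 0 * (X 0 * pderiv ℂ 0 g) + (k₁ + C l) * (X 1 * pderiv ℂ 1 g)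
          + (k₂ - C l) * (X 2 * pderiv ℂ 2 g) - q * g := by
        rw [lie_diagField] at hg
        rw [del]
        linear_combination -hg
      have m : C l * del g ∈ ordIdeal (Fin 3) (1 + n) := by
        rw [e]
        refine sub_mem (add_mem (add_mem ?_ ?_) ?_) ?_
        · exact mul_mem_ordIdeal (X_mem_ordIdeal 0) (X_mul_pderiv_mem_ordIdeal _ ih)
        · exact mul_mem_ordIdeal (mem_ordIdeal_one.2 (by simp [hk₁]))
            (X_mul_pderiv_mem_ordIdeal _ ih)
        · exact mul_mem_ordIdeal (mem_ordIdeal_one.2 (by simp [hk₂]))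
            (X_mul_pderiv_mem_ordIdeal _ ih)
        · exact mul_mem_ordIdeal (mem_ordIdeal_one.2 hq0) ih
      intro k hk
      have hk' := m k (by omega)
      rw [coeff_C_mul, coeff_del, mul_eq_zero, mul_eq_zero] at hk'
      by_cases hk12 : k 1 = k 2
      · exact hnr k hk12
      · refine (hk'.resolve_left hl).resolve_left ?_
        rw [sub_eq_zero]; exact_mod_cast hk12
  exact eq_of_forall_sub_mem_ordIdeal fun d => by rw [sub_zero]; exact main d

end Resonance

/-! ### Restriction to `x = 0` and congruence modulo `x`. -/

section Restriction

lemma zeroConst_restr : ZeroConst (![0, X 0, X 1] : Fin 3 → Ser 2) := fun i => by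
  fin_cases i <;> simp

lemma restr_eq_of_dvd {f g : Ser 3} (h : X 0 ∣ f - g) : restr f = restr g := by
  obtain ⟨q, hq⟩ := h
  rw [← sub_eq_zero, restr, restr, ← subst_sub zeroConst_restr.hasSubst, hq,
    subst_mul zeroConst_restr.hasSubst, subst_X zeroConst_restr.hasSubst]
  simp

lemma isConvergent_restr {f : Ser 3} (h : IsConvergent f) : IsConvergent (restr f) :=
  h.subst zeroConst_restr fun i => by
    fin_cases i
    · exact isConvergent_zero
    · exact isConvergent_X 0
    · exact isConvergent_X 1

/-- The lift of `f(0, y)` back to three variables. It replaces `f` wherever only the class modulo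
`x` matters, and it converges even if `f` does not. -/
lemma exists_convergent_of_restr {f : Ser 3} (h : IsConvergent (restr f)) :
    ∃ g : Ser 3, IsConvergent g ∧ X 0 ∣ f - g := by
  have hz : ZeroConst (![X 1, X 2] : Fin 2 → Ser 3) := fun i => by fin_cases i <;> simp
  refine ⟨subst (![X 1, X 2] : Fin 2 → Ser 3) (restr f), h.subst hz fun i => ?_, ?_⟩
  · fin_cases i
    · exact isConvergent_X 1
    · exact isConvergent_X 2
  · rw [restr, subst_comp_subst_apply zeroConst_restr.hasSubst hz.hasSubst]
    conv_rhs => rw [← subst_X_eq f]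
    rw [subst_X_eq f]
    nth_rewrite 1 [← subst_X_eq f]
    refine X_dvd_subst_sub_subst zeroConst_X (fun i => ?_) (fun i => ?_) f
    · rw [constantCoeff_subst_of_zeroConst hz]; exact zeroConst_restr i
    · fin_cases i
      · simp [subst_const_zero hz]
      · simp [subst_X hz.hasSubst]
      · simp [subst_X hz.hasSubst]

lemma pderiv_restr (f : Ser 3) (j : Fin 2) :
    pderiv ℂ j (restr f) = restr (pderiv ℂ j.succ f) := by
  rw [restr, pderiv_subst zeroConst_restr, Fin.sum_univ_three, restr]
  fin_cases j <;> simp [pderiv_X_of_ne]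

lemma area2_eq : area2 = !![0, 1; -1, 0] := by
  ext i j : 1
  fin_cases i <;> fin_cases j <;> simp [area2, wedge, d0, pderiv_X_of_ne]

lemma det_jac_restrMap {Φ : Fin 3 → Ser 3} : (jac (restrMap Φ)).det = restr (brk (Φ 1) (Φ 2)) := by
  rw [Matrix.det_fin_two]
  simp only [jac, Matrix.of_apply, restrMap, Matrix.cons_val_zero, Matrix.cons_val_one,
    pderiv_restr, brk]
  simp [restr, subst_sub zeroConst_restr.hasSubst, subst_mul zeroConst_restr.hasSubst]

lemma restrMap_zeroConst {Φ : Fin 3 → Ser 3} (h : ZeroConst Φ) : ZeroConst (restrMap Φ) := by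
  intro i
  fin_cases i <;> simp [restrMap, restr, constantCoeff_subst_of_zeroConst zeroConst_restr, h _]

lemma IsTransSymplectic.restr_diffeo {Φ : Fin 3 → Ser 3} (h : IsTransSymplectic Φ) :
    IsFormalDiffeo (restrMap Φ) ∧ pullback2 (restrMap Φ) area2 = area2 := by
  rw [isTransSymplectic_iff] at h
  have hz := restrMap_zeroConst h.1
  have hdet : (jac (restrMap Φ)).det = 1 := by
    rw [det_jac_restrMap, h.2.2]; exact subst_const_one zeroConst_restr
  refine ⟨⟨hz, ?_⟩, ?_⟩
  · rw [← RingHom.mapMatrix_apply, ← RingHom.map_det, hdet]; simp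
  · rw [Matrix.det_fin_two] at hdet
    have hm : area2.map (subst (restrMap Φ)) = !![0, 1; -1, 0] := by
      rw [area2_eq]
      ext i j : 1
      fin_cases i <;> fin_cases j <;>
        simp [subst_const_zero hz, subst_const_one hz, subst_neg hz]
    rw [pullback2, hm, area2_eq]
    ext i j : 1
    fin_cases i <;> fin_cases j <;> simp [Matrix.mul_apply, Fin.sum_univ_two]
    · ring
    · linear_combination hdet
    · linear_combination -hdet
    · ring

end Restriction

end SaddleNode
end

noncomputable section

namespace SaddleNode

/-! ### Division by a monomial. -/

section Division

variable {σ : Type*}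

lemma exists_eq_monomial_mul (s : σ →₀ ℕ) {f : MvPowerSeries σ ℂ}
    (h : ∀ k, ¬ s ≤ k → coeff k f = 0) :
    ∃ g, f = monomial s 1 * g ∧ (∀ k, coeff k g = coeff (k + s) f) ∧
      (IsConvergent f → IsConvergent g) := by
  classical
  let g : MvPowerSeries σ ℂ := fun k => coeff (k + s) f
  have hg : ∀ k, coeff k g = coeff (k + s) f := fun _ => rfl
  refine ⟨g, ?_, hg, fun hf => ?_⟩
  · ext k
    rw [coeff_monomial_mul]
    split_ifs with hk
    · rw [one_mul, hg, tsub_add_cancel_of_le hk]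
    · exact h k hk
  · refine hf.of_le (fun k => k + s) (add_left_injective s) 1 1 le_rfl 1 s.degree
      (fun k => by simp) fun k => ?_
    rw [one_pow, one_mul, one_mul, hg]

end Division

/-! ### Morse coordinates and integer-weight equations. -/

section Morse

/-- The Morse lemma for a Hamiltonian with hyperbolic quadratic part, with parameter. -/
lemma exists_morse {l : ℂ} (hl : l ≠ 0) {H : Ser 3}
    (h1 : ∀ k : Fin 3 →₀ ℕ, k 1 + k 2 ≤ 1 → coeff k H = 0)
    (h11 : coeff (Finsupp.single 1 2) H = 0) (h22 : coeff (Finsupp.single 2 2) H = 0)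
    (h12 : coeff (Finsupp.single 1 1 + Finsupp.single 2 1) H = l) :
    ∃ u₁ u₂ : Ser 3, H = C l * (u₁ * u₂) ∧ u₁ - X 1 ∈ ordIdeal (Fin 3) 2 ∧
      u₂ - X 2 ∈ ordIdeal (Fin 3) 2 ∧ (IsConvergent H → IsConvergent u₁ ∧ IsConvergent u₂) := by
  classical
  have hle : ∀ (i : Fin 3) (n : ℕ) (k : Fin 3 →₀ ℕ), Finsupp.single i n ≤ k ↔ n ≤ k i :=
    fun i n k => Finsupp.single_le_iff
  have hb : ∀ (p : (Fin 3 →₀ ℕ) → Prop) [DecidablePred p],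
      IsConvergent H → IsConvergent (mulCoeff (fun k => if p k then 1 else 0) H) := fun p _ hH =>
    hH.mulCoeff 1 fun k => by split_ifs <;> simp
  obtain ⟨A, hA, hAk, hAc⟩ := exists_eq_monomial_mul (Finsupp.single 1 2)
    (f := mulCoeff (fun k => if 2 ≤ k 1 then 1 else 0) H) (fun k hk => by
      rw [hle] at hk; rw [coeff_mulCoeff, if_neg hk, zero_mul])
  obtain ⟨D, hD, hDk, hDc⟩ := exists_eq_monomial_mul (Finsupp.single 1 1 + Finsupp.single 2 1)
    (f := mulCoeff (fun k => if k 1 = 1 then 1 else 0) H) (fun k hk => by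
      rw [coeff_mulCoeff]
      split_ifs with hk1
      · rw [one_mul]
        apply h1
        by_contra hcon
        apply hk
        intro i
        fin_cases i <;> simp <;> omega
      · rw [zero_mul])
  obtain ⟨C', hC, hCk, hCc⟩ := exists_eq_monomial_mul (Finsupp.single 2 2)
    (f := mulCoeff (fun k => if k 1 = 0 then 1 else 0) H) (fun k hk => by
      rw [hle] at hk
      rw [coeff_mulCoeff]
      split_ifs with hk1
      · rw [one_mul]; exact h1 k (by omega)
      · rw [zero_mul])
  have hH : H = X 1 ^ 2 * A + X 1 * X 2 * D + X 2 ^ 2 * C' := by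
    rw [X_pow_eq, X_pow_eq, ← hA, ← hC, X, X, monomial_mul_monomial, one_mul, ← hD]
    ext k
    simp only [map_add, coeff_mulCoeff]
    rcases Nat.lt_trichotomy (k 1) 1 with h | h | h
    · rw [if_neg (by omega), if_neg (by omega), if_pos (by omega)]; ring
    · rw [if_neg (by omega), if_pos (by omega), if_neg (by omega)]; ring
    · rw [if_pos (by omega), if_neg (by omega), if_neg (by omega)]; ring
  have hA0 : constantCoeff A = 0 := by
    rw [← coeff_zero_eq_constantCoeff_apply, hAk, zero_add, coeff_mulCoeff, h11, mul_zero]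
  have hC0 : constantCoeff C' = 0 := by
    rw [← coeff_zero_eq_constantCoeff_apply, hCk, zero_add, coeff_mulCoeff, h22, mul_zero]
  have hD0 : constantCoeff D = l := by
    rw [← coeff_zero_eq_constantCoeff_apply, hDk, zero_add, coeff_mulCoeff, h12]; simp
  have hDi : D * D⁻¹ = 1 := MvPowerSeries.mul_inv_cancel _ (by rw [hD0]; exact hl)
  set a := A * D⁻¹ with ha
  set c := C' * D⁻¹ with hc
  have hac : constantCoeff (a * c) = 0 := by simp [ha, hA0]
  -- Here `H = A y₁² + D y₁y₂ + C' y₂²`, and `y₁ + p y₂` divides it when `D p = C' + A p²`. The root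
  -- vanishing at the origin is `p = c q` with `q = 1 + ac q²`, the Catalan generating function at
  -- `ac`, which converges since its coefficients are at most `4 ^ n`.
  let Cat : PowerSeries ℂ := PowerSeries.map (Nat.castRingHom ℂ) PowerSeries.catalanSeries
  set q := PowerSeries.subst (a * c) Cat with hq
  have hqe : q = q ^ 2 * (a * c) + 1 := by
    have hs := PowerSeries.HasSubst.of_constantCoeff_zero hac
    have e : Cat ^ 2 * PowerSeries.X + 1 = Cat := by
      have := congrArg (PowerSeries.map (Nat.castRingHom ℂ))
        PowerSeries.catalanSeries_sq_mul_X_add_one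
      simpa using this
    have h1 : PowerSeries.subst (a * c) (1 : PowerSeries ℂ) = 1 :=
      subst_const_one (zeroConst_const hac)
    conv_lhs => rw [hq, ← e, PowerSeries.subst_add hs, PowerSeries.subst_mul hs,
      PowerSeries.subst_pow hs, PowerSeries.subst_X hs, h1]
  set p := c * q with hp
  have hp0 : constantCoeff p = 0 := by simp [hp, hc, hC0]
  have hpe : D * p = C' + A * p ^ 2 := by
    have e1 : D * a = A := by rw [ha]; linear_combination A * hDi
    have e2 : D * c = C' := by rw [hc]; linear_combination C' * hDi
    rw [hp]
    linear_combination (q - a * c * q ^ 2) * e2 + C' * hqe + c ^ 2 * q ^ 2 * e1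
  have hli : (C l : Ser 3) * C l⁻¹ = 1 := by rw [← map_mul, mul_inv_cancel₀ hl, map_one]
  refine ⟨X 1 + p * X 2, C l⁻¹ * (A * X 1 + (D - A * p) * X 2), ?_, ?_, ?_, fun hHc => ?_⟩
  · rw [hH]
    linear_combination -(X 2 ^ 2) * hpe - (X 1 + p * X 2) * (A * X 1 + (D - A * p) * X 2) * hli
  · rw [add_sub_cancel_left]
    exact mul_mem_ordIdeal (mem_ordIdeal_one.2 hp0) (X_mem_ordIdeal 2)
  · have e : C l⁻¹ * (A * X 1 + (D - A * p) * X 2) - X 2 =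
        C l⁻¹ * (A * X 1 + (D - A * p - C l) * X 2) := by
      linear_combination (X 2 : Ser 3) * hli
    rw [e]
    refine Ideal.mul_mem_left _ _ (add_mem ?_ ?_)
    · exact mul_mem_ordIdeal (mem_ordIdeal_one.2 hA0) (X_mem_ordIdeal 1)
    · exact mul_mem_ordIdeal (mem_ordIdeal_one.2 (by simp [hD0, hA0])) (X_mem_ordIdeal 2)
  · have cA := hAc (hb _ hHc)
    have cD := hDc (hb _ hHc)
    have cC := hCc (hb _ hHc)
    have cCat : IsConvergent Cat := isConvergent_of_norm_coeff_le 1 4 fun n => by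
      simp only [Cat, PowerSeries.coeff_map, PowerSeries.catalanSeries_coeff]
      have h1 : catalan n ≤ 4 ^ n := by
        rw [catalan_eq_centralBinom_div]
        exact (Nat.div_le_self _ _).trans (by
          rw [Nat.centralBinom_eq_two_mul_choose]
          calc _ ≤ 2 ^ (2 * n) := Nat.choose_le_two_pow _ _
            _ = 4 ^ n := by rw [pow_mul]; norm_num)
      rw [eq_natCast, Complex.nnnorm_natCast, one_mul]
      exact_mod_cast h1
    have ca : IsConvergent a := cA.mul cD.inv
    have cc : IsConvergent c := cC.mul cD.inv
    have cp : IsConvergent p := cc.mul (cCat.powerSeries_subst hac (ca.mul cc))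
    exact ⟨(isConvergent_X _).add (cp.mul (isConvergent_X _)), (isConvergent_C _).mul
      ((cA.mul (isConvergent_X _)).add ((cD.sub (cA.mul cp)).mul (isConvergent_X _)))⟩

/-- The map `(x, z₁, z₂)`. -/
lemma zeroConst_cons {f g : Ser 3} (hf : constantCoeff f = 0) (hg : constantCoeff g = 0) :
    ZeroConst (![X 0, f, g] : Fin 3 → Ser 3) := fun i => by
  fin_cases i
  · simp
  · exact hf
  · exact hg

lemma constantCoeff_of_sub_X_mem {i : Fin 3} {f : Ser 3} (h : f - X i ∈ ordIdeal (Fin 3) 2) :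
    constantCoeff f = 0 := by
  have := mem_ordIdeal_one.1 (ordIdeal_mono one_le_two h)
  simpa using this

lemma constantCoeff_brk_of_sub_X_mem {f g : Ser 3} (hf : f - X 1 ∈ ordIdeal (Fin 3) 2)
    (hg : g - X 2 ∈ ordIdeal (Fin 3) 2) : constantCoeff (brk f g) = 1 := by
  have a := (mem_ordIdeal_two.1 hf).2
  have b := (mem_ordIdeal_two.1 hg).2
  have a1 := a 1
  have a2 := a 2
  have b1 := b 1
  have b2 := b 2
  simp only [map_sub, pderiv_X12, pderiv_X21, pderiv_X_self, map_one, sub_zero,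
    sub_eq_zero] at a1 a2 b1 b2
  simp [brk, a1, a2, b1, b2]

lemma isFibered_cons {f g : Ser 3} (hf : f - X 1 ∈ ordIdeal (Fin 3) 2)
    (hg : g - X 2 ∈ ordIdeal (Fin 3) 2) : IsFibered (![X 0, f, g] : Fin 3 → Ser 3) :=
  isFibered_iff.2 ⟨zeroConst_cons (constantCoeff_of_sub_X_mem hf) (constantCoeff_of_sub_X_mem hg),
    rfl, by
      change constantCoeff (brk f g) ≠ 0
      rw [constantCoeff_brk_of_sub_X_mem hf hg]; exact one_ne_zero⟩

lemma isConvergent_cons {f g : Ser 3} (hf : IsConvergent f) (hg : IsConvergent g) :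
    ∀ i, IsConvergent ((![X 0, f, g] : Fin 3 → Ser 3) i) := fun i => by
  fin_cases i
  · exact isConvergent_X 0
  · exact hf
  · exact hg

lemma eq_mulCoeff_of_add_X_mul_pderiv {g J : Ser 3} (h : g + X 1 * pderiv ℂ 1 g = J) :
    g = mulCoeff (fun k => ((k 1 : ℂ) + 1)⁻¹) J := by
  subst h
  ext k
  have hn : ((k 1 : ℂ) + 1) ≠ 0 := Nat.cast_add_one_ne_zero _
  rw [coeff_mulCoeff, map_add, coeff_X_mul_pderiv]
  field_simp
  ring

lemma eq_zero_of_add_X_mul_pderiv {g : Ser 3} (h : g + X 1 * pderiv ℂ 1 g = 0) : g = 0 := by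
  rw [eq_mulCoeff_of_add_X_mul_pderiv h]
  ext k
  simp

/-- A resonant primitive: `W` with `(1 + y₁ ∂/∂y₁) W = J` for resonant `J`. -/
lemma exists_resonant_primitive {J : Ser 3} (hJ : del J = 0) :
    ∃ W : Ser 3, del W = 0 ∧ W + X 1 * pderiv ℂ 1 W = J ∧ constantCoeff W = constantCoeff J ∧
      (X 0 ∣ J - 1 → X 0 ∣ W - 1) ∧ (IsConvergent J → IsConvergent W) := by
  have hW : mulCoeff (fun k => ((k 1 : ℂ) + 1)⁻¹) J +
      X 1 * pderiv ℂ 1 (mulCoeff (fun k => ((k 1 : ℂ) + 1)⁻¹) J) = J := by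
    ext k
    have hn : ((k 1 : ℂ) + 1) ≠ 0 := Nat.cast_add_one_ne_zero _
    rw [map_add, coeff_X_mul_pderiv, coeff_mulCoeff]
    field_simp
    ring
  refine ⟨mulCoeff (fun k => ((k 1 : ℂ) + 1)⁻¹) J, ?_, hW, ?_, fun h => ?_, fun h => ?_⟩
  · rw [del_eq_zero_iff] at hJ ⊢
    intro k hk; rw [coeff_mulCoeff, hJ k hk, mul_zero]
  · rw [← coeff_zero_eq_constantCoeff_apply, coeff_mulCoeff]; simp
  · have e : mulCoeff (fun k => ((k 1 : ℂ) + 1)⁻¹) J - 1 =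
        mulCoeff (fun k => ((k 1 : ℂ) + 1)⁻¹) (J - 1) := by
      apply eq_mulCoeff_of_add_X_mul_pderiv
      rw [map_sub, pderiv_one, sub_zero]
      linear_combination hW
    rw [e]
    exact X_dvd_mulCoeff _ h
  · refine h.mulCoeff 1 fun k => ?_
    rw [nnnorm_inv]
    have : ((k 1 : ℂ) + 1) = ((k 1 + 1 : ℕ) : ℂ) := by push_cast; ring
    rw [this, Complex.nnnorm_natCast]
    exact inv_le_one_of_one_le₀ (by exact_mod_cast Nat.le_add_left 1 _)

/-- Off the resonances the divisors `k 1 - k 2` are nonzero integers, of modulus at least 1, so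
dividing by them cannot destroy convergence. -/
lemma exists_del_eq {f : Ser 3} (hf : ∀ k : Fin 3 →₀ ℕ, k 1 = k 2 → coeff k f = 0) :
    ∃ g : Ser 3, del g = f ∧ constantCoeff g = 0 ∧ (X 0 ∣ f → X 0 ∣ g) ∧
      (IsConvergent f → IsConvergent g) := by
  refine ⟨mulCoeff (fun k => ((k 1 : ℂ) - k 2)⁻¹) f, ?_, ?_, fun h => X_dvd_mulCoeff _ h,
    fun h => ?_⟩
  · ext k
    rw [coeff_del, coeff_mulCoeff]
    by_cases hk : k 1 = k 2
    · rw [hf k hk]; ring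
    · have : (k 1 : ℂ) - k 2 ≠ 0 := by rw [sub_ne_zero]; exact_mod_cast hk
      field_simp
  · rw [← coeff_zero_eq_constantCoeff_apply, coeff_mulCoeff, hf 0 rfl, mul_zero]
  · refine h.mulCoeff 1 fun k => ?_
    rw [nnnorm_inv]
    by_cases hk : k 1 = k 2
    · simp [hk]
    · apply inv_le_one_of_one_le₀
      have h1 : ((k 1 : ℂ) - k 2) = (((k 1 : ℤ) - k 2 : ℤ) : ℂ) := by push_cast; ring
      rw [h1, ← NNReal.coe_le_coe, coe_nnnorm, Complex.norm_intCast, NNReal.coe_one]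
      have : (1 : ℤ) ≤ |(k 1 : ℤ) - k 2| := Int.one_le_abs (by omega)
      exact_mod_cast this

end Morse

end SaddleNode
end

noncomputable section

namespace SaddleNode

/-! ### Isochore Morse lemma. -/

section Vey

lemma compMap_cons {f g : Ser 3} {Φ : Fin 3 → Ser 3} (hΦ : ZeroConst Φ) (h0 : Φ 0 = X 0) :
    compMap ![X 0, f, g] Φ = ![X 0, subst Φ f, subst Φ g] := by
  funext i
  fin_cases i
  · simp [compMap, subst_X hΦ.hasSubst, h0]
  · rfl
  · rfl

/-- Jacobian determinant of `(x, y₁ e^a, y₂ W e^{-a})` for resonant `W`. -/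
lemma brk_hyperbolic {W a : Ser 3} (hW : del W = 0) (ha : constantCoeff a = 0) :
    brk (X 1 * expS a) (X 2 * (W * expS (-a))) = (W + X 1 * pderiv ℂ 1 W) * (1 + del a) := by
  have ha' : constantCoeff (-a) = 0 := by simp [ha]
  have he := expS_mul_expS_neg ha
  rw [del, sub_eq_zero] at hW
  simp only [brk, pderiv_mul, pderiv_X12, pderiv_X21, pderiv_X_self, pderiv_expS ha,
    pderiv_expS ha', map_neg, del]
  linear_combination (-(1 + X 1 * pderiv ℂ 1 a) * hW) * (expS a * expS (-a)) +
    (W + X 1 * pderiv ℂ 1 W) * (1 + X 1 * pderiv ℂ 1 a - X 2 * pderiv ℂ 2 a) * he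

lemma expS_hyperbolic_sub_mem {W a : Ser 3} (hW : constantCoeff W = 1)
    (ha : constantCoeff a = 0) : X 1 * expS a - X 1 ∈ ordIdeal (Fin 3) 2 ∧
      X 2 * (W * expS (-a)) - X 2 ∈ ordIdeal (Fin 3) 2 := by
  have ha' : constantCoeff (-a) = 0 := by simp [ha]
  constructor
  · have : X 1 * expS a - X 1 = X 1 * (expS a - 1) := by ring
    rw [this]
    exact mul_mem_ordIdeal (X_mem_ordIdeal 1) (mem_ordIdeal_one.2 (by simp [constantCoeff_expS ha]))
  · have : X 2 * (W * expS (-a)) - X 2 = X 2 * (W * expS (-a) - 1) := by ring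
    rw [this]
    exact mul_mem_ordIdeal (X_mem_ordIdeal 2)
      (mem_ordIdeal_one.2 (by simp [constantCoeff_expS ha', hW]))

/-- Composing two maps tangent to the identity. -/
lemma subst_sub_X_mem {Φ : Fin 3 → Ser 3} (hΦ : ZeroConst Φ) {i : Fin 3} {f : Ser 3}
    (hf : f - X i ∈ ordIdeal (Fin 3) 2) (hi : Φ i - X i ∈ ordIdeal (Fin 3) 2) :
    subst Φ f - X i ∈ ordIdeal (Fin 3) 2 := by
  have h := subst_mem_ordIdeal hΦ hf
  rw [subst_sub hΦ.hasSubst, subst_X hΦ.hasSubst] at h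
  have := add_mem h hi
  rwa [sub_add_sub_cancel] at this

/-- The isochore Morse lemma with parameter: a Hamiltonian with hyperbolic quadratic part is
symplectically conjugate to a function of `y₁ y₂`. -/
theorem exists_isochore_morse {l : ℂ} (hl : l ≠ 0) {H : Ser 3}
    (h1 : ∀ k : Fin 3 →₀ ℕ, k 1 + k 2 ≤ 1 → coeff k H = 0)
    (h11 : coeff (Finsupp.single 1 2) H = 0) (h22 : coeff (Finsupp.single 2 2) H = 0)
    (h12 : coeff (Finsupp.single 1 1 + Finsupp.single 2 1) H = l) :
    ∃ (Φ : Fin 3 → Ser 3) (m : Ser 3), IsTransSymplectic Φ ∧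
      Φ 1 - X 1 ∈ ordIdeal (Fin 3) 2 ∧ Φ 2 - X 2 ∈ ordIdeal (Fin 3) 2 ∧
      brk H (Φ 1) = -(subst Φ m * Φ 1) ∧ brk H (Φ 2) = subst Φ m * Φ 2 ∧
      (IsConvergent H → (∀ i, IsConvergent (Φ i)) ∧ IsConvergent m) := by
  obtain ⟨u₁, u₂, hH, hu1, hu2, huc⟩ := exists_morse hl h1 h11 h22 h12
  set u : Fin 3 → Ser 3 := ![X 0, u₁, u₂] with hu
  have hufib := isFibered_cons hu1 hu2
  obtain ⟨v, hv, huv, hvu, hvc⟩ := exists_inverse hufib.1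
  have hu0 : ZeroConst u := hufib.1.1
  have hv0 : ZeroConst v := hv.1
  set j := brk u₁ u₂ with hj
  have hj0 : constantCoeff j = 1 := constantCoeff_brk_of_sub_X_mem hu1 hu2
  have hji : j * j⁻¹ = 1 := MvPowerSeries.mul_inv_cancel _ (by rw [hj0]; exact one_ne_zero)
  have hji0 : constantCoeff j⁻¹ = 1 := by rw [constantCoeff_inv, hj0, inv_one]
  -- The Jacobian a second map `S` must have for `S ∘ u` to be symplectic.
  set J := subst v j⁻¹ with hJ
  have hJu : subst u J = j⁻¹ := by rw [hJ, subst_subst hv0 hu0, hvu, subst_X_eq]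
  have hJ0 : constantCoeff J = 1 := by rw [hJ, constantCoeff_subst_of_zeroConst hv0, hji0]
  set R := mulCoeff (fun k : Fin 3 →₀ ℕ => if k 1 = k 2 then 1 else 0) J with hR
  have hRres : del R = 0 := del_eq_zero_iff.2 fun k hk => by
    rw [hR, coeff_mulCoeff, if_neg hk, zero_mul]
  have hR0 : constantCoeff R = 1 := by
    rw [← coeff_zero_eq_constantCoeff_apply, hR, coeff_mulCoeff, coeff_zero_eq_constantCoeff_apply,
      hJ0]; simp
  have hRi : R * R⁻¹ = 1 := MvPowerSeries.mul_inv_cancel _ (by rw [hR0]; exact one_ne_zero)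
  have hRires : del R⁻¹ = 0 := by
    refine del_eq_zero_of_mul hRres (fun h => by rw [h] at hR0; simp at hR0) ?_
    rw [hRi]; simpa using del_C 1
  obtain ⟨W, hWres, hWR, hW0, -, hWc⟩ := exists_resonant_primitive hRres
  rw [hR0] at hW0
  obtain ⟨a', ha', ha'0, -, ha'c⟩ := exists_del_eq (f := J - R) fun k hk => by
    rw [map_sub, hR, coeff_mulCoeff, if_pos hk, one_mul, sub_self]
  -- The Jacobian of `S` is `(W + y₁∂₁W)(1 + del a)`. The first factor is made equal to the resonant
  -- part `R` of `J`, the second to `J / R`; this is solvable because `J - R` has no resonant term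
  -- and `del` passes through `R⁻¹`.
  set a := a' * R⁻¹ with ha
  have ha0 : constantCoeff a = 0 := by simp [ha, ha'0]
  have hda : del a = J * R⁻¹ - 1 := by
    rw [ha, del_mul, hRires, ha']; linear_combination -hRi
  obtain ⟨hS1, hS2⟩ := expS_hyperbolic_sub_mem hW0 ha0
  have hbr : brk (X 1 * expS a) (X 2 * (W * expS (-a))) = J := by
    rw [brk_hyperbolic hWres ha0, hWR, hda]; linear_combination J * hRi
  set S : Fin 3 → Ser 3 := ![X 0, X 1 * expS a, X 2 * (W * expS (-a))] with hS
  have hSfib := isFibered_cons hS1 hS2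
  have hS0 : ZeroConst S := hSfib.1.1
  obtain ⟨T, hT, hST, hTS, hTc⟩ := exists_inverse hSfib.1
  have hcomp : compMap S u = ![X 0, subst u (X 1 * expS a), subst u (X 2 * (W * expS (-a)))] :=
    compMap_cons hu0 rfl
  have hm : subst (compMap S u) (subst T (C l * R⁻¹)) = C l * subst u R⁻¹ := by
    rw [← subst_subst hS0 hu0, subst_subst hT.1 hS0, hTS, subst_X_eq, subst_mul hu0.hasSubst,
      subst_C]
  have hHu : H = subst u (C l * (X 1 * X 2)) := by
    rw [subst_mul hu0.hasSubst, subst_mul hu0.hasSubst, subst_C, subst_X hu0.hasSubst,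
      subst_X hu0.hasSubst, hH]; rfl
  have hbH : ∀ f : Ser 3, brk H (subst u f) = subst u (brk (C l * (X 1 * X 2)) f) * j := fun f => by
    rw [hHu, brk_subst hu0 rfl]; rfl
  refine ⟨compMap S u, subst T (C l * R⁻¹), ?_, ?_, ?_, ?_, ?_, fun hHc => ?_⟩
  · rw [isTransSymplectic_iff]
    refine ⟨zeroConst_compMap hS0 hu0, by rw [hcomp]; rfl, ?_⟩
    change brk (subst u (X 1 * expS a)) (subst u (X 2 * (W * expS (-a)))) = 1
    rw [brk_subst hu0 rfl, hbr, hJu]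
    change j⁻¹ * j = 1
    rw [mul_comm, hji]
  · exact subst_sub_X_mem hu0 hS1 hu1
  · exact subst_sub_X_mem hu0 hS2 hu2
  · rw [hm]
    change brk H (subst u (X 1 * expS a)) = -(C l * subst u R⁻¹ * subst u (X 1 * expS a))
    have e : brk (C l * (X 1 * X 2)) (X 1 * expS a) = -(C l * (R⁻¹ * (X 1 * expS a) * J)) := by
      have : brk (C l * (X 1 * X 2)) (X 1 * expS a) = -(C l * (X 1 * expS a) * (1 + del a)) := by
        simp only [brk, pderiv_mul, pderiv_X12, pderiv_X21, pderiv_X_self, pderiv_expS ha0,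
          pderiv_C, del]
        ring
      rw [this, hda]; ring
    rw [hbH, e, subst_neg hu0, subst_mul hu0.hasSubst, subst_mul hu0.hasSubst,
      subst_mul hu0.hasSubst, subst_C, hJu]
    linear_combination -(C l * subst u R⁻¹ * subst u (X 1 * expS a)) * hji
  · rw [hm]
    change brk H (subst u (X 2 * (W * expS (-a)))) =
      C l * subst u R⁻¹ * subst u (X 2 * (W * expS (-a)))
    have ha0' : constantCoeff (-a) = 0 := by simp [ha0]
    have e : brk (C l * (X 1 * X 2)) (X 2 * (W * expS (-a))) =
        C l * (R⁻¹ * (X 2 * (W * expS (-a))) * J) := by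
      have : brk (C l * (X 1 * X 2)) (X 2 * (W * expS (-a))) =
          C l * (X 2 * (W * expS (-a))) * (1 + del a) - C l * X 2 * expS (-a) * del W := by
        simp only [brk, pderiv_mul, pderiv_X12, pderiv_X21, pderiv_X_self, pderiv_expS ha0',
          pderiv_C, del, map_neg]
        ring
      rw [this, hda, hWres]; ring
    rw [hbH, e, subst_mul hu0.hasSubst, subst_mul hu0.hasSubst,
      subst_mul hu0.hasSubst, subst_C, hJu]
    linear_combination (C l * subst u R⁻¹ * subst u (X 2 * (W * expS (-a)))) * hji
  · obtain ⟨cu1, cu2⟩ := huc hHc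
    have cu := isConvergent_cons cu1 cu2
    have cj : IsConvergent j := ((cu1.pderiv 1).mul (cu2.pderiv 2)).sub
      ((cu1.pderiv 2).mul (cu2.pderiv 1))
    have cJ : IsConvergent J := cj.inv.subst hv0 (hvc cu)
    have cR : IsConvergent R := cJ.mulCoeff 1 fun k => by split_ifs <;> simp
    have ca : IsConvergent a := (ha'c (cJ.sub cR)).mul cR.inv
    have cS := isConvergent_cons ((isConvergent_X 1).mul (ca.expS ha0))
      ((isConvergent_X 2).mul ((hWc cR).mul (ca.neg.expS (by simp [ha0]))))
    exact ⟨fun i => (cS i).subst hu0 cu, ((isConvergent_C l).mul cR.inv).subst hT.1 (hTc cS)⟩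

end Vey

end SaddleNode
end

noncomputable section

namespace SaddleNode

/-! ### Convergent normalization on `x = 0`. -/

section Prenormalization

/-- Prepared fields `x² ∂/∂x + …` whose transverse divergence is `x`. -/
def IsHamPrepared (l : ℂ) (Y : Fin 3 → Ser 3) : Prop :=
  Y 0 = X 0 ^ 2 ∧ ydiv Y = X 0 ∧ Y 1 + C l * X 1 ∈ ordIdeal (Fin 3) 2 ∧
    Y 2 - C l * X 2 ∈ ordIdeal (Fin 3) 2

lemma eq_subst_of_subst_eq {n : ℕ} {Φ Ψ : Fin n → Ser n} (hΦ : ZeroConst Φ) (hΨ : ZeroConst Ψ)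
    (h : compMap Φ Ψ = X) {f g : Ser n} (hfg : subst Φ f = g) : f = subst Ψ g := by
  rw [← hfg, subst_subst hΦ hΨ, h, subst_X_eq]

lemma X0_dvd_subst {Φ : Fin 3 → Ser 3} (hΦ : ZeroConst Φ) (h0 : Φ 0 = X 0) {f : Ser 3}
    (h : X 0 ∣ f) : X 0 ∣ subst Φ f := by
  obtain ⟨g, rfl⟩ := h
  rw [subst_mul hΦ.hasSubst, subst_X hΦ.hasSubst, h0]
  exact dvd_mul_right _ _

lemma subst_X0_sq {Φ : Fin 3 → Ser 3} (hΦ : ZeroConst Φ) (h0 : Φ 0 = X 0) :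
    subst Φ (X 0 ^ 2 : Ser 3) = X 0 ^ 2 := by
  rw [subst_pow hΦ.hasSubst, subst_X hΦ.hasSubst, h0]

lemma pderiv_X0_sq {Y : Fin 3 → Ser 3} (h : Y 0 = X 0 ^ 2) :
    pderiv ℂ 1 (Y 0) = 0 ∧ pderiv ℂ 2 (Y 0) = 0 := by
  rw [h]; simp

lemma PushesTo.zero_eq {Φ Ψ Y Z : Fin 3 → Ser 3} (hΦ : ZeroConst Φ) (h0 : Φ 0 = X 0)
    (hΨ : ZeroConst Ψ) (h : compMap Φ Ψ = X) (hp : PushesTo Φ Y Z) (hY : Y 0 = X 0 ^ 2) :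
    Z 0 = X 0 ^ 2 := by
  have h1 := hp 0
  rw [h0, lie_X, hY] at h1
  rw [eq_subst_of_subst_eq hΦ hΨ h h1.symm, subst_X0_sq hΨ (inverse_fibered hΨ h0 h)]

/-- A symplectic conjugacy has Jacobian 1, so the divergence is simply transported as a function. -/
lemma PushesTo.ydiv_eq {Φ Ψ Y Z : Fin 3 → Ser 3} (hΦ : IsTransSymplectic Φ)
    (hΨ : ZeroConst Ψ) (h : compMap Φ Ψ = X) (hp : PushesTo Φ Y Z)
    (h1 : pderiv ℂ 1 (Y 0) = 0) (h2 : pderiv ℂ 2 (Y 0) = 0) :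
    ydiv Z = subst Ψ (ydiv Y) := by
  rw [isTransSymplectic_iff] at hΦ
  have e := subst_ydiv_mul hΦ.1 hΦ.2.1 h1 h2 hp
  rw [hΦ.2.2, mul_one, mul_one, lie_three, pderiv_one, pderiv_one, pderiv_one] at e
  exact eq_subst_of_subst_eq hΦ.1 hΨ h (by rw [e]; ring)

lemma IsConvergent.lie {n : ℕ} {Y : Fin n → Ser n} (hY : ∀ i, IsConvergent (Y i)) {f : Ser n}
    (hf : IsConvergent f) : IsConvergent (lie Y f) :=
  isConvergent_sum _ fun i _ => (hY i).mul (hf.pderiv i)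

lemma lie_mem_ordIdeal {n d : ℕ} {Y : Fin n → Ser n} (hY : ZeroConst Y) {f : Ser n}
    (hf : f ∈ ordIdeal (Fin n) (d + 1)) : lie Y f ∈ ordIdeal (Fin n) (d + 1) :=
  sum_mem fun i _ => by
    rw [add_comm d 1]
    exact mul_mem_ordIdeal (mem_ordIdeal_one.2 (hY i)) (pderiv_mem_ordIdeal i hf)

lemma mem_ordIdeal_of_subst {n d : ℕ} {Φ Ψ : Fin n → Ser n} (hΦ : ZeroConst Φ)
    (hΨ : ZeroConst Ψ) (h : compMap Φ Ψ = X) {f : Ser n}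
    (hf : subst Φ f ∈ ordIdeal (Fin n) d) : f ∈ ordIdeal (Fin n) d := by
  rw [eq_subst_of_subst_eq hΦ hΨ h (f := f) rfl]; exact subst_mem_ordIdeal hΨ hf

lemma constantCoeff_of_add_mem {f : Ser 3} {c : ℂ} {i : Fin 3}
    (h : f + C c * X i ∈ ordIdeal (Fin 3) 2) : constantCoeff f = 0 := by
  have := mem_ordIdeal_one.1 (ordIdeal_mono one_le_two h)
  simpa using this

lemma IsHamPrepared.zeroConst {l : ℂ} {Y : Fin 3 → Ser 3} (h : IsHamPrepared l Y) :
    ZeroConst Y := by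
  obtain ⟨h0, -, h1, h2⟩ := h
  intro i
  fin_cases i
  · simp [h0]
  · exact constantCoeff_of_add_mem h1
  · rw [sub_eq_add_neg, ← neg_mul, ← map_neg] at h2
    exact constantCoeff_of_add_mem h2

/-- The preparing map fixes `x`, so the first component is already `x²` before preparation. -/
lemma IsTransHamSaddleNode.basic {l : ℂ} {Y : Fin 3 → Ser 3} (h : IsTransHamSaddleNode l Y) :
    l ≠ 0 ∧ ZeroConst Y ∧ Y 0 = X 0 ^ 2 ∧ ydiv Y = X 0 := by
  obtain ⟨hY, Φ, Z, hΦ, hp, hl, F₁, -, F₂, -, rfl⟩ := h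
  have h0 := hp 0
  rw [hΦ.1.2, lie_X] at h0
  have hY0 : Y 0 = X 0 ^ 2 := by
    rw [h0]; exact subst_X0_sq hΦ.diffeo.1 hΦ.1.2
  exact ⟨hl, hY.1, hY0, hY.ydiv_eq hY0⟩

/-- A linear transversally symplectic map suffices to prepare the field. -/
lemma exists_linear_preparation {l : ℂ} {Y : Fin 3 → Ser 3} (h : IsTransHamSaddleNode l Y) :
    ∃ L Y' : Fin 3 → Ser 3, IsTransSymplectic L ∧ PushesTo L Y Y' ∧ IsHamPrepared l Y' ∧
      (∀ i, IsConvergent (L i)) ∧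
      ((∀ i, IsConvergent (restrMap Y i)) → ∀ i, IsConvergent (restrMap Y' i)) ∧
      ((∀ i, IsConvergent (Y i)) → ∀ i, IsConvergent (Y' i)) := by
  obtain ⟨hl, hYz, hY0, hYd⟩ := h.basic
  obtain ⟨-, Φ, Z, hΦ, hp, -, F₁, hF₁, F₂, hF₂, rfl⟩ := h
  have hΦ' := isTransSymplectic_iff.1 hΦ
  have hΦz := hΦ'.1
  -- The given `Φ` may diverge, but the prepared shape depends only on 1-jets, and the linear part
  -- of a symplectic `Φ` is itself symplectic.
  set A := linPart Φ with hA
  have hdiff : ∀ i, linMap A i - Φ i ∈ ordIdeal (Fin 3) 2 := fun i => by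
    rw [← neg_sub]; exact neg_mem (sub_linMap_linPart_mem hΦz i)
  have hL0 : linMap A 0 = X 0 := by
    rw [linMap, Fin.sum_univ_three]
    simp [hA, linPart, jac, hΦ'.2.1]
  have hL : IsTransSymplectic (linMap A) := by
    refine isTransSymplectic_iff.2 ⟨zeroConst_linMap A, hL0, ?_⟩
    have := congrArg constantCoeff hΦ'.2.2
    simp only [brk, map_sub, map_mul, map_one] at this
    rw [brk, pderiv_linMap, pderiv_linMap, pderiv_linMap, pderiv_linMap, ← map_mul, ← map_mul,
      ← map_sub]
    simp only [hA, linPart, jac, Matrix.map_apply, Matrix.of_apply]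
    rw [this, map_one]
  have hLz := zeroConst_linMap A
  obtain ⟨M, hM, hLM, hML, hMc⟩ := exists_inverse hL.diffeo
  have hMz : ZeroConst M := hM.1
  have hMc := hMc (isConvergent_linMap A)
  have hM0 : M 0 = X 0 := inverse_fibered hMz hL0 hLM
  have hpush := exists_pushesTo hMz hLz hML Y
  obtain ⟨d1, d2⟩ := pderiv_X0_sq hY0
  refine ⟨linMap A, _, hL, hpush, ⟨hpush.zero_eq hLz hL0 hMz hLM hY0, ?_, ?_, ?_⟩,
    isConvergent_linMap A, fun hc i => ?_, fun hc i => ?_⟩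
  · rw [hpush.ydiv_eq hL hMz hLM d1 d2, hYd, subst_X hMz.hasSubst, hM0]
  · refine mem_ordIdeal_of_subst hLz hMz hLM ?_
    rw [subst_add hLz.hasSubst, ← hpush 1, subst_mul hLz.hasSubst, subst_C, subst_X hLz.hasSubst]
    have e := hp 1
    simp only [Matrix.cons_val_one, Matrix.cons_val_zero] at e
    rw [subst_add hΦz.hasSubst, subst_neg hΦz, subst_mul hΦz.hasSubst, subst_C,
      subst_X hΦz.hasSubst] at e
    have e2 : lie Y (linMap A 1) = lie Y (linMap A 1 - Φ 1) + lie Y (Φ 1) := by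
      rw [← lie_add, sub_add_cancel]
    rw [e2, e]
    have := add_mem (add_mem (lie_mem_ordIdeal (d := 1) hYz (hdiff 1))
      (Ideal.mul_mem_left _ (C l) (hdiff 1))) (subst_mem_ordIdeal hΦz (maxIdeal_sq_le hF₁))
    convert this using 1
    ring
  · refine mem_ordIdeal_of_subst hLz hMz hLM ?_
    rw [subst_sub hLz.hasSubst, ← hpush 2, subst_mul hLz.hasSubst, subst_C, subst_X hLz.hasSubst]
    have e := hp 2
    simp only [Matrix.cons_val] at e
    rw [subst_add hΦz.hasSubst, subst_mul hΦz.hasSubst, subst_C, subst_X hΦz.hasSubst] at e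
    have e2 : lie Y (linMap A 2) = lie Y (linMap A 2 - Φ 2) + lie Y (Φ 2) := by
      rw [← lie_add, sub_add_cancel]
    rw [e2, e]
    have := add_mem (sub_mem (lie_mem_ordIdeal (d := 1) hYz (hdiff 2))
      (Ideal.mul_mem_left _ (C l) (hdiff 2))) (subst_mem_ordIdeal hΦz (maxIdeal_sq_le hF₂))
    convert this using 1
    ring
  · obtain ⟨g₁, hg₁, h1⟩ := exists_convergent_of_restr (f := Y 1) (hc 0)
    obtain ⟨g₂, hg₂, h2⟩ := exists_convergent_of_restr (f := Y 2) (hc 1)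
    -- Only the restriction of `Y` is known to converge here; modulo `x` its components may be
    -- exchanged for convergent ones, and `M` preserves `x`.
    have key : ∀ i, IsConvergent (restr (subst M (lie Y (linMap A i)))) := fun i => by
      have hd : X 0 ∣ lie Y (linMap A i) -
          (g₁ * pderiv ℂ 1 (linMap A i) + g₂ * pderiv ℂ 2 (linMap A i)) := by
        rw [lie_three, hY0]
        have : X 0 ^ 2 * pderiv ℂ 0 (linMap A i) + Y 1 * pderiv ℂ 1 (linMap A i) +
            Y 2 * pderiv ℂ 2 (linMap A i) -
            (g₁ * pderiv ℂ 1 (linMap A i) + g₂ * pderiv ℂ 2 (linMap A i)) =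
            X 0 * (X 0 * pderiv ℂ 0 (linMap A i)) + (Y 1 - g₁) * pderiv ℂ 1 (linMap A i) +
            (Y 2 - g₂) * pderiv ℂ 2 (linMap A i) := by ring
        rw [this]
        exact dvd_add (dvd_add (dvd_mul_right _ _) (h1.mul_right _)) (h2.mul_right _)
      have hd' := X0_dvd_subst hMz hM0 hd
      rw [subst_sub hMz.hasSubst] at hd'
      rw [restr_eq_of_dvd hd']
      refine isConvergent_restr (IsConvergent.subst ?_ hMz hMc)
      exact (hg₁.mul ((isConvergent_linMap A i).pderiv 1)).add
        (hg₂.mul ((isConvergent_linMap A i).pderiv 2))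
    fin_cases i
    · exact key 1
    · exact key 2
  · exact IsConvergent.subst (IsConvergent.lie hc (isConvergent_linMap A i)) hMz hMc

/-- The Hamiltonian of the restriction of the field to `x = 0`. -/
lemma exists_hamiltonian {l : ℂ} {Y : Fin 3 → Ser 3} (h : IsHamPrepared l Y) :
    ∃ H : Ser 3, X 0 ∣ Y 1 + pderiv ℂ 2 H ∧ X 0 ∣ Y 2 - pderiv ℂ 1 H ∧
      (∀ k : Fin 3 →₀ ℕ, k 1 + k 2 ≤ 1 → coeff k H = 0) ∧
      coeff (Finsupp.single 1 2) H = 0 ∧ coeff (Finsupp.single 2 2) H = 0 ∧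
      coeff (Finsupp.single 1 1 + Finsupp.single 2 1) H = l ∧
      ((∀ i, IsConvergent (restrMap Y i)) → IsConvergent H) := by
  have hz := h.zeroConst
  obtain ⟨h0, hd, h1, h2⟩ := h
  let ε : Ser 3 → Ser 3 := mulCoeff fun k => if k 0 = 0 then 1 else 0
  have hεd : ∀ f, X 0 ∣ f - ε f := fun f => by
    rw [X_dvd_iff]
    intro k hk
    simp [ε, hk]
  have hε0 : ∀ f, X 0 ∣ f → ε f = 0 := fun f hf => by
    ext k
    rw [X_dvd_iff] at hf
    by_cases hk : k 0 = 0
    · simp [ε, hf k hk]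
    · simp [ε, hk]
  have hεadd : ∀ f g, ε (f + g) = ε f + ε g := fun f g => by
    ext k; simp [ε]; split_ifs <;> simp
  have hεp : ∀ (i : Fin 3), i ≠ 0 → ∀ f, pderiv ℂ i (ε f) = ε (pderiv ℂ i f) := fun i hi f => by
    ext k
    simp only [ε, coeff_pderiv, coeff_mulCoeff, Finsupp.add_apply,
      Finsupp.single_eq_of_ne hi.symm, add_zero]
    ring
  have hεc : ∀ f, IsConvergent (restr f) → IsConvergent (ε f) := fun f hf => by
    obtain ⟨g, hg, hfg⟩ := exists_convergent_of_restr hf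
    have e : ε f = ε g := by
      have : ε f = ε (f - g) + ε g := by rw [← hεadd, sub_add_cancel]
      rw [this, hε0 _ hfg, zero_add]
    rw [e]
    exact hg.mulCoeff 1 fun k => by split_ifs <;> simp
  set P := ε (Y 1) with hP
  set Q := ε (Y 2) with hQ
  have hPQ : pderiv ℂ 1 P + pderiv ℂ 2 Q = 0 := by
    rw [hP, hQ, hεp 1 (by decide), hεp 2 (by decide), ← hεadd]
    rw [ydiv] at hd
    rw [hd, hε0 _ dvd_rfl]
  -- If `∂₁H = Q` and `∂₂H = -P`, Euler's formula gives `(y₁∂₁ + y₂∂₂) H = G`, so `H` is obtained by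
  -- dividing by the degree in `y`. In `y`-degree 0 the convention `0⁻¹ = 0` is harmless because `G`
  -- has no such term.
  set G : Ser 3 := X 1 * Q - X 2 * P with hG
  set H := mulCoeff (fun k => ((k 1 : ℂ) + k 2)⁻¹) G with hH
  have hEH : X 1 * pderiv ℂ 1 H + X 2 * pderiv ℂ 2 H = G := by
    ext k
    rw [map_add, coeff_X_mul_pderiv, coeff_X_mul_pderiv, ← add_mul, hH, coeff_mulCoeff]
    by_cases hk : k 1 + k 2 = 0
    · have h1k : k 1 = 0 := by omega
      have h2k : k 2 = 0 := by omega
      have e1 : coeff k (X 1 * Q) = 0 := X_dvd_iff.1 (dvd_mul_right _ _) k h1k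
      have e2 : coeff k (X 2 * P) = 0 := X_dvd_iff.1 (dvd_mul_right _ _) k h2k
      rw [hG, map_sub, e1, e2]; simp
    · have : (k 1 : ℂ) + k 2 ≠ 0 := by exact_mod_cast hk
      field_simp
  -- Differentiating Euler's formula shows that the errors `∂₁H - Q` and `∂₂H + P` lie in the kernel
  -- of `1 + y₁∂₁ + y₂∂₂`, which is trivial. Vanishing divergence of `(P, Q)` enters here.
  have hinj : ∀ f : Ser 3, f + (X 1 * pderiv ℂ 1 f + X 2 * pderiv ℂ 2 f) = 0 → f = 0 := by
    intro f hf
    ext k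
    have := congrArg (coeff k) hf
    rw [map_add, map_add, coeff_X_mul_pderiv, coeff_X_mul_pderiv, map_zero] at this
    have hk : (1 + k 1 + k 2 : ℂ) ≠ 0 := by
      have : (1 + k 1 + k 2 : ℂ) = ((1 + k 1 + k 2 : ℕ) : ℂ) := by push_cast; ring
      rw [this]; exact_mod_cast (by omega)
    have e : (1 + k 1 + k 2 : ℂ) * coeff k f = 0 := by linear_combination this
    exact (mul_eq_zero.1 e).resolve_left hk
  have hH1 : pderiv ℂ 1 H = Q := by
    rw [← sub_eq_zero]
    apply hinj
    have e := congrArg (pderiv ℂ 1) hEH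
    simp only [hG, map_add, map_sub, pderiv_mul, pderiv_X_self, pderiv_X21, mul_zero] at e ⊢
    rw [pderiv_comm 2 1]
    linear_combination e - X 2 * hPQ
  have hH2 : pderiv ℂ 2 H = -P := by
    rw [← add_eq_zero_iff_eq_neg]
    apply hinj
    have e := congrArg (pderiv ℂ 2) hEH
    simp only [hG, map_add, map_sub, pderiv_mul, pderiv_X_self, pderiv_X12, mul_zero] at e ⊢
    rw [pderiv_comm 1 2]
    linear_combination e + X 1 * hPQ
  have c1 : ∀ k : Fin 3 →₀ ℕ, coeff (k + Finsupp.single 1 1) H * (k 1 + 1) = coeff k Q :=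
    fun k => by rw [← coeff_pderiv, hH1]
  have c2 : ∀ k : Fin 3 →₀ ℕ, coeff (k + Finsupp.single 2 1) H * (k 2 + 1) = -coeff k P :=
    fun k => by rw [← coeff_pderiv, hH2, map_neg]
  have cε : ∀ (k : Fin 3 →₀ ℕ) f, k 0 = 0 → coeff k (ε f) = coeff k f := fun k f hk => by
    simp [ε, hk]
  have l1 : ∀ k : Fin 3 →₀ ℕ, k.degree < 2 → coeff k (Y 1) = -(l * coeff k (X 1)) :=
    fun k hk => by
      have := h1 k hk
      rw [map_add, coeff_C_mul] at this
      linear_combination this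
  have l2 : ∀ k : Fin 3 →₀ ℕ, k.degree < 2 → coeff k (Y 2) = l * coeff k (X 2) :=
    fun k hk => by
      have := h2 k hk
      rw [map_sub, coeff_C_mul] at this
      linear_combination this
  have small : ∀ (k : Fin 3 →₀ ℕ) (i : Fin 3), k 1 = 0 → k 2 = 0 → coeff k (ε (Y i)) = 0 := by
    intro k i hk1 hk2
    by_cases hk0 : k 0 = 0
    · have : k = 0 := by ext i; fin_cases i <;> assumption
      rw [this, cε _ _ rfl, coeff_zero_eq_constantCoeff_apply, hz]
    · simp [ε, hk0]
  refine ⟨H, ?_, ?_, fun k hk => ?_, ?_, ?_, ?_, fun hc => ?_⟩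
  · rw [hH2, ← sub_eq_add_neg]; exact hεd _
  · rw [hH1]; exact hεd _
  · by_cases hk0 : k 1 + k 2 = 0
    · rw [hH, coeff_mulCoeff]
      have : (k 1 : ℂ) + k 2 = 0 := by exact_mod_cast hk0
      rw [this]; simp
    · by_cases hk1 : k 1 = 0
      · have e : k = (k - Finsupp.single 2 1) + Finsupp.single 2 1 :=
          (tsub_add_cancel_of_le (Finsupp.single_le_iff.2 (by omega))).symm
        have := c2 (k - Finsupp.single 2 1)
        rw [← e, small _ 1 (by simp [hk1]) (by simp; omega)] at this
        simpa [show k 2 = 1 by omega] using this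
      · have e : k = (k - Finsupp.single 1 1) + Finsupp.single 1 1 :=
          (tsub_add_cancel_of_le (Finsupp.single_le_iff.2 (by omega))).symm
        have := c1 (k - Finsupp.single 1 1)
        rw [← e, small _ 2 (by simp; omega) (by simp; omega)] at this
        simpa [show k 1 = 1 by omega] using this
  · have := c1 (Finsupp.single 1 1)
    rw [← Finsupp.single_add, cε _ _ (by simp), l2 _ (by simp), coeff_X,
      if_neg (by rw [Finsupp.single_left_inj one_ne_zero]; decide)] at this
    have h2 : ((Finsupp.single (1 : Fin 3) 1 1 : ℕ) : ℂ) + 1 ≠ 0 := Nat.cast_add_one_ne_zero _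
    rw [mul_zero] at this
    exact (mul_eq_zero.1 this).resolve_right h2
  · have := c2 (Finsupp.single 2 1)
    rw [← Finsupp.single_add, cε _ _ (by simp), l1 _ (by simp), coeff_X,
      if_neg (by rw [Finsupp.single_left_inj one_ne_zero]; decide)] at this
    have h2 : ((Finsupp.single (2 : Fin 3) 1 2 : ℕ) : ℂ) + 1 ≠ 0 := Nat.cast_add_one_ne_zero _
    rw [mul_zero, neg_zero, neg_zero] at this
    exact (mul_eq_zero.1 this).resolve_right h2
  · have := c1 (Finsupp.single 2 1)
    rw [cε _ _ (by simp), l2 _ (by simp), coeff_X, if_pos rfl, add_comm (Finsupp.single 2 1)] at this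
    simpa using this
  · have cP : IsConvergent P := hεc _ (hc 0)
    have cQ : IsConvergent Q := hεc _ (hc 1)
    refine (((isConvergent_X 1).mul cQ).sub ((isConvergent_X 2).mul cP)).mulCoeff 1 fun k => ?_
    have : (k 1 : ℂ) + k 2 = ((k 1 + k 2 : ℕ) : ℂ) := by push_cast; ring
    rw [this, nnnorm_inv, Complex.nnnorm_natCast]
    by_cases hk : k 1 + k 2 = 0
    · simp [hk]
    · exact inv_le_one_of_one_le₀ (by exact_mod_cast Nat.one_le_iff_ne_zero.2 hk)

/-- Convergent normalization of the restriction of the field to `x = 0`. -/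
theorem exists_prenormalization {l : ℂ} {Y : Fin 3 → Ser 3} (h : IsTransHamSaddleNode l Y) :
    ∃ (Φ Y' : Fin 3 → Ser 3) (m : Ser 3), IsTransSymplectic Φ ∧ PushesTo Φ Y Y' ∧
      IsHamPrepared l Y' ∧ del m = 0 ∧ X 0 ∣ Y' 1 + m * X 1 ∧ X 0 ∣ Y' 2 - m * X 2 ∧
      ((∀ i, IsConvergent (restrMap Y i)) → (∀ i, IsConvergent (Φ i)) ∧ IsConvergent m) ∧
      ((∀ i, IsConvergent (restrMap Y i)) → (∀ i, IsConvergent (Y i)) →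
        ∀ i, IsConvergent (Y' i)) := by
  obtain ⟨hl, -⟩ := h.basic
  obtain ⟨L, V, hL, hLp, hV, hLc, hVr, hVc⟩ := exists_linear_preparation h
  obtain ⟨H, hH2, hH1, k1, k2, k3, k4, hHc⟩ := exists_hamiltonian hV
  obtain ⟨Φ, m, hΦ, hΦ1, hΦ2, e1, e2, hc⟩ := exists_isochore_morse hl k1 k2 k3 k4
  obtain ⟨Ψ, hΨ, hΦΨ, hΨΦ, hΨc⟩ := exists_inverse hΦ.diffeo
  have hΦz := hΦ.diffeo.zeroConst
  have hΦ0 := hΦ.1.2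
  have hΨz := hΨ.zeroConst
  have hΨ0 : Ψ 0 = X 0 := inverse_fibered hΨz hΦ0 hΦΨ
  have hVz := hV.zeroConst
  obtain ⟨v0, vd, v1, v2⟩ := hV
  obtain ⟨d1, d2⟩ := pderiv_X0_sq v0
  have hp := exists_pushesTo hΨz hΦz hΨΦ V
  -- Modulo `x` the field is the Hamiltonian field of `H`.
  have hmod : ∀ f, X 0 ∣ lie V f - brk H f := fun f => by
    have : lie V f - brk H f = X 0 * (X 0 * pderiv ℂ 0 f) +
        (V 1 + pderiv ℂ 2 H) * pderiv ℂ 1 f + (V 2 - pderiv ℂ 1 H) * pderiv ℂ 2 f := by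
      rw [lie_three, v0, brk]; ring
    rw [this]
    exact dvd_add (dvd_add (dvd_mul_right _ _) (hH2.mul_right _)) (hH1.mul_right _)
  refine ⟨compMap Φ L, _, m, hΦ.comp hL, hLp.comp hL.diffeo.1 hΦz hp,
    ⟨hp.zero_eq hΦz hΦ0 hΨz hΦΨ v0, ?_, ?_, ?_⟩, ?_, ?_, ?_, fun hr => ?_, fun hr hY i => ?_⟩
  · rw [hp.ydiv_eq hΦ hΨz hΦΨ d1 d2, vd, subst_X hΨz.hasSubst, hΨ0]
  · refine mem_ordIdeal_of_subst hΦz hΨz hΦΨ ?_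
    rw [subst_add hΦz.hasSubst, ← hp 1, subst_mul hΦz.hasSubst, subst_C, subst_X hΦz.hasSubst]
    have e3 : lie V (Φ 1) = lie V (Φ 1 - X 1) + V 1 := by
      rw [← lie_X V 1, ← lie_add, sub_add_cancel]
    rw [e3]
    have := add_mem (add_mem (lie_mem_ordIdeal (d := 1) hVz hΦ1) v1)
      (Ideal.mul_mem_left _ (C l) hΦ1)
    convert this using 1
    ring
  · refine mem_ordIdeal_of_subst hΦz hΨz hΦΨ ?_
    rw [subst_sub hΦz.hasSubst, ← hp 2, subst_mul hΦz.hasSubst, subst_C, subst_X hΦz.hasSubst]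
    have e3 : lie V (Φ 2) = lie V (Φ 2 - X 2) + V 2 := by
      rw [← lie_X V 2, ← lie_add, sub_add_cancel]
    rw [e3]
    have := sub_mem (add_mem (lie_mem_ordIdeal (d := 1) hVz hΦ2) v2)
      (Ideal.mul_mem_left _ (C l) hΦ2)
    convert this using 1
    ring
  -- The Hamiltonian field has divergence zero, hence so has its image `(0, -m y₁, m y₂)`, whose
  -- divergence is `-del m`.
  · have hHp : PushesTo Φ ![0, -pderiv ℂ 2 H, pderiv ℂ 1 H] ![0, -(m * X 1), m * X 2] := by
      have hb : ∀ f, lie ![0, -pderiv ℂ 2 H, pderiv ℂ 1 H] f = brk H f := fun f => by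
        rw [lie_three, brk]; simp; ring
      intro i
      rw [hb]
      fin_cases i
      · simp [brk, hΦ0, subst_const_zero hΦz]
      · simp [e1, subst_neg hΦz, subst_mul hΦz.hasSubst, subst_X hΦz.hasSubst]
      · simp [e2, subst_mul hΦz.hasSubst, subst_X hΦz.hasSubst]
    have e := hHp.ydiv_eq hΦ hΨz hΦΨ (by simp) (by simp)
    have hz : ydiv ![0, -pderiv ℂ 2 H, pderiv ℂ 1 H] = 0 := by
      simp [ydiv, pderiv_comm (2 : Fin 3) 1]
    rw [hz, subst_const_zero hΨz] at e
    simp only [ydiv, Matrix.cons_val_one, Matrix.cons_val_zero, Matrix.cons_val, map_neg,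
      pderiv_mul, pderiv_X_self] at e
    rw [del]
    linear_combination -e
  · have := X0_dvd_subst hΨz hΨ0 (hmod (Φ 1))
    rw [e1, sub_neg_eq_add, subst_add hΨz.hasSubst, subst_mul hΨz.hasSubst,
      subst_subst hΦz hΨz, hΦΨ, subst_X_eq] at this
    have e3 := congrFun hΦΨ 1
    rw [compMap] at e3
    rwa [e3] at this
  · have := X0_dvd_subst hΨz hΨ0 (hmod (Φ 2))
    rw [e2, subst_sub hΨz.hasSubst, subst_mul hΨz.hasSubst,
      subst_subst hΦz hΨz, hΦΨ, subst_X_eq] at this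
    have e3 := congrFun hΦΨ 2
    rw [compMap] at e3
    rwa [e3] at this
  · obtain ⟨a, b⟩ := hc (hHc (hVr hr))
    exact ⟨fun i => (a i).subst hL.diffeo.1 hLc, b⟩
  · obtain ⟨a, b⟩ := hc (hHc (hVr hr))
    exact IsConvergent.subst (IsConvergent.lie (hVc hY) (a i)) hΨz (hΨc a)

end Prenormalization

end SaddleNode
end

noncomputable section

namespace SaddleNode

/-! ### Formal Poincaré–Dulac normalization tangent to the identity. -/

section PoincareDulac

/-- A monomial of weight `1` must contain `y₁` and one of weight `-1` must contain `y₂`; dividing it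
out leaves weight zero. -/
lemma exists_eq_X_mul_of_del {f : Ser 3} (i : Fin 2) (hf : f ∈ ordIdeal (Fin 3) 2)
    (h : ∀ k : Fin 3 →₀ ℕ, (k 1 : ℂ) - k 2 ≠ (![1, -1] : Fin 2 → ℂ) i → coeff k f = 0) :
    ∃ n : Ser 3, f = n * X i.succ ∧ del n = 0 ∧ constantCoeff n = 0 := by
  have hd : del f = C ((![1, -1] : Fin 2 → ℂ) i) * f := by
    ext k
    rw [coeff_del, coeff_C_mul]
    by_cases hk : (k 1 : ℂ) - k 2 = (![1, -1] : Fin 2 → ℂ) i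
    · rw [hk]
    · rw [h k hk]; ring
  have hX : (X i.succ : Ser 3) ∣ f := by
    rw [X_dvd_iff]
    intro k hk
    apply h
    fin_cases i
    · have : k 1 = 0 := hk
      intro e
      simp only [this, Nat.cast_zero, zero_sub, Fin.zero_eta, Matrix.cons_val_zero] at e
      have : ((k 2 + 1 : ℕ) : ℂ) = 0 := by push_cast; linear_combination -e
      exact absurd (Nat.cast_eq_zero.1 this) (by omega)
    · have : k 2 = 0 := hk
      intro e
      simp only [this, Nat.cast_zero, sub_zero, Fin.mk_one, Matrix.cons_val_one,
        Matrix.cons_val_zero] at e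
      have : ((k 1 + 1 : ℕ) : ℂ) = 0 := by push_cast; linear_combination e
      exact absurd (Nat.cast_eq_zero.1 this) (by omega)
  obtain ⟨n, rfl⟩ := hX
  have hdX : del (X i.succ : Ser 3) = C ((![1, -1] : Fin 2 → ℂ) i) * X i.succ := by
    fin_cases i
    · simp [del]
    · simp [del]
  have hX0 : (X i.succ : Ser 3) ≠ 0 := by
    intro h
    have := congrArg (pderiv ℂ i.succ) h
    simp at this
  refine ⟨n, mul_comm _ _, ?_, ?_⟩
  · rw [del_mul, hdX] at hd
    have : X i.succ * del n = 0 := by linear_combination hd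
    exact (mul_eq_zero.1 this).resolve_left hX0
  · have := (mem_ordIdeal_two.1 hf).2 i.succ
    rw [pderiv_mul] at this
    simpa using this

/-- Formal fibered Poincaré–Dulac normalization, equal to the identity on `x = 0` when the
restriction of the field is already resonant. -/
theorem exists_poincareDulac {l : ℂ} (hl : l ≠ 0) {Y : Fin 3 → Ser 3} (hY : IsHamPrepared l Y)
    {m : Ser 3} (hm : del m = 0) (hm1 : X 0 ∣ Y 1 + m * X 1) (hm2 : X 0 ∣ Y 2 - m * X 2) :
    ∃ u₁ u₂ k₁ k₂ : Ser 3, u₁ - X 1 ∈ ordIdeal (Fin 3) 2 ∧ u₂ - X 2 ∈ ordIdeal (Fin 3) 2 ∧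
      X 0 ∣ u₁ - X 1 ∧ X 0 ∣ u₂ - X 2 ∧ del k₁ = 0 ∧ del k₂ = 0 ∧
      constantCoeff k₁ = -l ∧ constantCoeff k₂ = l ∧
      PushesTo ![X 0, u₁, u₂] Y (diagField k₁ k₂) := by
  obtain ⟨hY0, -, hY1, hY2⟩ := hY
  let s : Fin 2 → ℂ := ![1, -1]
  let w : Fin 2 → (Fin 3 →₀ ℕ) → ℂ := fun i k => (k 1 : ℂ) - k 2 - s i
  -- Inverse of the homological operator. One series `g i` carries two unknowns: its coefficients
  -- with `w ≠ 0` form the change of variable `hh`, those with `w = 0` the nonlinear part `NN` of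
  -- the normal form. On the latter, `-1` solves for `NN` itself.
  let μ : Fin 2 → (Fin 3 →₀ ℕ) → ℂ := fun i k => if w i k = 0 then -1 else -(l * w i k)⁻¹
  let ν : Fin 2 → (Fin 3 →₀ ℕ) → ℂ := fun i k => if w i k = 0 then 0 else 1
  let hh : (Fin 2 → Ser 3) → Fin 2 → Ser 3 := fun g i => mulCoeff (ν i) (g i)
  let NN : (Fin 2 → Ser 3) → Fin 2 → Ser 3 := fun g i => mulCoeff (fun k => 1 - ν i k) (g i)
  let U : (Fin 2 → Ser 3) → Fin 3 → Ser 3 := fun g => ![X 0, X 1 + hh g 0, X 2 + hh g 1]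
  let F : Fin 2 → Ser 3 := ![Y 1 + C l * X 1, Y 2 - C l * X 2]
  let D : Ser 3 → Ser 3 := fun f =>
    X 0 * X 0 * pderiv ℂ 0 f + F 0 * pderiv ℂ 1 f + F 1 * pderiv ℂ 2 f
  -- The conjugacy equation is `-l (del h - s h) = -F - D h + NN ∘ U`. Subtracting `NN` leaves `NN ∘
  -- U - NN`, of higher order as `U` is tangent to the identity, so `T` gains an order.
  let T : (Fin 2 → Ser 3) → Fin 2 → Ser 3 := fun g i =>
    mulCoeff (μ i) (-F i - D (hh g i) + (subst (U g) (NN g i) - NN g i))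
  let S : Set (Fin 2 → Ser 3) := {g | ∀ i, g i ∈ ordIdeal (Fin 3) 2 ∧ X 0 ∣ hh g i}
  have hF : ∀ i, F i ∈ ordIdeal (Fin 3) 2 := fun i => by
    fin_cases i
    · exact hY1
    · exact hY2
  have hUX : ∀ g, (∀ i, g i ∈ ordIdeal (Fin 3) 2) → ∀ i, U g i - X i ∈ ordIdeal (Fin 3) 2 :=
    fun g hg i => by
      fin_cases i
      · simp [U]
      · simpa [U] using mulCoeff_mem_ordIdeal _ (hg 0)
      · simpa [U] using mulCoeff_mem_ordIdeal _ (hg 1)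
  have hUz : ∀ g, (∀ i, g i ∈ ordIdeal (Fin 3) 2) → ZeroConst (U g) := fun g hg i =>
    constantCoeff_of_sub_X_mem (hUX g hg i)
  have hUX0 : ∀ g, (∀ i, X 0 ∣ hh g i) → ∀ i, X 0 ∣ U g i - X i := fun g hg i => by
    fin_cases i
    · simp [U]
    · simpa [U] using hg 0
    · simpa [U] using hg 1
  have hD : ∀ d f, f ∈ ordIdeal (Fin 3) (d + 1) → D f ∈ ordIdeal (Fin 3) (2 + d) :=
    fun d f hf => by
      refine add_mem (add_mem ?_ ?_) ?_
      · exact mul_mem_ordIdeal (mul_mem_ordIdeal (d := 1) (e := 1) (X_mem_ordIdeal 0)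
          (X_mem_ordIdeal 0)) (pderiv_mem_ordIdeal _ hf)
      · exact mul_mem_ordIdeal (hF 0) (pderiv_mem_ordIdeal _ hf)
      · exact mul_mem_ordIdeal (hF 1) (pderiv_mem_ordIdeal _ hf)
  have hDX : ∀ f, X 0 ∣ f → X 0 ∣ D f := fun f hf => by
    refine dvd_add (dvd_add ?_ ?_) ?_
    · rw [mul_assoc]; exact dvd_mul_right _ _
    · exact (X_dvd_pderiv (by decide) hf).mul_left _
    · exact (X_dvd_pderiv (by decide) hf).mul_left _
  -- Modulo `x` the perturbation is `(l - m) y₁` or `(m - l) y₂`, entirely resonant. This keeps the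
  -- change of variable equal to the identity on `x = 0`.
  have hFX : ∀ i, X 0 ∣ mulCoeff (ν i) (F i) := fun i => by
    have key : ∀ r : Ser 3, del r = C (s i) * r → mulCoeff (ν i) r = 0 := fun r hr => by
      ext k
      have := congrArg (coeff k) hr
      rw [coeff_del, coeff_C_mul] at this
      rw [coeff_mulCoeff, map_zero]
      by_cases hk : w i k = 0
      · simp [ν, hk]
      · have e : w i k * coeff k r = 0 := by simp only [w]; linear_combination this
        rw [(mul_eq_zero.1 e).resolve_left hk, mul_zero]
    have add : ∀ a b : Ser 3, mulCoeff (ν i) (a + b) = mulCoeff (ν i) a + mulCoeff (ν i) b :=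
      fun a b => by ext k; simp [mul_add]
    fin_cases i
    · change X 0 ∣ mulCoeff (ν 0) (Y 1 + C l * X 1)
      have e : Y 1 + C l * X 1 = (Y 1 + m * X 1) + (C l - m) * X 1 := by ring
      rw [e]
      have h2 : mulCoeff (ν 0) ((C l - m) * X 1) = 0 := key _ (by
        rw [del_mul, del_sub, hm, del_C]; simp [s, del])
      have h1 : mulCoeff (ν 0) ((Y 1 + m * X 1) + (C l - m) * X 1) =
          mulCoeff (ν 0) (Y 1 + m * X 1) + mulCoeff (ν 0) ((C l - m) * X 1) := add _ _
      rw [h2, add_zero] at h1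
      rw [h1]; exact X_dvd_mulCoeff _ hm1
    · change X 0 ∣ mulCoeff (ν 1) (Y 2 - C l * X 2)
      have e : Y 2 - C l * X 2 = (Y 2 - m * X 2) + (m - C l) * X 2 := by ring
      rw [e]
      have h2 : mulCoeff (ν 1) ((m - C l) * X 2) = 0 := key _ (by
        rw [del_mul, del_sub, hm, del_C]; simp [s, del])
      have h1 : mulCoeff (ν 1) ((Y 2 - m * X 2) + (m - C l) * X 2) =
          mulCoeff (ν 1) (Y 2 - m * X 2) + mulCoeff (ν 1) ((m - C l) * X 2) := add _ _
      rw [h2, add_zero] at h1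
      rw [h1]; exact X_dvd_mulCoeff _ hm2
  have hhmem : ∀ g i d, g i ∈ ordIdeal (Fin 3) d → hh g i ∈ ordIdeal (Fin 3) d :=
    fun g i d h => mulCoeff_mem_ordIdeal _ h
  have hNmem : ∀ g i d, g i ∈ ordIdeal (Fin 3) d → NN g i ∈ ordIdeal (Fin 3) d :=
    fun g i d h => mulCoeff_mem_ordIdeal _ h
  have hsub : ∀ (a b : Fin 2 → Ser 3) i, hh a i - hh b i = hh (a - b) i := fun a b i => by
    ext k; simp [hh, mul_sub]
  have hNsub : ∀ (a b : Fin 2 → Ser 3) i, NN a i - NN b i = NN (a - b) i := fun a b i => by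
    ext k; simp [NN, mul_sub]
  have hTS : ∀ g ∈ S, T g ∈ S := fun g hg i => by
    have hg1 := fun i => (hg i).1
    have hg2 := fun i => (hg i).2
    refine ⟨mulCoeff_mem_ordIdeal _ (add_mem (sub_mem (neg_mem (hF i)) ?_) (sub_mem ?_ ?_)), ?_⟩
    · exact ordIdeal_mono (by norm_num) (hD 1 _ (hhmem g i 2 (hg1 i)))
    · exact subst_mem_ordIdeal (hUz g hg1) (hNmem g i 2 (hg1 i))
    · exact hNmem g i 2 (hg1 i)
    · have e : hh (T g) i = mulCoeff (μ i) (-mulCoeff (ν i) (F i) - mulCoeff (ν i) (D (hh g i)) +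
          mulCoeff (ν i) (subst (U g) (NN g i) - NN g i)) := by
        ext k
        simp only [hh, T, coeff_mulCoeff, map_add, map_sub, map_neg]
        ring
      rw [e]
      refine X_dvd_mulCoeff _ (dvd_add (dvd_sub ?_ ?_) ?_)
      · exact (hFX i).neg_right
      · exact X_dvd_mulCoeff _ (hDX _ (hg2 i))
      · refine X_dvd_mulCoeff _ ?_
        nth_rewrite 2 [← subst_X_eq (NN g i)]
        exact X_dvd_subst_sub_subst (hUz g hg1) zeroConst_X (hUX0 g hg2) _
  obtain ⟨g, hgS, hfix⟩ := exists_fixedPoint T S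
    (fun i => ⟨zero_mem _, by
      have : hh 0 i = 0 := by ext k; simp [hh]
      rw [this]; exact dvd_zero _⟩) hTS
    (fun a ha i => by
      constructor
      · obtain ⟨b, hb, hab⟩ := ha 2
        have := add_mem (hab i) (hb i).1
        rwa [sub_add_cancel] at this
      · rw [X_dvd_iff]
        intro k hk
        obtain ⟨b, hb, hab⟩ := ha (k.degree + 1)
        have h1 := hab i k (Nat.lt_succ_self _)
        have h2 := X_dvd_iff.1 (hb i).2 k hk
        rw [map_sub, sub_eq_zero] at h1
        simpa only [hh, coeff_mulCoeff, h1] using h2)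
    (fun a ha b hb d hab i => by
      -- In low order the gain is automatic, since `T` takes values in order 2.
      by_cases hd : d ≤ 1
      · exact ordIdeal_mono (by omega) (sub_mem (hTS a ha i).1 (hTS b hb i).1)
      obtain ⟨e, rfl⟩ : ∃ e, d = e + 1 := ⟨d - 1, by omega⟩
      have ha1 := fun i => (ha i).1
      have hb1 := fun i => (hb i).1
      have hDsub : D (hh a i) - D (hh b i) = D (hh (a - b) i) := by
        rw [← hsub]; simp only [D, map_sub]; ring
      have hT : T a i - T b i = mulCoeff (μ i) (-D (hh (a - b) i) +
          ((subst (U a) (NN (a - b) i) - NN (a - b) i) +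
            (subst (U a) (NN b i) - subst (U b) (NN b i)))) := by
        rw [← hDsub, ← hNsub, subst_sub (hUz a ha1).hasSubst]
        ext k
        simp only [T, coeff_mulCoeff, map_add, map_sub, map_neg]
        ring
      rw [hT]
      refine mulCoeff_mem_ordIdeal _ (add_mem (neg_mem ?_) (add_mem ?_ ?_))
      · exact ordIdeal_mono (by omega) (hD e _ (hhmem (a - b) i _ (hab i)))
      · nth_rewrite 2 [← subst_X_eq (NN (a - b) i)]
        exact ordIdeal_mono (by omega) (subst_sub_subst_mem_ordIdeal (m := e) (hUz a ha1)
          zeroConst_X (hUX a ha1) (hNmem (a - b) i _ (hab i)))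
      · refine subst_sub_subst_mem_ordIdeal (d := e + 1) (m := 1) (hUz a ha1) (hUz b hb1)
          (fun j => ?_) (hNmem b i 2 (hb1 i))
        fin_cases j
        · simp [U]
        · have := hhmem (a - b) 0 _ (hab 0)
          rw [← hsub] at this
          simpa [U] using this
        · have := hhmem (a - b) 1 _ (hab 1)
          rw [← hsub] at this
          simpa [U] using this)
  have hg1 := fun i => (hgS i).1
  have hg2 := fun i => (hgS i).2
  have hz := hUz g hg1
  have heq : ∀ i, -(C l * (del (hh g i) - C (s i) * hh g i)) =
      -F i - D (hh g i) + subst (U g) (NN g i) := fun i => by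
    ext k
    have h1 : coeff k (g i) = μ i k *
        coeff k (-F i - D (hh g i) + (subst (U g) (NN g i) - NN g i)) := by
      conv_lhs => rw [← hfix]
      rfl
    have h2 : coeff k (-F i - D (hh g i) + (subst (U g) (NN g i) - NN g i)) =
        coeff k (-F i - D (hh g i) + subst (U g) (NN g i)) - (1 - ν i k) * coeff k (g i) := by
      simp only [map_add, map_sub, map_neg, NN, coeff_mulCoeff]; ring
    have h3 : coeff k (-(C l * (del (hh g i) - C (s i) * hh g i))) =
        -(l * w i k * (ν i k * coeff k (g i))) := by
      simp only [map_neg, coeff_C_mul, map_sub, coeff_del, hh, coeff_mulCoeff, w]; ring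
    rw [h3]
    rw [h2] at h1
    by_cases hk : w i k = 0
    · simp only [μ, ν, hk, if_true] at h1 ⊢
      linear_combination -h1
    · simp only [μ, ν, hk, if_false] at h1 ⊢
      rw [h1]
      field_simp
      ring
  have hpush : ∀ i : Fin 2, lie Y (X i.succ + hh g i) =
      subst (U g) (-(C (l * s i) * X i.succ) + NN g i) := fun i => by
    have hU : U g i.succ = X i.succ + hh g i := by fin_cases i <;> rfl
    have hYi : Y i.succ = F i - C (l * s i) * X i.succ := by
      fin_cases i
      · simp [F, s]
      · simp [F, s]
    rw [lie_add, lie_X, subst_add hz.hasSubst, subst_neg hz, subst_mul hz.hasSubst, subst_C,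
      subst_X hz.hasSubst, hU, hYi, lie_three, hY0]
    have e := heq i
    have y1 : Y 1 = F 0 - C l * X 1 := by simp [F]
    have y2 : Y 2 = F 1 + C l * X 2 := by simp [F]
    rw [y1, y2]
    simp only [D, del] at e
    rw [map_mul]
    linear_combination e
  have hN : ∀ i, ∃ n : Ser 3, NN g i = n * X i.succ ∧ del n = 0 ∧ constantCoeff n = 0 := fun i =>
    exists_eq_X_mul_of_del i (hNmem g i 2 (hg1 i)) fun k hk => by
      have : w i k ≠ 0 := sub_ne_zero.2 hk
      simp [NN, ν, this]
  obtain ⟨n₁, hn₁, hdn₁, hcn₁⟩ := hN 0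
  obtain ⟨n₂, hn₂, hdn₂, hcn₂⟩ := hN 1
  refine ⟨X 1 + hh g 0, X 2 + hh g 1, -C l + n₁, C l + n₂, ?_, ?_, ?_, ?_, ?_, ?_, ?_, ?_, ?_⟩
  · rw [add_sub_cancel_left]; exact hhmem g 0 2 (hg1 0)
  · rw [add_sub_cancel_left]; exact hhmem g 1 2 (hg1 1)
  · rw [add_sub_cancel_left]; exact hg2 0
  · rw [add_sub_cancel_left]; exact hg2 1
  · rw [← map_neg, del_add, del_C, hdn₁, add_zero]
  · rw [del_add, del_C, hdn₂, add_zero]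
  · simp [hcn₁]
  · simp [hcn₂]
  · intro i
    fin_cases i
    · change lie Y (X 0) = subst (U g) (X 0 ^ 2)
      rw [lie_X, hY0, subst_X0_sq hz rfl]
    · have := hpush 0
      rw [hn₁] at this
      refine this.trans (congrArg (subst (U g)) ?_)
      simp [s, diagField]; ring
    · have := hpush 1
      rw [hn₂] at this
      refine this.trans (congrArg (subst (U g)) ?_)
      simp [s, diagField]; ring

end PoincareDulac

end SaddleNode
end

noncomputable section

namespace SaddleNode

/-! ### Making the diagonalization symplectic. -/

section Straightening

lemma X_dvd_of_X_dvd_X_mul {σ : Type*} {i j : σ} (hij : j ≠ i) {f : MvPowerSeries σ ℂ}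
    (h : X i ∣ X j * f) : X i ∣ f := by
  rw [X_dvd_iff] at h ⊢
  intro k hk
  have := h (Finsupp.single j 1 + k) (by simp [hk, hij])
  rwa [X, coeff_add_monomial_mul, one_mul] at this

lemma X2_mul_pderiv_of_del {f : Ser 3} (h : del f = 0) :
    X 2 * pderiv ℂ 2 f = X 1 * pderiv ℂ 1 f := (sub_eq_zero.1 h).symm

lemma del_X_mul_pderiv {f : Ser 3} (h : del f = 0) (i : Fin 3) : del (X i * pderiv ℂ i f) = 0 := by
  rw [del_eq_zero_iff] at h ⊢
  intro k hk
  rw [coeff_X_mul_pderiv, h k hk, mul_zero]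

lemma ydiv_diagField {k₁ k₂ : Ser 3} : ydiv (diagField k₁ k₂) =
    k₁ + X 1 * pderiv ℂ 1 k₁ + (k₂ + X 2 * pderiv ℂ 2 k₂) := by
  simp [ydiv, diagField]

lemma X0_dvd_brk_sub_one {f g : Ser 3} (hf : X 0 ∣ f - X 1) (hg : X 0 ∣ g - X 2) :
    X 0 ∣ brk f g - 1 := by
  have d : ∀ {j : Fin 3}, j ≠ 0 → ∀ {h : Ser 3}, X 0 ∣ h → X 0 ∣ pderiv ℂ j h :=
    fun hj _ h => X_dvd_pderiv hj h
  obtain ⟨a, ha⟩ := d (j := 1) (by decide) hf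
  obtain ⟨b, hb⟩ := d (j := 2) (by decide) hf
  obtain ⟨a', ha'⟩ := d (j := 1) (by decide) hg
  obtain ⟨b', hb'⟩ := d (j := 2) (by decide) hg
  simp only [map_sub, pderiv_X_self, pderiv_X12, pderiv_X21, sub_zero] at ha hb ha' hb'
  rw [sub_eq_iff_eq_add] at ha hb'
  refine ⟨a * (X 0 * b') + a + b' - b * (X 0 * a'), ?_⟩
  rw [brk, ha, hb, ha', hb']
  ring

lemma X0_dvd_inverse_sub {n : ℕ} {Φ Ψ : Fin (n + 1) → Ser (n + 1)} 
    (hΨ : ZeroConst Ψ) (h0 : Φ 0 = X 0) (h : compMap Φ Ψ = X) {i : Fin (n + 1)}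
    (hi : X 0 ∣ Φ i - X i) : X 0 ∣ Ψ i - X i := by
  have h1 : Ψ 0 = X 0 := inverse_fibered hΨ h0 h
  obtain ⟨g, hg⟩ := hi
  have e : subst Ψ (Φ i) = X i := congrFun h i
  have e1 := congrArg (subst Ψ) hg
  rw [subst_sub hΨ.hasSubst, subst_mul hΨ.hasSubst, subst_X hΨ.hasSubst, subst_X hΨ.hasSubst, e,
    h1] at e1
  rw [← dvd_neg, neg_sub, e1]
  exact dvd_mul_right _ _

/-- The resonant primitive of the Jacobian of a diagonalization is a semi-invariant. -/
lemma lie_resonant_primitive {k₁ k₂ J W : Ser 3} (h2 : del k₂ = 0)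
    (hJ0 : del J = 0) (hW : del W = 0) (hWJ : W + X 1 * pderiv ℂ 1 W = J)
    (hJ : lie (diagField k₁ k₂) J = J * (X 0 - ydiv (diagField k₁ k₂))) :
    lie (diagField k₁ k₂) W = (X 0 - (k₁ + k₂)) * W := by
  rw [lie_diagField, ydiv_diagField, X2_mul_pderiv_of_del hJ0, X2_mul_pderiv_of_del h2] at hJ
  rw [lie_diagField, X2_mul_pderiv_of_del hW, ← sub_eq_zero]
  apply eq_zero_of_add_X_mul_pderiv
  simp only [map_add, map_sub, pderiv_mul, pderiv_X01, pderiv_X_self]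
  rw [← sub_eq_zero] at hJ
  refine Eq.trans ?_ hJ
  rw [← hWJ]
  simp only [map_add, pderiv_mul, pderiv_X10, pderiv_X_self, pderiv_comm (0 : Fin 3) 1]
  ring

/-- The Jacobian defect of the Poincaré–Dulac map is a resonant series, so multiplying `y₂` by a
resonant unit `W` removes it without leaving diagonal form. The divergence then forces the
coefficients to be `k` and `x - k` with `k` resonant. -/
theorem exists_symplectic_diagonalization {l : ℂ} (hl : l ≠ 0) {Y : Fin 3 → Ser 3}
    (hY : IsHamPrepared l Y) {m : Ser 3} (hm : del m = 0) (hm1 : X 0 ∣ Y 1 + m * X 1)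
    (hm2 : X 0 ∣ Y 2 - m * X 2) :
    ∃ (U : Fin 3 → Ser 3) (k : Ser 3), IsTransSymplectic U ∧ X 0 ∣ U 1 - X 1 ∧ X 0 ∣ U 2 - X 2 ∧
      del k = 0 ∧ constantCoeff k = -l ∧ X 0 ∣ k + m ∧
      PushesTo U Y (diagField k (X 0 - k)) := by
  obtain ⟨u₁, u₂, k₁, k₂, o1, o2, x1, x2, d1, d2, c1, c2, hp⟩ :=
    exists_poincareDulac hl hY hm hm1 hm2
  obtain ⟨hY0, hYd, -⟩ := hY
  set U : Fin 3 → Ser 3 := ![X 0, u₁, u₂] with hU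
  have hfib : IsFibered U := isFibered_cons o1 o2
  have hUz : ZeroConst U := hfib.1.zeroConst
  obtain ⟨V, hV, hUV, hVU, -⟩ := exists_inverse hfib.1
  have hVz : ZeroConst V := hV.zeroConst
  have hV0 : V 0 = X 0 := inverse_fibered (Φ := U) hVz rfl hUV
  set N := diagField k₁ k₂ with hN
  have hN0 : pderiv ℂ 1 (N 0) = 0 ∧ pderiv ℂ 2 (N 0) = 0 := pderiv_X0_sq rfl
  have hpV : PushesTo V N Y := hp.symm hVz hUz hUV hVU
  set J := brk (V 1) (V 2) with hJdef
  -- The transformation law of the divergence for `V`, whose target has divergence `x`.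
  have hJ : lie N J = J * (X 0 - ydiv N) := by
    have := subst_ydiv_mul hVz hV0 hN0.1 hN0.2 hpV
    rw [hYd, subst_X hVz.hasSubst, hV0] at this
    linear_combination -this
  have hdD : del (X 0 - ydiv N) = 0 := by
    rw [hN, ydiv_diagField]
    simp [del_sub, del_add, d1, d2, del_X_mul_pderiv]
  have hcD : constantCoeff (X 0 - ydiv N) = 0 := by
    rw [hN, ydiv_diagField]
    simp [c1, c2]
  have hdJ : del J = 0 := del_eq_zero_of_lie_eq hl d1 d2 c1 c2 hdD hcD hJ
  have hJ1 : X 0 ∣ J - 1 := X0_dvd_brk_sub_one (X0_dvd_inverse_sub (Φ := U) hVz rfl hUV x1)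
    (X0_dvd_inverse_sub (Φ := U) hVz rfl hUV x2)
  have hJc : constantCoeff J = 1 := by
    obtain ⟨g, hg⟩ := hJ1
    rw [sub_eq_iff_eq_add.1 hg]; simp
  have hJU : subst U J * brk u₁ u₂ = 1 := by
    have := brk_subst hUz rfl (V 1) (V 2)
    have e1 : subst U (V 1) = X 1 := congrFun hVU 1
    have e2 : subst U (V 2) = X 2 := congrFun hVU 2
    rw [e1, e2] at this
    rw [hJdef]
    refine this.symm.trans ?_
    simp [brk]
  obtain ⟨W, hdW, hWJ, hWc, hWx, -⟩ := exists_resonant_primitive hdJ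
  have hW1 : X 0 ∣ W - 1 := hWx hJ1
  have hlW : lie N W = (X 0 - (k₁ + k₂)) * W := lie_resonant_primitive d2 hdJ hdW hWJ hJ
  -- In diagonal coordinates `(x, y₁, y₂ W)` has Jacobian `W + y₂∂₂W = W + y₁∂₁W = J`, exactly what
  -- cancels the Jacobian of `U`.
  set w := subst U (X 2 * W) with hw
  have ow : w - X 2 ∈ ordIdeal (Fin 3) 2 := by
    refine subst_sub_X_mem hUz ?_ o2
    have e : X 2 * W - X 2 = X 2 * (W - 1) := by ring
    rw [e]
    exact mul_mem_ordIdeal (X_mem_ordIdeal 2) (mem_ordIdeal_one.2 (by simp [hWc, hJc]))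
  have xw : X 0 ∣ w - X 2 := by
    have e : X 2 * W - X 2 = X 2 * (W - 1) := by ring
    have h1 : X 0 ∣ subst U (X 2 * W - X 2) :=
      X0_dvd_subst hUz rfl (e ▸ hW1.mul_left _)
    rw [subst_sub hUz.hasSubst, subst_X hUz.hasSubst] at h1
    have := dvd_add h1 x2
    have e2 : U 2 = u₂ := rfl
    rwa [e2, sub_add_sub_cancel] at this
  set U' : Fin 3 → Ser 3 := ![X 0, u₁, w] with hU'
  have hsym : IsTransSymplectic U' := by
    rw [isTransSymplectic_iff]
    refine ⟨(isFibered_cons o1 ow).1.zeroConst, rfl, ?_⟩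
    change brk u₁ w = 1
    have e1 : u₁ = subst U (X (1 : Fin 3) : Ser 3) := by rw [subst_X hUz.hasSubst]; rfl
    rw [← hJU, hw]
    conv_lhs => rw [e1]
    rw [brk_subst hUz rfl]
    congr 2
    simp only [brk, pderiv_X_self, pderiv_X12, pderiv_mul, one_mul, zero_mul, sub_zero, mul_one]
    rw [X2_mul_pderiv_of_del hdW, add_comm, hWJ]
  have hUz' : ZeroConst U' := hsym.diffeo.zeroConst
  obtain ⟨V', hV', hUV', hVU', -⟩ := exists_inverse hsym.diffeo
  have hVz' : ZeroConst V' := hV'.zeroConst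
  have hk : subst U' (subst V' (subst U k₁)) = subst U k₁ := by
    rw [subst_subst hVz' hUz', hVU', subst_X_eq]
  have hp' : PushesTo U' Y (diagField (subst V' (subst U k₁)) (X 0 - subst V' (subst U k₁))) := by
    intro i
    fin_cases i
    · exact (lie_X Y 0).trans (hY0.trans (subst_X0_sq hUz' rfl).symm)
    · change lie Y u₁ = subst U' (_ * X 1)
      rw [subst_mul hUz'.hasSubst, hk, subst_X hUz'.hasSubst]
      refine (hp 1).trans ?_
      change subst U (k₁ * X 1) = _
      rw [subst_mul hUz.hasSubst, subst_X hUz.hasSubst]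
      rfl
    · change lie Y w = subst U' (_ * X 2)
      rw [subst_mul hUz'.hasSubst, subst_sub hUz'.hasSubst, hk, subst_X hUz'.hasSubst,
        subst_X hUz'.hasSubst, hw, lie_subst hUz hp, lie_mul, lie_X, hlW]
      change subst U (X 2 * ((X 0 - (k₁ + k₂)) * W) + W * (k₂ * X 2)) = (X 0 - _) * w
      have e : (X 2 * ((X 0 - (k₁ + k₂)) * W) + W * (k₂ * X 2)) = (X 0 - k₁) * (X 2 * W) := by ring
      rw [e, subst_mul hUz.hasSubst, subst_sub hUz.hasSubst, subst_X hUz.hasSubst]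
      rfl
  set k := subst V' (subst U k₁) with hkdef
  have hdk : del k = 0 := by
    have := hp'.ydiv_eq hsym hVz' hUV' (pderiv_X0_sq hY0).1 (pderiv_X0_sq hY0).2
    rw [hYd, subst_X hVz'.hasSubst, inverse_fibered (Φ := U') hVz' rfl hUV', ydiv_diagField, map_sub,
      pderiv_X02] at this
    rw [del]
    linear_combination this
  refine ⟨U', k, hsym, x1, xw, hdk, ?_, ?_, hp'⟩
  · rw [hkdef, constantCoeff_subst_of_zeroConst hVz', constantCoeff_subst_of_zeroConst hUz, c1]
  -- As `U'` is the identity modulo `x`, reducing its first equation gives `x ∣ y₁ (k + m)`.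
  · have e : lie Y u₁ = subst U' (k * X 1) := hp' 1
    rw [subst_mul hUz'.hasSubst, subst_X hUz'.hasSubst] at e
    have hUX : ∀ i, X 0 ∣ U' i - X i := by
      intro i
      fin_cases i
      · simp [hU']
      · exact x1
      · exact xw
    have hk' := X_dvd_subst_sub_subst hUz' (zeroConst_X (σ := Fin 3)) hUX k
    rw [subst_X_eq] at hk'
    obtain ⟨g, hg⟩ := hk'
    obtain ⟨b, hb⟩ := x1
    obtain ⟨c, hc⟩ := hm1
    have e3 : lie Y u₁ = Y 1 + X 0 * (X 0 * b + lie Y b) := by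
      rw [sub_eq_iff_eq_add.1 hb, lie_add, lie_mul, lie_X, lie_X, hY0]; ring
    have e4 : X 0 ∣ X 1 * (k + m) := by
      change lie Y u₁ = subst U' k * u₁ at e
      refine ⟨c + X 0 * b + lie Y b - g * X 1 - subst U' k * b, ?_⟩
      rw [e3, sub_eq_iff_eq_add.1 hb] at e
      linear_combination hc - e - hg * X 1
    exact X_dvd_of_X_dvd_X_mul (by decide) e4

end Straightening

end SaddleNode
end

noncomputable section

namespace SaddleNode

/-! ### Removing the remaining resonant terms. -/

section FinalNormalization

lemma constantCoeff_X_mul_X : constantCoeff (X 1 * X 2 : Ser 3) = 0 := by simp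

lemma coeff_powerSeries_subst_X_mul_X (c : PowerSeries ℂ) (k : Fin 3 →₀ ℕ) :
    coeff k (PowerSeries.subst (X 1 * X 2 : Ser 3) c) =
      if k 0 = 0 ∧ k 1 = k 2 then PowerSeries.coeff (k 1) c else 0 := by
  have hs : PowerSeries.HasSubst (X 1 * X 2 : Ser 3) :=
    PowerSeries.HasSubst.of_constantCoeff_zero constantCoeff_X_mul_X
  have hX : ∀ d : ℕ, ((X 1 * X 2 : Ser 3)) ^ d =
      monomial (Finsupp.single 1 d + Finsupp.single 2 d) 1 := by
    intro d
    rw [mul_pow, X_pow_eq, X_pow_eq, monomial_mul_monomial, one_mul]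
  rw [PowerSeries.coeff_subst hs, finsum_eq_single _ (k 1)]
  · rw [hX, coeff_monomial]
    have : k = Finsupp.single 1 (k 1) + Finsupp.single 2 (k 1) ↔ k 0 = 0 ∧ k 1 = k 2 := by
      constructor
      · intro h
        have h0 := DFunLike.congr_fun h 0
        have h2 := DFunLike.congr_fun h 2
        simp at h0 h2
        exact ⟨h0, h2.symm⟩
      · rintro ⟨h0, h1⟩
        ext i
        fin_cases i <;> simp [h0, h1]
    simp [this]
  · intro d hd
    rw [hX, coeff_monomial, if_neg, smul_zero]
    intro h
    have h1 := DFunLike.congr_fun h 1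
    simp at h1
    exact hd h1.symm

lemma del_powerSeries_subst (c : PowerSeries ℂ) :
    del (PowerSeries.subst (X 1 * X 2 : Ser 3) c) = 0 := by
  rw [del_eq_zero_iff]
  intro k hk
  rw [coeff_powerSeries_subst_X_mul_X, if_neg fun h => hk h.2]

lemma subst_powerSeries_subst {R : Fin 3 → Ser 3} (hR : ZeroConst R) (c : PowerSeries ℂ) :
    subst R (PowerSeries.subst (X 1 * X 2 : Ser 3) c) = PowerSeries.subst (R 1 * R 2) c := by
  have hs : PowerSeries.HasSubst (X 1 * X 2 : Ser 3) :=
    PowerSeries.HasSubst.of_constantCoeff_zero constantCoeff_X_mul_X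
  rw [PowerSeries.subst, PowerSeries.subst, subst_comp_subst_apply hs.const hR.hasSubst]
  congr 1
  funext _
  rw [subst_mul hR.hasSubst, subst_X hR.hasSubst, subst_X hR.hasSubst]

lemma coeff_X0_mul (f : Ser 3) (k : Fin 3 →₀ ℕ) : coeff k (X 0 * f) =
    if k 0 = 0 then 0 else coeff (k - Finsupp.single 0 1) f := by
  rw [X, coeff_monomial_mul]
  simp [Finsupp.single_le_iff, Nat.one_le_iff_ne_zero]

/-- The resonant exponent that removes from `k` all terms divisible by `x` but `a₁ x`. -/
lemma exists_normalizing_exponent {l : ℂ} {k : Ser 3} (hk : del k = 0)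
    (hk0 : constantCoeff k = -l) : ∃ (a₁ : ℂ) (c : PowerSeries ℂ) (g : Ser 3),
      PowerSeries.constantCoeff c = 0 ∧
      (∀ j, j ≠ 0 → PowerSeries.coeff j c =
        -coeff (Finsupp.single 1 j + Finsupp.single 2 j) k) ∧
      del g = 0 ∧ constantCoeff g = 0 ∧
      k + X 0 * (X 0 * pderiv ℂ 0 g + X 1 * pderiv ℂ 1 g) =
        -C l + C a₁ * X 0 - PowerSeries.subst (X 1 * X 2 : Ser 3) c ∧
      ∀ e : Fin 3 →₀ ℕ, e 0 = 0 → coeff e g = -coeff (e + Finsupp.single 0 1) k / e 1 := by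
  rw [del_eq_zero_iff] at hk
  set c : PowerSeries ℂ := PowerSeries.mk fun j =>
    if j = 0 then 0 else -coeff (Finsupp.single 1 j + Finsupp.single 2 j) k with hc
  -- On resonant monomials `x (x∂ₓ + y₁∂₁)` multiplies by `e 0 + e 1` and raises the power of `x` by
  -- one, whence the shifted index. At `e = 0` the divisor vanishes: `g` has coefficient `0` by
  -- convention and the term `a₁ x` survives.
  set g : Ser 3 := fun e => -coeff (e + Finsupp.single 0 1) k / ((e 0 : ℂ) + e 1) with hg
  have hge : ∀ e, coeff e g = -coeff (e + Finsupp.single 0 1) k / ((e 0 : ℂ) + e 1) := fun e => rfl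
  refine ⟨coeff (Finsupp.single 0 1) k, c, g, ?_, ?_, ?_, ?_, ?_, ?_⟩
  · rw [← PowerSeries.coeff_zero_eq_constantCoeff_apply, hc, PowerSeries.coeff_mk, if_pos rfl]
  · intro j hj
    rw [hc, PowerSeries.coeff_mk, if_neg hj]
  · rw [del_eq_zero_iff]
    intro e he
    rw [hge, hk _ (by simpa using he), neg_zero, zero_div]
  · rw [← coeff_zero_eq_constantCoeff_apply, hge]
    simp
  · ext e
    rw [map_add, coeff_X0_mul, map_add, coeff_X_mul_pderiv, coeff_X_mul_pderiv, map_sub, map_add,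
      map_neg, coeff_C_mul, coeff_powerSeries_subst_X_mul_X, coeff_C, coeff_X, hge, hc,
      PowerSeries.coeff_mk]
    by_cases h0 : e 0 = 0
    · have h1 : e ≠ Finsupp.single 0 1 := by
        rintro rfl; simp at h0
      rw [if_pos h0, if_neg h1, mul_zero, add_zero, add_zero]
      by_cases h12 : e 1 = e 2
      · rw [if_pos (show e 0 = 0 ∧ e 1 = e 2 from ⟨h0, h12⟩)]
        by_cases h3 : e 1 = 0
        · have : e = 0 := by
            ext i
            fin_cases i
            · exact h0
            · exact h3
            · exact h12 ▸ h3
          subst this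
          simpa using hk0
        · have he : e = Finsupp.single 1 (e 1) + Finsupp.single 2 (e 1) := by
            ext i
            fin_cases i <;> simp [h0, h12]
          have he0 : e ≠ 0 := by
            rintro rfl; simp at h3
          rw [if_neg h3, if_neg he0, ← he]
          ring
      · have he0 : e ≠ 0 := by
          rintro rfl; simp at h12
        rw [hk e h12, if_neg (fun h => h12 h.2 : ¬(e 0 = 0 ∧ e 1 = e 2)), if_neg he0]
        ring
    · have he0 : e ≠ 0 := by
        rintro rfl; simp at h0
      rw [if_neg h0, if_neg he0, if_neg (fun h => h0 h.1 : ¬(e 0 = 0 ∧ e 1 = e 2))]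
      have hle : Finsupp.single 0 1 ≤ e := by
        rw [Finsupp.single_le_iff]; omega
      rw [tsub_add_cancel_of_le hle]
      by_cases h1 : e = Finsupp.single 0 1
      · subst h1; simp
      · rw [if_neg h1]
        by_cases h12 : e 1 = e 2
        · have hne : (((e - Finsupp.single 0 1 : Fin 3 →₀ ℕ) 0 : ℕ) : ℂ) +
              ((e - Finsupp.single 0 1 : Fin 3 →₀ ℕ) 1 : ℕ) ≠ 0 := by
            rw [← Nat.cast_add, Nat.cast_ne_zero]
            intro h
            apply h1
            simp at h
            ext i
            fin_cases i
            · simp; omega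
            · simpa using h.2
            · simp; omega
          field_simp
          ring
        · rw [hk e h12]
          simp
  · intro e he
    rw [hge, he]; simp

lemma isTransSymplectic_exp {g : Ser 3} (hg : del g = 0) (hg0 : constantCoeff g = 0) :
    IsTransSymplectic ![X 0, X 1 * expS g, X 2 * expS (-g)] := by
  rw [isTransSymplectic_iff]
  refine ⟨zeroConst_cons (by simp) (by simp), rfl, ?_⟩
  have := brk_hyperbolic (W := 1) (by simp [del]) hg0
  rw [one_mul, hg] at this
  exact this.trans (by simp)

lemma lie_X_mul_exp {Y : Fin 3 → Ser 3} {g : Ser 3} (hg : constantCoeff g = 0) (i : Fin 3) :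
    lie Y (X i * expS g) = (Y i + X i * lie Y g) * expS g := by
  rw [lie_mul, lie_X, lie_three, lie_three, pderiv_expS hg, pderiv_expS hg, pderiv_expS hg]
  ring

/-- The two exponentials cancel in `y₁y₂`, so `c(v)` is unchanged. As the diagonal coefficients sum
to `x` and `g` is resonant, the derivative of `g` along the field is free of `k`, and the equation
for `g` is linear. -/
lemma pushesTo_normalForm {l a₁ : ℂ} {k g : Ser 3} {c : PowerSeries ℂ} (hg : del g = 0)
    (hg0 : constantCoeff g = 0) (h : k + X 0 * (X 0 * pderiv ℂ 0 g + X 1 * pderiv ℂ 1 g) =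
      -C l + C a₁ * X 0 - PowerSeries.subst (X 1 * X 2 : Ser 3) c) :
    PushesTo ![X 0, X 1 * expS g, X 2 * expS (-g)] (diagField k (X 0 - k))
      (normalForm l a₁ (1 - a₁) c) := by
  set R : Fin 3 → Ser 3 := ![X 0, X 1 * expS g, X 2 * expS (-g)] with hR
  have hRz : ZeroConst R := (isTransSymplectic_exp hg hg0).diffeo.zeroConst
  have hRv : subst R (PowerSeries.subst (X 1 * X 2 : Ser 3) c) =
      PowerSeries.subst (X 1 * X 2 : Ser 3) c := by
    rw [subst_powerSeries_subst hRz]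
    congr 1
    change X 1 * expS g * (X 2 * expS (-g)) = _
    linear_combination (X 1 * X 2) * expS_mul_expS_neg hg0
  have hlg : lie (diagField k (X 0 - k)) g =
      X 0 * (X 0 * pderiv ℂ 0 g + X 1 * pderiv ℂ 1 g) := by
    rw [lie_diagField, X2_mul_pderiv_of_del hg]; ring
  have hC : ∀ a : ℂ, subst R (C a : Ser 3) = C a := fun a => subst_C _
  have hng : constantCoeff (-g) = 0 := by simp [hg0]
  intro i
  fin_cases i
  · exact (lie_X _ 0).trans (subst_X0_sq hRz rfl).symm
  · change lie _ (X 1 * expS g) = subst R (_ * X 1)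
    rw [subst_mul hRz.hasSubst, subst_sub hRz.hasSubst, subst_add hRz.hasSubst, subst_neg hRz,
      subst_mul hRz.hasSubst, hC, hC, subst_X hRz.hasSubst, subst_X hRz.hasSubst, hRv,
      lie_X_mul_exp hg0, hlg]
    change (k * X 1 + _) * _ = (-C l + C a₁ * X 0 - _) * (X 1 * expS g)
    rw [← h]; ring
  · change lie _ (X 2 * expS (-g)) = subst R (_ * X 2)
    have hl : lie (diagField k (X 0 - k)) (-g) = -lie (diagField k (X 0 - k)) g := by
      simp [lie]
    rw [subst_mul hRz.hasSubst, subst_add hRz.hasSubst, subst_add hRz.hasSubst,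
      subst_mul hRz.hasSubst, hC, hC, subst_X hRz.hasSubst, subst_X hRz.hasSubst, hRv,
      lie_X_mul_exp hng, hl, hlg]
    change ((X 0 - k) * X 2 + _) * _ = (C l + C (1 - a₁) * X 0 + _) * (X 2 * expS (-g))
    rw [map_sub, map_one]
    linear_combination (-X 2 * expS (-g)) * h

end FinalNormalization

end SaddleNode
end

noncomputable section

namespace SaddleNode

/-! ### Convergence of the normalization on `x = 0`. -/

section Convergence

lemma X_ne_zero {σ : Type*} (i : σ) : (X i : MvPowerSeries σ ℂ) ≠ 0 := fun h => by
  have := congrArg (coeff (Finsupp.single i 1)) h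
  simp at this

lemma quotient_mk_eq_iff {σ : Type*} {i : σ} {f g : MvPowerSeries σ ℂ} :
    Ideal.Quotient.mk (Ideal.span {X i}) f = Ideal.Quotient.mk (Ideal.span {X i}) g ↔
      X i ∣ f - g := by
  rw [Ideal.Quotient.eq, Ideal.mem_span_singleton]

/-- The `x`-derivative at `x = 0` of the first conjugacy equation, times `y₂`, with `U` the identity
plus `x (p, q)` in the transverse components. The point of this arrangement is that `p` and `q`,
possibly divergent, occur only in terms whose resonant part will vanish. -/
lemma X2_mul_pderiv_drift_congr {Y U : Fin 3 → Ser 3} {k m p q : Ser 3} (hm : del m = 0)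
    (hY0 : Y 0 = X 0 ^ 2) (hY1 : X 0 ∣ Y 1 + m * X 1) (hY2 : X 0 ∣ Y 2 - m * X 2)
    (hU : ZeroConst U) (hU0 : U 0 = X 0) (hp : U 1 - X 1 = X 0 * p) (hq : U 2 - X 2 = X 0 * q)
    (hkm : X 0 ∣ k + m) (h : lie Y (U 1) = subst U k * U 1) :
    X 0 ∣ X 2 * pderiv ℂ 0 (Y 1) - (X 1 * X 2 * pderiv ℂ 0 k + del (m * (X 2 * p)) -
      X 1 * pderiv ℂ 1 m * (X 2 * p + X 1 * q)) := by
  have hUX : ∀ i, X 0 ∣ U i - X i := by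
    intro i
    fin_cases i
    · simp [hU0]
    · exact ⟨p, hp⟩
    · exact ⟨q, hq⟩
  have hs : ∀ f : Ser 3, X 0 ∣ subst U f - f := fun f => by
    have := X_dvd_subst_sub_subst hU (zeroConst_X (σ := Fin 3)) hUX f
    rwa [subst_X_eq] at this
  have hd : ∀ j : Fin 3, j ≠ 0 → X 0 ∣ pderiv ℂ j k - -pderiv ℂ j m := fun j hj => by
    have := X_dvd_pderiv hj hkm
    rwa [map_add, ← sub_neg_eq_add] at this
  rw [sub_eq_iff_eq_add'] at hp hq
  have e := congrArg (pderiv ℂ (0 : Fin 3)) h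
  have e1 : lie Y (U 1) = Y 1 + X 0 * (X 0 * p + (X 0 ^ 2 * pderiv ℂ 0 p + Y 1 * pderiv ℂ 1 p +
      Y 2 * pderiv ℂ 2 p)) := by
    rw [hp, lie_add, lie_mul, lie_X, lie_X, lie_three, hY0]; ring
  rw [e1, pderiv_mul, pderiv_subst hU, Fin.sum_univ_three, hU0, hp, hq] at e
  simp only [map_add, pderiv_mul, pderiv_X_self, pderiv_X10, pderiv_X20] at e
  set π := Ideal.Quotient.mk (Ideal.span {(X 0 : Ser 3)}) with hπ
  have π0 : π (X 0) = 0 := by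
    rw [hπ, Ideal.Quotient.eq_zero_iff_mem]; exact Ideal.mem_span_singleton_self _
  have πs : ∀ f, π (subst U f) = π f := fun f => quotient_mk_eq_iff.2 (hs f)
  have πd1 := quotient_mk_eq_iff.2 (hd 1 (by decide))
  have πd2 := quotient_mk_eq_iff.2 (hd 2 (by decide))
  have πY1 := quotient_mk_eq_iff.2 (by rwa [sub_neg_eq_add] : X 0 ∣ Y 1 - -(m * X 1))
  have πY2 := quotient_mk_eq_iff.2 hY2
  have πk := quotient_mk_eq_iff.2 (by rwa [sub_neg_eq_add] : X 0 ∣ k - -m)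
  have e' := congrArg π e
  rw [← hπ] at πd1 πd2 πY1 πY2 πk
  simp only [map_add, map_mul, π0, πs, zero_mul, zero_add, add_zero, map_one, map_pow] at e'
  have hm' := congrArg π hm
  rw [← quotient_mk_eq_iff, ← hπ]
  rw [del_mul, hm, mul_zero, add_zero]
  simp only [del, map_add, map_sub, map_mul, map_neg, map_zero, pderiv_mul, pderiv_X21,
    pderiv_X_self] at *
  simp only [πd1, πd2, πY1, πY2, πk] at e'
  simp only [map_one, mul_one, mul_zero]
  linear_combination π (X 2) * e' + (π (X 1) * π q) * hm'

/-- Applying `y₁∂₁` to `y₂p` and `y₂∂₂` to `y₁q` gives the sum `y₁y₂ (∂₁p + ∂₂q)`, zero on `x = 0`;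
on a resonant monomial both operators multiply by the same `e 1`. -/
lemma coeff_add_dot_eq_zero {p q : Ser 3} (h : X 0 ∣ pderiv ℂ 1 p + pderiv ℂ 2 q)
    {e : Fin 3 →₀ ℕ} (h0 : e 0 = 0) (h12 : e 1 = e 2) : coeff e (X 2 * p + X 1 * q) = 0 := by
  by_cases h1 : e 1 = 0
  · have hz : ∀ (i : Fin 3) (f : Ser 3), e i = 0 → coeff e (X i * f) = 0 := fun i f hi =>
      X_dvd_iff.1 (dvd_mul_right (X i) f) e hi
    rw [map_add, hz 2 p (h12 ▸ h1), hz 1 q h1, add_zero]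
  · have key : X 1 * pderiv ℂ 1 (X 2 * p) + X 2 * pderiv ℂ 2 (X 1 * q) =
        X 1 * X 2 * (pderiv ℂ 1 p + pderiv ℂ 2 q) := by
      simp only [pderiv_mul, pderiv_X21, pderiv_X12]; ring
    have := X_dvd_iff.1 (h.mul_left (X 1 * X 2)) e h0
    rw [← key, map_add, coeff_X_mul_pderiv, coeff_X_mul_pderiv, ← h12, ← mul_add,
      ← map_add] at this
    exact (mul_eq_zero.1 this).resolve_left (Nat.cast_ne_zero.2 h1)

/-- The image of `del` has no resonant term. Symplecticity makes `(p, q)` divergence-free on `x =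
0`, so `y₂p + y₁q` has none there either, even after multiplication by the resonant `y₁∂₁m`. -/
lemma coeff_X2_mul_pderiv_drift {Y U : Fin 3 → Ser 3} {k m : Ser 3} (hm : del m = 0)
    (hY0 : Y 0 = X 0 ^ 2) (hY1 : X 0 ∣ Y 1 + m * X 1) (hY2 : X 0 ∣ Y 2 - m * X 2)
    (hU : IsTransSymplectic U) (hp : X 0 ∣ U 1 - X 1) (hq : X 0 ∣ U 2 - X 2)
    (hkm : X 0 ∣ k + m) (h : lie Y (U 1) = subst U k * U 1) {e : Fin 3 →₀ ℕ} (h0 : e 0 = 0)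
    (h12 : e 1 = e 2) :
    coeff e (X 2 * pderiv ℂ 0 (Y 1)) = coeff e (X 1 * X 2 * pderiv ℂ 0 k) := by
  obtain ⟨p, hp⟩ := hp
  obtain ⟨q, hq⟩ := hq
  have hdvd := X2_mul_pderiv_drift_congr hm hY0 hY1 hY2 hU.diffeo.zeroConst hU.1.2 hp hq hkm h
  have hpq : X 0 ∣ pderiv ℂ 1 p + pderiv ℂ 2 q := by
    have hb := (isTransSymplectic_iff.1 hU).2.2
    rw [sub_eq_iff_eq_add'] at hp hq
    simp only [brk, hp, hq, map_add, pderiv_mul, pderiv_X01, pderiv_X02, pderiv_X_self,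
      pderiv_X21, pderiv_X12] at hb
    refine ⟨-(pderiv ℂ 1 p * pderiv ℂ 2 q - pderiv ℂ 2 p * pderiv ℂ 1 q), ?_⟩
    apply mul_left_cancel₀ (X_ne_zero (0 : Fin 3))
    linear_combination hb
  have hd := X_dvd_iff.1 hdvd e h0
  have h1 : coeff e (del (m * (X 2 * p))) = 0 := by
    rw [coeff_del, h12, sub_self, zero_mul]
  have h2 : coeff e (X 1 * pderiv ℂ 1 m * (X 2 * p + X 1 * q)) = 0 := by
    rw [coeff_mul]
    refine Finset.sum_eq_zero fun a ha => ?_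
    rw [Finset.HasAntidiagonal.mem_antidiagonal] at ha
    by_cases ha12 : a.1 1 = a.1 2
    · have e0 := DFunLike.congr_fun ha 0
      have e1 := DFunLike.congr_fun ha 1
      have e2 := DFunLike.congr_fun ha 2
      simp only [Finsupp.add_apply] at e0 e1 e2
      rw [coeff_add_dot_eq_zero hpq (by omega) (by omega), mul_zero]
    · rw [del_eq_zero_iff.1 (del_X_mul_pderiv hm 1) _ ha12, zero_mul]
  rw [map_sub, map_sub, map_add, h1, h2] at hd
  linear_combination hd

/-- At `x = 0` the coefficients of `g` are, up to sign, coefficients of the convergent `y₂ ∂ₓY₁`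
with index shifted by `y₁y₂`, divided by an integer `e 1`. -/
lemma exists_convergent_exponent {Y1 k g : Ser 3} (hY : IsConvergent Y1)
    (h : ∀ e : Fin 3 →₀ ℕ, e 0 = 0 → e 1 = e 2 →
      coeff e (X 2 * pderiv ℂ 0 Y1) = coeff e (X 1 * X 2 * pderiv ℂ 0 k)) (hg : del g = 0)
    (hg0 : constantCoeff g = 0)
    (hgk : ∀ e : Fin 3 →₀ ℕ, e 0 = 0 → coeff e g = -coeff (e + Finsupp.single 0 1) k / e 1) :
    ∃ g₀ : Ser 3, IsConvergent g₀ ∧ constantCoeff g₀ = 0 ∧ X 0 ∣ g - g₀ := by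
  set g₀ := mulCoeff (fun e : Fin 3 →₀ ℕ => if e 0 = 0 then 1 else 0) g with hg₀
  have hc : ∀ e, coeff e g₀ = (if e 0 = 0 then 1 else 0) * coeff e g := fun e => coeff_mulCoeff _ _ _
  refine ⟨g₀, ?_, ?_, ?_⟩
  · refine ((isConvergent_X 2).mul (hY.pderiv 0)).of_le
      (fun e => (Finsupp.single 1 1 + Finsupp.single 2 1) + e) (add_right_injective _) 1 1 le_rfl
      1 2 (fun e => by simp [add_comm]) fun e => ?_
    rw [hc]
    split_ifs with h0
    · by_cases h12 : e 1 = e 2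
      · rw [h _ (by simpa using h0) (by simpa using h12), hgk e h0]
        have e1 : (X 1 * X 2 * pderiv ℂ 0 k : Ser 3) =
            monomial (Finsupp.single 1 1 + Finsupp.single 2 1) 1 * pderiv ℂ 0 k := by
          rw [X, X, monomial_mul_monomial, one_mul]
        rw [e1, coeff_add_monomial_mul, coeff_pderiv, h0]
        rw [one_mul, one_pow, one_mul, one_mul, one_mul, nnnorm_div, nnnorm_neg, Nat.cast_zero,
          zero_add, mul_one, Complex.nnnorm_natCast]
        rcases Nat.eq_zero_or_pos (e 1) with h1 | h1
        · rw [h1]; simp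
        · exact div_le_self zero_le (by exact_mod_cast h1)
      · rw [del_eq_zero_iff.1 hg e h12]; simp
    · simp
  · rw [← coeff_zero_eq_constantCoeff_apply, hc, coeff_zero_eq_constantCoeff_apply, hg0, mul_zero]
  · rw [X_dvd_iff]
    intro e he
    rw [map_sub, hc, if_pos he, one_mul, sub_self]

lemma X_dvd_expS_sub {σ : Type*} {i : σ} {f g : MvPowerSeries σ ℂ} (hf : constantCoeff f = 0)
    (hg : constantCoeff g = 0) (h : X i ∣ f - g) : X i ∣ expS f - expS g :=
  X_dvd_subst_sub_subst (zeroConst_const hf) (zeroConst_const hg) (fun _ => h) _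

lemma isConvergent_of_coeff_diagonal {c : PowerSeries ℂ} {m : Ser 3} (hm : IsConvergent m)
    (h : ∀ j, j ≠ 0 → PowerSeries.coeff j c = coeff (Finsupp.single 1 j + Finsupp.single 2 j) m)
    (h0 : PowerSeries.constantCoeff c = 0) : IsConvergent c := by
  refine hm.of_le (σ := Unit)
    (fun e => Finsupp.single 1 e.degree + Finsupp.single 2 e.degree) ?_ 1 1 le_rfl 2 0 ?_ ?_
  · intro a b hab
    have := DFunLike.congr_fun hab 1
    simp [Finsupp.degree_eq_sum] at this
    ext
    simpa using this
  · intro e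
    simp [two_mul]
  · intro e
    rw [powerSeries_coeff_eq]
    by_cases he : e.degree = 0
    · rw [he, PowerSeries.coeff_zero_eq_constantCoeff_apply, h0]; simp
    · rw [h _ he]; simp

theorem exists_normalization {l : ℂ} {Y : Fin 3 → Ser 3} (h : IsTransHamSaddleNode l Y) :
    ∃ (Φ : Fin 3 → Ser 3) (a₁ a₂ : ℂ) (c : PowerSeries ℂ), Normalizes Φ Y l a₁ a₂ c ∧
      ((∀ i, IsConvergent (restrMap Y i)) → IsConvergent c) ∧
      ((∀ i, IsConvergent (Y i)) → ∀ i, IsConvergent (restrMap Φ i)) := by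
  obtain ⟨hl, -⟩ := h.basic
  obtain ⟨P, Z, m, hP, hPp, hZ, hm, hm1, hm2, hPc, hZc⟩ := exists_prenormalization h
  obtain ⟨U, k, hU, hU1, hU2, hk, hk0, hkm, hUp⟩ :=
    exists_symplectic_diagonalization hl hZ hm hm1 hm2
  obtain ⟨a₁, c, g, hc0, hc, hg, hg0, hkg, hgk⟩ := exists_normalizing_exponent hk hk0
  set R : Fin 3 → Ser 3 := ![X 0, X 1 * expS g, X 2 * expS (-g)] with hRdef
  have hR : IsTransSymplectic R := isTransSymplectic_exp hg hg0
  have hUz := hU.diffeo.zeroConst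
  have hPz := hP.diffeo.zeroConst
  have hRz := hR.diffeo.zeroConst
  refine ⟨compMap (compMap R U) P, a₁, 1 - a₁, c, ⟨(hR.comp hU).comp hP, hl, by ring, hc0,
    hPp.comp hPz (zeroConst_compMap hRz hUz) (hUp.comp hUz hRz (pushesTo_normalForm hg hg0 hkg))⟩,
    fun hY => ?_, fun hY => ?_⟩
  -- Off the constant term, `c` has the diagonal coefficients of `-k`, equal on `x = 0` to those of
  -- the convergent `m`.
  · refine isConvergent_of_coeff_diagonal (hPc hY).2 (fun j hj => ?_) hc0
    have := X_dvd_iff.1 hkm (Finsupp.single 1 j + Finsupp.single 2 j) (by simp)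
    rw [map_add] at this
    rw [hc j hj]
    linear_combination -this
  · have hYr : ∀ i, IsConvergent (restrMap Y i) := by
      intro i
      fin_cases i
      · exact isConvergent_restr (hY 1)
      · exact isConvergent_restr (hY 2)
    have hPconv := (hPc hYr).1
    have hk1 : lie Z (U 1) = subst U k * U 1 := by
      rw [hUp 1]
      change subst U (k * X 1) = _
      rw [subst_mul hUz.hasSubst, subst_X hUz.hasSubst]
    obtain ⟨g₀, hg₀, hg₀0, hgg⟩ := exists_convergent_exponent (hZc hYr hY 1) (k := k) (g := g)
      (fun e h0 h12 => coeff_X2_mul_pderiv_drift hm hZ.1 hm1 hm2 hU hU1 hU2 hkm hk1 h0 h12)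
      hg hg0 hgk
    have hUX : ∀ i, X 0 ∣ U i - X i := by
      intro i
      fin_cases i
      · simp [hU.1.2]
      · exact hU1
      · exact hU2
    -- The formal map `U` is the identity modulo `x` and disappears on restriction; only the
    -- convergent `P` and the class of `f` modulo `x` remain.
    have key : ∀ f f₀ : Ser 3, IsConvergent f₀ → X 0 ∣ f - f₀ →
        IsConvergent (restr (subst P (subst U f))) := by
      intro f f₀ hf₀ hf
      have h1 := X_dvd_subst_sub_subst hUz (zeroConst_X (σ := Fin 3)) hUX f
      rw [subst_X_eq] at h1
      have h2 := X0_dvd_subst hPz hP.1.2 (dvd_add h1 hf)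
      rw [sub_add_sub_cancel, subst_sub hPz.hasSubst] at h2
      rw [restr_eq_of_dvd h2]
      exact isConvergent_restr (hf₀.subst hPz hPconv)
    have hng : constantCoeff (-g) = 0 := by simp [hg0]
    have hng₀ : constantCoeff (-g₀) = 0 := by simp [hg₀0]
    intro i
    fin_cases i
    · refine key (X 1 * expS g) (X 1 * expS g₀) ((isConvergent_X 1).mul (hg₀.expS hg₀0)) ?_
      rw [← mul_sub]
      exact (X_dvd_expS_sub hg0 hg₀0 hgg).mul_left _
    · refine key (X 2 * expS (-g)) (X 2 * expS (-g₀))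
        ((isConvergent_X 2).mul (hg₀.neg.expS hng₀)) ?_
      rw [← mul_sub]
      refine (X_dvd_expS_sub hng hng₀ ?_).mul_left _
      rw [← neg_sub', dvd_neg]
      exact hgg

end Convergence

end SaddleNode
end

noncomputable section

namespace SaddleNode

/-! ### Invariance and value of the residue. -/

section Residue

lemma constantCoeff_pderiv_mul {σ : Type*} (i : σ) {f g : MvPowerSeries σ ℂ} :
    constantCoeff (pderiv ℂ i (f * g)) = constantCoeff f * constantCoeff (pderiv ℂ i g) +
      constantCoeff g * constantCoeff (pderiv ℂ i f) := by
  rw [pderiv_mul, map_add, map_mul, map_mul]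

lemma constantCoeff_pderiv_lie {n : ℕ} {Y : Fin n → Ser n} (hY : ZeroConst Y) (i : Fin n)
    (h : ∀ j, constantCoeff (pderiv ℂ i (Y j)) = 0) (f : Ser n) :
    constantCoeff (pderiv ℂ i (lie Y f)) = 0 := by
  rw [lie, map_sum, map_sum]
  refine Finset.sum_eq_zero fun j _ => ?_
  rw [constantCoeff_pderiv_mul, hY j, h j, zero_mul, mul_zero, add_zero]

lemma constantCoeff_pderiv_subst {n : ℕ} {Φ : Fin n → Ser n} (hΦ : ZeroConst Φ) (i : Fin n)
    (f : Ser n) : constantCoeff (pderiv ℂ i (subst Φ f)) =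
      ∑ j, constantCoeff (pderiv ℂ j f) * constantCoeff (pderiv ℂ i (Φ j)) := by
  rw [pderiv_subst hΦ, map_sum]
  refine Finset.sum_congr rfl fun j _ => ?_
  rw [map_mul, constantCoeff_subst_of_zeroConst hΦ]

lemma IsPrepared.linear {l : ℂ} {Z : Fin 3 → Ser 3} (h : IsPrepared l Z) : ZeroConst Z ∧
    Z 0 = X 0 ^ 2 ∧ (∀ j, constantCoeff (pderiv ℂ j (Z 1)) = if j = 1 then -l else 0) ∧
      ∀ j, constantCoeff (pderiv ℂ j (Z 2)) = if j = 2 then l else 0 := by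
  obtain ⟨-, F₁, hF₁, F₂, hF₂, rfl⟩ := h
  have m1 := mem_ordIdeal_two.1 (maxIdeal_sq_le hF₁)
  have m2 := mem_ordIdeal_two.1 (maxIdeal_sq_le hF₂)
  have d1 : ∀ j, constantCoeff (pderiv ℂ j F₁) = 0 := m1.2
  have d2 : ∀ j, constantCoeff (pderiv ℂ j F₂) = 0 := m2.2
  refine ⟨fun i => ?_, rfl, fun j => ?_, fun j => ?_⟩
  · fin_cases i
    · simp
    · simp [m1.1]
    · simp [m2.1]
  · change constantCoeff (pderiv ℂ j (-(C l * X 1) + F₁)) = _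
    rw [map_add, map_add, d1, add_zero, map_neg, map_neg, constantCoeff_pderiv_mul]
    fin_cases j <;> simp
  · change constantCoeff (pderiv ℂ j (C l * X 2 + F₂)) = _
    rw [map_add, map_add, d2, add_zero, constantCoeff_pderiv_mul]
    fin_cases j <;> simp

/-- The residue is invariant under fibered conjugacy between prepared forms. -/
lemma residue_eq_of_pushesTo {l l' : ℂ} {Θ Z Z' : Fin 3 → Ser 3} (hΘ : IsFibered Θ)
    (hp : PushesTo Θ Z Z') (hZ : IsPrepared l Z) (hZ' : IsPrepared l' Z') :
    constantCoeff (pderiv ℂ 0 (ydiv Z')) = constantCoeff (pderiv ℂ 0 (ydiv Z)) := by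
  obtain ⟨hΘz, h0, hb⟩ := isFibered_iff.1 hΘ
  obtain ⟨z, z0, z1, z2⟩ := hZ.linear
  obtain ⟨-, -, z1', z2'⟩ := hZ'.linear
  have hl' := hZ'.1
  have hZx : ∀ j, constantCoeff (pderiv ℂ 0 (Z j)) = 0 := by
    intro j
    fin_cases j
    · simp [z0]
    · simp [z1]
    · simp [z2]
  have hd : ∀ f, constantCoeff (pderiv ℂ 0 (lie Z f)) = 0 := constantCoeff_pderiv_lie z 0 hZx
  have e1 := hd (Θ 1)
  have e2 := hd (Θ 2)
  rw [hp, constantCoeff_pderiv_subst hΘz, Fin.sum_univ_three] at e1 e2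
  -- A prepared field has no term linear in `x`, so `l' ≠ 0` forces `Θ 1`, and likewise `Θ 2`, to
  -- have none.
  simp [z1', hl'] at e1
  simp [z2', hl'] at e2
  have key := congrArg (fun f => constantCoeff (pderiv ℂ 0 f))
    (subst_ydiv_mul hΘz h0 (pderiv_X0_sq z0).1 (pderiv_X0_sq z0).2 hp)
  have hdiv : constantCoeff (ydiv Z) = 0 := by simp [ydiv, z1, z2]
  have hdiv' : constantCoeff (ydiv Z') = 0 := by simp [ydiv, z1', z2']
  simp only [map_add, hd, constantCoeff_pderiv_mul, constantCoeff_subst_of_zeroConst hΘz, hdiv,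
    hdiv', constantCoeff_pderiv_subst hΘz, Fin.sum_univ_three, e1, e2, h0, pderiv_X_self,
    map_one, mul_zero, zero_mul, add_zero, zero_add, mul_one] at key
  exact mul_left_cancel₀ hb key

/-- The symplectic preparation that comes with `Y` has divergence `x`; any other prepared form is
fibered conjugate to it and has the same residue. -/
theorem isResidue_iff {l : ℂ} {Y : Fin 3 → Ser 3} (h : IsTransHamSaddleNode l Y) (r : ℂ) :
    IsResidue Y r ↔ r = 1 := by
  obtain ⟨-, -, hY0, hYd⟩ := h.basic
  obtain ⟨-, Φ, Z, hΦ, hp, hZ⟩ := h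
  obtain ⟨Ψ, hΨ, hΦΨ, hΨΦ, -⟩ := exists_inverse hΦ.diffeo
  have hΨz := hΨ.zeroConst
  have hΨs : IsTransSymplectic Ψ := hΦ.symm hΨz hΦΨ
  have hd : ydiv Z = X 0 := by
    rw [hp.ydiv_eq hΦ hΨz hΦΨ (pderiv_X0_sq hY0).1 (pderiv_X0_sq hY0).2, hYd,
      subst_X hΨz.hasSubst, hΨs.1.2]
  constructor
  · rintro ⟨Φ', Z', hΦ', hp', ⟨l', hZ'⟩, rfl⟩
    have hΘ : IsFibered (compMap Φ' Ψ) := by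
      rw [isFibered_iff] at hΦ' ⊢
      refine ⟨zeroConst_compMap hΦ'.1 hΨz, ?_, ?_⟩
      · rw [compMap, hΦ'.2.1, subst_X hΨz.hasSubst, hΨs.1.2]
      · rw [compMap, compMap, brk_subst hΨz hΨs.1.2, (isTransSymplectic_iff.1 hΨs).2.2, mul_one,
          constantCoeff_subst_of_zeroConst hΨz]
        exact hΦ'.2.2
    have := residue_eq_of_pushesTo hΘ ((hp.symm hΨz hΦ.diffeo.zeroConst hΦΨ hΨΦ).comp hΨz
      hΦ'.1.zeroConst hp') hZ hZ'
    rw [hd, pderiv_X_self, map_one, constantCoeff_pderiv] at this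
    exact this
  · rintro rfl
    refine ⟨Φ, Z, hΦ.1, hp, ⟨l, hZ⟩, ?_⟩
    change 1 = coeff _ (ydiv Z)
    rw [hd, coeff_X, if_pos rfl]

end Residue

/-! ### Rigidity of the normal form. -/

section Uniqueness

/-- Setting `Xᵢ = 0` is a ring homomorphism into a domain, with kernel generated by `Xᵢ`. -/
lemma X_dvd_or_dvd {n : ℕ} {i : Fin n} {f g : Ser n} (h : X i ∣ f * g) :
    X i ∣ f ∨ X i ∣ g := by
  set a : Fin n → Ser n := fun j => if j = i then 0 else X j with ha
  have haz : ZeroConst a := fun j => by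
    simp only [ha]; split_ifs <;> simp
  have hd : ∀ f : Ser n, subst a f = 0 → X i ∣ f := fun f hf => by
    have := X_dvd_subst_sub_subst haz zeroConst_X (j := i) (fun j => ?_) f
    · rw [hf, subst_X_eq, zero_sub, dvd_neg] at this
      exact this
    · simp only [ha]
      split_ifs with hj
      · rw [hj, zero_sub, dvd_neg]
      · simp
  obtain ⟨q, hq⟩ := h
  have e := congrArg (subst a) hq
  rw [subst_mul haz.hasSubst, subst_mul haz.hasSubst, subst_X haz.hasSubst] at e
  simp only [ha, if_true, zero_mul] at e
  exact (mul_eq_zero.1 e).imp (hd f) (hd g)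

/-- The equation makes `A` resonant, so its left side is a multiple of `x`. As `A` is a unit, `x`
divides `s`, and `s` does not depend on `x`, hence `s = 0`. What is left is `(x∂ₓ + y₁∂₁) A = t A`:
the constant term gives `t = 0`, and only constants remain. -/
lemma eq_C_of_lie_eq {l : ℂ} (hl : l ≠ 0) {k₁ k₂ A s : Ser 3} {t : ℂ} (h1 : del k₁ = 0)
    (h2 : del k₂ = 0) (hk₁ : constantCoeff k₁ = -l) (hk₂ : constantCoeff k₂ = l)
    (hk : k₁ + k₂ = X 0) (hs0 : pderiv ℂ 0 s = 0) (hs : del s = 0) (hA : constantCoeff A ≠ 0)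
    (h : lie (diagField k₁ k₂) A = (s + C t * X 0) * A) : A = C (constantCoeff A) := by
  have hsc : constantCoeff s = 0 := by
    have := congrArg constantCoeff h
    rw [lie_diagField] at this
    simp only [map_add, map_mul, constantCoeff_X, zero_mul, mul_zero, add_zero] at this
    exact (mul_eq_zero.1 this.symm).resolve_right hA
  have hdA : del A = 0 := by
    refine del_eq_zero_of_lie_eq (q := s + C t * X 0) hl h1 h2 hk₁ hk₂ ?_ ?_ (by rw [h, mul_comm])
    · rw [del_add, hs, del_mul]; simp
    · simp [hsc]
  have hE : lie (diagField k₁ k₂) A = X 0 * (X 0 * pderiv ℂ 0 A + X 1 * pderiv ℂ 1 A) := by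
    rw [lie_diagField, X2_mul_pderiv_of_del hdA]
    linear_combination (X 1 * pderiv ℂ 1 A) * hk
  have hXs : X 0 ∣ s := by
    have h3 : X 0 ∣ s * A := ⟨X 0 * pderiv ℂ 0 A + X 1 * pderiv ℂ 1 A - C t * A, by
      linear_combination hE - h⟩
    refine (X_dvd_or_dvd h3).resolve_right ?_
    rintro ⟨B, hB⟩
    rw [hB] at hA
    simp at hA
  have hs' : s = 0 := by
    ext e
    by_cases he : e 0 = 0
    · exact X_dvd_iff.1 hXs e he
    · have := coeff_X_mul_pderiv 0 s e
      rw [hs0, mul_zero, map_zero] at this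
      exact (mul_eq_zero.1 this.symm).resolve_left (Nat.cast_ne_zero.2 he)
  have hEA : X 0 * pderiv ℂ 0 A + X 1 * pderiv ℂ 1 A = C t * A := by
    apply mul_left_cancel₀ (X_ne_zero (0 : Fin 3))
    rw [← hE, h, hs']; ring
  have hcoeff : ∀ e : Fin 3 →₀ ℕ, ((e 0 : ℂ) + e 1 - t) * coeff e A = 0 := fun e => by
    have := congrArg (coeff e) hEA
    rw [map_add, coeff_X_mul_pderiv, coeff_X_mul_pderiv, coeff_C_mul] at this
    linear_combination this
  have ht : t = 0 := by
    have := hcoeff 0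
    rw [coeff_zero_eq_constantCoeff_apply] at this
    simpa using (mul_eq_zero.1 this).resolve_right hA
  ext e
  rw [coeff_C]
  split_ifs with he
  · rw [he, coeff_zero_eq_constantCoeff_apply]
  · by_cases h12 : e 1 = e 2
    · refine (mul_eq_zero.1 (hcoeff e)).resolve_left ?_
      rw [ht, sub_zero, ← Nat.cast_add, Nat.cast_eq_zero]
      intro h0
      apply he
      ext i
      fin_cases i <;> simp <;> omega
    · exact del_eq_zero_iff.1 hdA e h12

/-- On resonant monomials `x∂ₓ + y₁∂₁` has eigenvalue 1 only at `x` and `y₁y₂`; order two excludes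
`x`. -/
lemma eq_C_mul_X_mul_X {w : Ser 3} (hdel : del w = 0) (hw : w ∈ ordIdeal (Fin 3) 2)
    (h : X 0 * pderiv ℂ 0 w + X 1 * pderiv ℂ 1 w = w) : ∃ β : ℂ, w = C β * (X 1 * X 2) := by
  refine ⟨coeff (Finsupp.single 1 1 + Finsupp.single 2 1) w, ?_⟩
  have hX : (X 1 * X 2 : Ser 3) = monomial (Finsupp.single 1 1 + Finsupp.single 2 1) 1 := by
    rw [X, X, monomial_mul_monomial, one_mul]
  ext e
  rw [coeff_C_mul, hX, coeff_monomial]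
  split_ifs with he
  · rw [he, mul_one]
  · rw [mul_zero]
    by_cases h12 : e 1 = e 2
    · have hc := congrArg (coeff e) h
      rw [map_add, coeff_X_mul_pderiv, coeff_X_mul_pderiv] at hc
      have hc' : ((e 0 : ℂ) + e 1 - 1) * coeff e w = 0 := by linear_combination hc
      rcases mul_eq_zero.1 hc' with h1 | h1
      · have h2 : e 0 + e 1 = 1 := by
          rw [sub_eq_zero] at h1; exact_mod_cast h1
        rw [mem_ordIdeal] at hw
        apply hw
        rw [Finsupp.degree_eq_sum, Fin.sum_univ_three]
        by_contra hlt
        apply he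
        ext i
        fin_cases i <;> simp <;> omega
      · exact h1
    · exact del_eq_zero_iff.1 hdel e h12

lemma pderiv_zero_powerSeries_subst {β : ℂ} (c : PowerSeries ℂ) :
    pderiv ℂ 0 (PowerSeries.subst (C β * (X 1 * X 2) : Ser 3) c) = 0 := by
  rw [pderiv_powerSeries_subst (by simp)]
  simp

lemma del_powerSeries_subst_C_mul {β : ℂ} (c : PowerSeries ℂ) :
    del (PowerSeries.subst (C β * (X 1 * X 2) : Ser 3) c) = 0 := by
  rw [del, pderiv_powerSeries_subst (by simp), pderiv_powerSeries_subst (by simp)]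
  simp only [pderiv_mul, pderiv_C, pderiv_X_self, pderiv_X12, pderiv_X21]
  ring

/-- The first diagonal coefficient of the normal form. -/
def normalCoeff₁ (l a₁ : ℂ) (c : PowerSeries ℂ) : Ser 3 :=
  -C l + C a₁ * X 0 - PowerSeries.subst (X 1 * X 2 : Ser 3) c

/-- The second diagonal coefficient of the normal form. -/
def normalCoeff₂ (l a₂ : ℂ) (c : PowerSeries ℂ) : Ser 3 :=
  C l + C a₂ * X 0 + PowerSeries.subst (X 1 * X 2 : Ser 3) c

lemma normalForm_eq (l a₁ a₂ : ℂ) (c : PowerSeries ℂ) :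
    normalForm l a₁ a₂ c = diagField (normalCoeff₁ l a₁ c) (normalCoeff₂ l a₂ c) := rfl

lemma del_normalCoeff₁ (l a₁ : ℂ) (c : PowerSeries ℂ) : del (normalCoeff₁ l a₁ c) = 0 := by
  rw [normalCoeff₁, del_sub, del_powerSeries_subst]; simp [del]

lemma del_normalCoeff₂ (l a₂ : ℂ) (c : PowerSeries ℂ) : del (normalCoeff₂ l a₂ c) = 0 := by
  rw [normalCoeff₂, del_add, del_powerSeries_subst]; simp [del]

lemma normalCoeff_add {l a₁ a₂ : ℂ} (c : PowerSeries ℂ) (h : a₁ + a₂ = 1) :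
    normalCoeff₁ l a₁ c + normalCoeff₂ l a₂ c = X 0 := by
  have : (C a₁ + C a₂ : Ser 3) = 1 := by rw [← map_add, h, map_one]
  rw [normalCoeff₁, normalCoeff₂]
  linear_combination X 0 * this

lemma constantCoeff_normalCoeff₁ {l a₁ : ℂ} {c : PowerSeries ℂ}
    (hc : PowerSeries.constantCoeff c = 0) : constantCoeff (normalCoeff₁ l a₁ c) = -l := by
  rw [normalCoeff₁, map_sub, constantCoeff_powerSeries_subst constantCoeff_X_mul_X, hc]; simp

lemma constantCoeff_normalCoeff₂ {l a₂ : ℂ} {c : PowerSeries ℂ}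
    (hc : PowerSeries.constantCoeff c = 0) : constantCoeff (normalCoeff₂ l a₂ c) = l := by
  rw [normalCoeff₂, map_add, constantCoeff_powerSeries_subst constantCoeff_X_mul_X, hc]; simp

lemma subst_normalCoeff₁ {Θ : Fin 3 → Ser 3} (hΘ : ZeroConst Θ) (h0 : Θ 0 = X 0) (l a₁ : ℂ)
    (c : PowerSeries ℂ) : subst Θ (normalCoeff₁ l a₁ c) =
      -C l + C a₁ * X 0 - PowerSeries.subst (Θ 1 * Θ 2) c := by
  rw [normalCoeff₁, subst_sub hΘ.hasSubst, subst_add hΘ.hasSubst, subst_neg hΘ,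
    subst_mul hΘ.hasSubst, subst_C, subst_C, subst_X hΘ.hasSubst, h0, subst_powerSeries_subst hΘ]

lemma subst_normalCoeff₂ {Θ : Fin 3 → Ser 3} (hΘ : ZeroConst Θ) (h0 : Θ 0 = X 0) (l a₂ : ℂ)
    (c : PowerSeries ℂ) : subst Θ (normalCoeff₂ l a₂ c) =
      C l + C a₂ * X 0 + PowerSeries.subst (Θ 1 * Θ 2) c := by
  rw [normalCoeff₂, subst_add hΘ.hasSubst, subst_add hΘ.hasSubst,
    subst_mul hΘ.hasSubst, subst_C, subst_C, subst_X hΘ.hasSubst, h0, subst_powerSeries_subst hΘ]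

/-- A factorization of `β y₁ y₂` into two series in the maximal ideal. -/
lemma exists_factor {f g : Ser 3} {β : ℂ} (hβ : β ≠ 0) (hg : constantCoeff g = 0)
    (h : f * g = C β * (X 1 * X 2)) (hf : X 1 ∣ f) :
    ∃ A B : Ser 3, f = X 1 * A ∧ g = X 2 * B ∧ A * B = C β := by
  obtain ⟨A, rfl⟩ := hf
  have h1 : A * g = C β * X 2 :=
    mul_left_cancel₀ (X_ne_zero (1 : Fin 3)) (by linear_combination h)
  have h2 : X 2 ∣ g := by
    refine (X_dvd_or_dvd (Dvd.intro_left _ h1.symm)).resolve_left ?_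
    rintro ⟨A', rfl⟩
    have h3 : A' * g = C β :=
      mul_left_cancel₀ (X_ne_zero (2 : Fin 3)) (by linear_combination h1)
    have := congrArg constantCoeff h3
    rw [map_mul, hg, mul_zero, constantCoeff_C] at this
    exact hβ this.symm
  obtain ⟨B, rfl⟩ := h2
  exact ⟨A, B, rfl, rfl, mul_left_cancel₀ (X_ne_zero (2 : Fin 3)) (by linear_combination h1)⟩

lemma lie_of_lie_X1_mul {k₁ k₂ A q : Ser 3}
    (h : lie (diagField k₁ k₂) (X 1 * A) = q * (X 1 * A)) :
    lie (diagField k₁ k₂) A = (q - k₁) * A := by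
  apply mul_left_cancel₀ (X_ne_zero (1 : Fin 3))
  rw [lie_mul, lie_X] at h
  change _ + A * (k₁ * X 1) = _ at h
  linear_combination h

/-- Symplectic conjugacies between normal forms are linear. -/
lemma exists_linear_of_pushesTo_normalForm {Θ : Fin 3 → Ser 3} (hΘ : IsTransSymplectic Θ)
    {l₁ l₂ a₁ a₂ b₁ b₂ : ℂ} {c e : PowerSeries ℂ} (hl : l₁ ≠ 0) (ha : a₁ + a₂ = 1)
    (hb : b₁ + b₂ = 1) (hc : PowerSeries.constantCoeff c = 0)
    (hp : PushesTo Θ (normalForm l₁ a₁ a₂ c) (normalForm l₂ b₁ b₂ e)) :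
    ∃ M : Matrix (Fin 2) (Fin 2) ℂ, M.det = 1 ∧ Θ = linComp M X := by
  obtain ⟨hz, h0, hbrk⟩ := isTransSymplectic_iff.1 hΘ
  rw [normalForm_eq, normalForm_eq] at hp
  set k₁ := normalCoeff₁ l₁ a₁ c with hk₁
  set k₂ := normalCoeff₂ l₁ a₂ c with hk₂
  have d1 : del k₁ = 0 := del_normalCoeff₁ _ _ _
  have d2 : del k₂ = 0 := del_normalCoeff₂ _ _ _
  have c1 : constantCoeff k₁ = -l₁ := constantCoeff_normalCoeff₁ hc
  have c2 : constantCoeff k₂ = l₁ := constantCoeff_normalCoeff₂ hc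
  have hk : k₁ + k₂ = X 0 := normalCoeff_add c ha
  have p1 : lie (diagField k₁ k₂) (Θ 1) = subst Θ (normalCoeff₁ l₂ b₁ e) * Θ 1 := by
    rw [hp 1]
    change subst Θ (_ * X 1) = _
    rw [subst_mul hz.hasSubst, subst_X hz.hasSubst]
  have p2 : lie (diagField k₁ k₂) (Θ 2) = subst Θ (normalCoeff₂ l₂ b₂ e) * Θ 2 := by
    rw [hp 2]
    change subst Θ (_ * X 2) = _
    rw [subst_mul hz.hasSubst, subst_X hz.hasSubst]
  -- In the target too the diagonal coefficients add up to `x`, so the unknown `e` cancels in the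
  -- product.
  have hw : lie (diagField k₁ k₂) (Θ 1 * Θ 2) = Θ 1 * Θ 2 * X 0 := by
    have hsum := congrArg (subst Θ) (normalCoeff_add (l := l₂) e hb)
    rw [subst_add hz.hasSubst, subst_X hz.hasSubst, h0] at hsum
    rw [lie_mul, p1, p2]
    linear_combination (Θ 1 * Θ 2) * hsum
  have hdw : del (Θ 1 * Θ 2) = 0 :=
    del_eq_zero_of_lie_eq hl d1 d2 c1 c2 (by simp) (by simp) hw
  obtain ⟨β, hβ⟩ : ∃ β : ℂ, Θ 1 * Θ 2 = C β * (X 1 * X 2) := by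
    refine eq_C_mul_X_mul_X hdw
      (mul_mem_ordIdeal (mem_ordIdeal_one.2 (hz 1)) (mem_ordIdeal_one.2 (hz 2))) ?_
    apply mul_left_cancel₀ (X_ne_zero (0 : Fin 3))
    rw [lie_diagField, X2_mul_pderiv_of_del hdw] at hw
    linear_combination hw - X 1 * pderiv ℂ 1 (Θ 1 * Θ 2) * hk
  have hβ0 : β ≠ 0 := by
    rintro rfl
    rw [map_zero, zero_mul] at hβ
    rcases mul_eq_zero.1 hβ with h | h
    · rw [h] at hbrk; simp [brk] at hbrk
    · rw [h] at hbrk; simp [brk] at hbrk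
  rw [subst_normalCoeff₁ hz h0, hβ] at p1
  rw [subst_normalCoeff₂ hz h0, hβ] at p2
  set E := PowerSeries.subst (C β * (X 1 * X 2) : Ser 3) e with hE
  set V := PowerSeries.subst (X 1 * X 2 : Ser 3) c with hV
  have dE0 : pderiv ℂ 0 E = 0 := pderiv_zero_powerSeries_subst e
  have dE : del E = 0 := del_powerSeries_subst_C_mul e
  have dV0 : pderiv ℂ 0 V = 0 := by
    have := pderiv_zero_powerSeries_subst (β := 1) c
    rwa [map_one, one_mul] at this
  have dV : del V = 0 := del_powerSeries_subst c
  have hconst : ∀ {A B : Ser 3}, A * B = C β → constantCoeff A ≠ 0 := fun {A B} h hA => by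
    have := congrArg constantCoeff h
    rw [map_mul, hA, zero_mul, constantCoeff_C] at this
    exact hβ0 this.symm
  have hB : ∀ {α : ℂ} {A B : Ser 3}, α ≠ 0 → A = C α → A * B = C β → B = C (α⁻¹ * β) :=
    fun {α A B} hα hA h => by
      have : (C α⁻¹ : Ser 3) * C α = 1 := by rw [← map_mul, inv_mul_cancel₀ hα, map_one]
      rw [map_mul, ← h, hA]
      linear_combination -B * this
  -- According to which component `y₁` divides, `Θ` is diagonal or antidiagonal; the second case
  -- exchanges the two axes.
  rcases X_dvd_or_dvd (⟨C β * X 2, by rw [hβ]; ring⟩ : X 1 ∣ Θ 1 * Θ 2) with h1 | h1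
  · obtain ⟨A, B, hA, hBe, hAB⟩ := exists_factor hβ0 (hz 2) hβ h1
    rw [hA] at p1
    have hA' : A = C (constantCoeff A) :=
      eq_C_of_lie_eq (s := C (l₁ - l₂) + V - E) (t := b₁ - a₁) hl d1 d2 c1 c2 hk
        (by simp [dE0, dV0]) (by simp [del_add, del_sub, dE, dV]) (hconst hAB)
        (by rw [lie_of_lie_X1_mul p1, hk₁, normalCoeff₁, map_sub, map_sub]; ring)
    have hB' := hB (hconst hAB) hA' hAB
    rw [hA, hBe, hA', hB'] at hbrk
    refine ⟨!![constantCoeff A, 0; 0, (constantCoeff A)⁻¹ * β], ?_, ?_⟩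
    · have := congrArg constantCoeff hbrk
      simpa [brk, pderiv_mul] using this
    · funext i
      fin_cases i
      · exact h0
      · simp only [linComp]
        simp
        rw [hA]; conv_lhs => rw [hA']
        ring
      · simp only [linComp]
        simp
        rw [hBe]; conv_lhs => rw [hB']
        rw [map_mul]; ring
  · obtain ⟨A, B, hA, hBe, hAB⟩ := exists_factor hβ0 (hz 1) (by rw [mul_comm, hβ]) h1
    rw [hA] at p2
    have hA' : A = C (constantCoeff A) :=
      eq_C_of_lie_eq (s := C (l₁ + l₂) + V + E) (t := b₂ - a₁) hl d1 d2 c1 c2 hk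
        (by simp [dE0, dV0]) (by simp [del_add, dE, dV]) (hconst hAB)
        (by rw [lie_of_lie_X1_mul p2, hk₁, normalCoeff₁, map_sub, map_add]; ring)
    have hB' := hB (hconst hAB) hA' hAB
    rw [hA, hBe, hA', hB'] at hbrk
    refine ⟨!![0, (constantCoeff A)⁻¹ * β; constantCoeff A, 0], ?_, ?_⟩
    · have := congrArg constantCoeff hbrk
      simpa [brk, pderiv_mul] using this
    · funext i
      fin_cases i
      · exact h0
      · simp only [linComp]
        simp
        rw [hBe]; conv_lhs => rw [hB']
        rw [map_mul]; ring
      · simp only [linComp]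
        simp
        rw [hA]; conv_lhs => rw [hA']
        ring

/-- The map `Ψ ∘ Φ⁻¹` is a symplectic conjugacy between the two normal forms, hence linear. -/
theorem exists_linComp_of_normalizes {Φ Ψ Y : Fin 3 → Ser 3} {l₁ l₂ a₁ a₂ b₁ b₂ : ℂ}
    {c e : PowerSeries ℂ} (hΦ : Normalizes Φ Y l₁ a₁ a₂ c) (hΨ : Normalizes Ψ Y l₂ b₁ b₂ e) :
    ∃ M : Matrix (Fin 2) (Fin 2) ℂ, M.det = 1 ∧ Ψ = linComp M Φ := by
  obtain ⟨hΦs, hl, ha, hc, hΦp⟩ := hΦ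
  obtain ⟨hΨs, -, hb, -, hΨp⟩ := hΨ
  obtain ⟨Ξ, hΞ, hΦΞ, hΞΦ, -⟩ := exists_inverse hΦs.diffeo
  have hΦz := hΦs.diffeo.zeroConst
  have hΞz := hΞ.zeroConst
  obtain ⟨M, hM, hΘ⟩ := exists_linear_of_pushesTo_normalForm
    (hΨs.comp (hΦs.symm hΞz hΦΞ)) hl ha hb hc
    ((hΦp.symm hΞz hΦz hΦΞ hΞΦ).comp hΞz hΨs.diffeo.zeroConst hΨp)
  refine ⟨M, hM, ?_⟩
  have h1 : Ψ = compMap (compMap Ψ Ξ) Φ := by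
    rw [compMap_assoc hΞz hΦz, hΞΦ, compMap_X]
  rw [h1, hΘ]
  funext i
  rw [compMap]
  fin_cases i
  · exact (subst_X hΦz.hasSubst _)
  · change subst Φ (C (M 0 0) * X 1 + C (M 0 1) * X 2) = _
    rw [subst_add hΦz.hasSubst, subst_mul hΦz.hasSubst, subst_mul hΦz.hasSubst, subst_C, subst_C,
      subst_X hΦz.hasSubst, subst_X hΦz.hasSubst]
    rfl
  · change subst Φ (C (M 1 0) * X 1 + C (M 1 1) * X 2) = _
    rw [subst_add hΦz.hasSubst, subst_mul hΦz.hasSubst, subst_mul hΦz.hasSubst, subst_C, subst_C,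
      subst_X hΦz.hasSubst, subst_X hΦz.hasSubst]
    rfl

end Uniqueness

end SaddleNode
end
theorem mainTheorem9 (l : ℂ) (Y : Fin 3 → Ser 3) (hY : IsTransHamSaddleNode l Y) :
    (∃ (Φ : Fin 3 → Ser 3) (a₁ a₂ : ℂ) (c : PowerSeries ℂ),
      Normalizes Φ Y l a₁ a₂ c ∧
      pullback2 (restrMap Φ) area2 = area2 ∧
      ((∀ i, IsConvergent (restrMap Y i)) → IsConvergent c) ∧
      ((∀ i, IsConvergent (Y i)) → IsAnalyticDiffeo (restrMap Φ))) ∧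
    (∀ r : ℂ, IsResidue Y r ↔ r = 1) ∧
    (∀ (Φ Ψ : Fin 3 → Ser 3) (l₁ l₂ a₁ a₂ b₁ b₂ : ℂ) (c e : PowerSeries ℂ),
      Normalizes Φ Y l₁ a₁ a₂ c → Normalizes Ψ Y l₂ b₁ b₂ e →
        ∃ M : Matrix (Fin 2) (Fin 2) ℂ, M.det = 1 ∧ Ψ = linComp M Φ) := by
  refine ⟨?_, isResidue_iff hY, fun Φ Ψ l₁ l₂ a₁ a₂ b₁ b₂ c e => exists_linComp_of_normalizes⟩
  obtain ⟨Φ, a₁, a₂, c, hΦ, hc, hconv⟩ := exists_normalization hY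
  exact ⟨Φ, a₁, a₂, c, hΦ, hΦ.1.restr_diffeo.2, hc, fun h => ⟨hΦ.1.restr_diffeo.1, hconv h⟩⟩
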